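/- **Setting.** Let $n>3f\ge 0$, let $B\ge 1$ be a batch size, and let $\lambda$ be the security parameter ($n,f,B$ are constants). For every $\lambda$ a set $C_\lambda$ of at most $f$ of the nodes $\mathcal P_1,\dots,\mathcal P_n$ is statically corrupted; the others are honest. The adversary controls the corrupted nodes, the inputs and the schedule of the authenticated asynchronous network; every message between honest nodes is eventually delivered and every process of an honest node keeps running, without any bound on delays. Given are an $(n-f,n)$ threshold signature scheme that is unforgeable under chosen message attacks, a (keyed) collision-resistant hash function $\mathcal H$, an $(n-2f,n)$ erasure code, and a multi-valued validated Byzantine agreement (MVBA). All keys are generated honestly. Unforgeability and collision resistance hold against a class of attacks that are regarded as efficient, and running the adversary together with the honest nodes is an attack of that class. (For $n=3f+1$ one has $n-f=2f+1$ and $n-2f=f+1$.) **The protocol Dumbo-NG.** Each node $\mathcal P_i$ has a FIFO buffer of input transactions and runs the following processes. *Broadcast sender.* For slots $s=1,2,\dots$: let $TX_{i,s}$ be the first $B$ transactions in the buffer (fewer if the buffer is shorter), multicast $\mathrm{Proposal}(s,TX_{i,s},d_{i,s-1},\Sigma_{i,s-1})$ (with $\bot,\bot$ for $s=1$), where $d_{i,s}=\mathcal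 H(TX_{i,s})$, wait for valid signature shares on $i\|s\|d_{i,s}$ from $n-f$ distinct nodes, and combine them into $\Sigma_{i,s}$. *Broadcast receiver*, for each sender $\mathcal P_j$, with a current slot $s$ (initially $1$). For a slot-$1$ proposal with $s=1$: record the batch and send $\mathcal P_j$ a signature share on $j\|1\|\mathcal H(TX_{j,1})$ (a vote; votes for slot $s$ are shares on $j\|s\|\mathcal H(TX_{j,s})$). For the first proposal of slot $s>1$ that carries the digest of the recorded batch $TX_{j,s-1}$ and a valid signature on $j\|s-1\|d_{j,s-1}$: set $\mathsf{fixed}_j[s-1]:=TX_{j,s-1}$ and $(\mathsf{current}_j,\mathsf{digest}_j,\Sigma_j):=(s-1,d_{j,s-1},\Sigma_{j,s-1})$, record the new batch in place of the old one, and vote for it. For a proposal of a later slot $s'>s$ with a valid signature for slot $s'-1$: pull the missing batches, wait until $\mathsf{fixed}_j[s-1],\dots,\mathsf{fixed}_j[s'-1]$ are recorded, update $(\mathsf{current}_j,\mathsf{digest}_j,\Sigma_j)$ to the data for $s'-1$, record the new batch and vote for it. After voting for a slot, move to the next one. *CallHelp / Help.* To pull the batches of $\mathcal P_j$ up to a slot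 $s^*$ with a valid certificate, a node asks, slot by slot from $\mathsf{current}_j+1$ on, all nodes for $\mathsf{fixed}_j[k]$ (adding the signature for the highest requested slot), until it has $n-2f$ fragments from distinct nodes with valid Merkle branches for one common root, from which it decodes and stores $\mathsf{fixed}_j[k]$. A node answers the first request of each node for each $(j,k)$: if the request carries a valid signature for the batch of slot $k$ that is its latest recorded one, it stores this batch as $\mathsf{fixed}_j[k]$; if $\mathsf{fixed}_j[k]$ is stored, it returns its own fragment with the root and the branch of the Merkle tree over the $n$ fragments. *Consensus.* All $\mathsf{ordered}_j$ are initially $0$. In epoch $e=1,2,\dots$ the node waits until $\mathsf{current}_j>\mathsf{ordered}_j$ for at least $n-f$ nodes $j$, and then inputs to $\mathrm{MVBA}[e]$ the vector $(\mathsf{current}_j,\mathsf{digest}_j,\Sigma_j)_{j}$, in which every entry with $\mathsf{current}_j<\mathsf{ordered}_j$ is replaced by the certificate for slot $\mathsf{ordered}_j$ that the previous MVBA output contained. The predicate $Q_e$ accepts a vector $(c_j,d_j,\Sigma_j)_j$ iff, for every $j$, $\Sigma_j$ is a valid signature on $j\|c_j\|d_j$ or $c_j=0$; $c_j>\mathsf{ordered}_j$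 for at least $n-f$ nodes $j$; and $c_j\ge\mathsf{ordered}_j$ for all $j$. When $\mathrm{MVBA}[e]$ outputs $(c_j,d_j,\Sigma_j)_j$, the node pulls missing batches, outputs as block $e$ the lexicographically sorted set of all transactions in $\mathsf{fixed}_j[\mathsf{ordered}_j+1],\dots,\mathsf{fixed}_j[c_j]$ for all $j$, removes them from its buffer, and sets $\mathsf{ordered}_j:=c_j$ for all $j$. **MVBA with quality $q\in(0,1]$** (for instance $q=1/2$). There is an event of negligible probability outside which every instance $\mathrm{MVBA}[e]$ satisfies *termination* (if all honest nodes input values valid for $Q_e$, all honest nodes get an output), *agreement* (honest nodes get the same output) and *external validity* (outputs of honest nodes satisfy $Q_e$), and outside which, conditionally on any record of the progress made before the instance begins (the slot numbers of the certificates held by the nodes when this and the earlier instances began, and which earlier outputs came from the adversary), the output of $\mathrm{MVBA}[e]$ comes from the adversary, i.e. is not the input of any honest node by the time of the first output to an honest node, with probability at most $1-q$: precisely, $\mathbb P(H\cap A_e\setminus\mathrm{bad})\le(1-q)\,\mathbb P(H)$ for every event $H$ in this record on which the instance begins, where $A_e$ is the event that the output comes from the adversary and $\mathrm{bad}$ is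 the exceptional event. **Theorem.** Dumbo-NG is an atomic broadcast protocol against $f<n/3$ Byzantine nodes: except with probability negligible in $\lambda$, all of the following hold. * *Agreement:* if an honest node outputs a transaction, every honest node eventually outputs it. * *Total order:* if two honest nodes have output $\langle tx_0,\dots,tx_a\rangle$ and $\langle tx'_0,\dots,tx'_b\rangle$, then $tx_k=tx'_k$ for all $k\le\min(a,b)$. * *Liveness (strong validity):* every transaction that is input by any honest node is eventually output (by every honest node). Moreover, there is a negligible function $\varepsilon$ such that the following holds for all $\lambda$, every honest $\mathcal P_j$ and every slot $s\ge1$. Let $T$ be the first time at which every honest node has $\mathsf{current}_j\ge s$, let $e_0$ be the number of MVBA instances to which some honest node has given an input by time $T$, and let $K\in\{0,1,2,\dots\}\cup\{\infty\}$ be the least $k$ such that all transactions of $TX_{j,s}$ are eventually contained, at every honest node, in the blocks that it outputs in epochs $1,\dots,e_0+k$ ($K=\infty$ if there is no such $k$ or $T$ does not exist). Then, up to $\varepsilon$, $K$ is stochastically dominated by a geometric variable with mean $1/q$: $$\mathbb P(K>m)\le(1-q)^m+\varepsilon(\lambda)\quad\text{and}\quad \mathbb E[\min(K,M)]\le \frac1q+M\,\varepsilon(\lambda)\qquad\text{for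 all } m,M\in\{0,1,2,\dots\}.$$ -/

import Mathlib

open MeasureTheory
open scoped ENNReal

namespace DumboNG

/-! ## Strings, serialization, Merkle trees -/

/-- Bit strings; transactions, digests, keys, signatures and code fragments are bit strings. -/
abbrev Bits := List Bool

/-- A batch of transactions. -/
abbrev Batch := List Bits

/-- Self-delimiting (injective) serialization of a list of strings. -/
def ser (l : List Bits) : Bits :=
  l.flatMap fun b => (b.flatMap fun x => [true, x]) ++ [false]

/-- The string `j || s || d` that is signed for slot `s` of the broadcast of node `j`. -/
def sigMsg (j s : ℕ) (d : Bits) : Bits := ser [Nat.bits j, Nat.bits s, d]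

/-- Root of the Merkle tree of depth `d` over the leaves `l 0, …, l (2 ^ d - 1)`. -/
def merkleRoot (H : Bits → Bits) : ℕ → (ℕ → Bits) → Bits
  | 0, l => H (ser [l 0])
  | d + 1, l => H (ser [merkleRoot H d l, merkleRoot H d fun i => l (2 ^ d + i)])

/-- Merkle branch of leaf `i`: the siblings on the path from the root down to the leaf. -/
def merkleBranch (H : Bits → Bits) : ℕ → (ℕ → Bits) → ℕ → List Bits
  | 0, _, _ => []
  | d + 1, l, i =>
    if i < 2 ^ d then
      merkleRoot H d (fun k => l (2 ^ d + k)) :: merkleBranch H d l i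
    else
      merkleRoot H d l :: merkleBranch H d (fun k => l (2 ^ d + k)) (i - 2 ^ d)

/-- The string whose hash must be the root, for leaf number `i` and the given branch. -/
def merkleTop (H : Bits → Bits) : List Bits → ℕ → Bits → Bits
  | [], _, leaf => ser [leaf]
  | b :: bs, i, leaf =>
    if i < 2 ^ bs.length then ser [H (merkleTop H bs i leaf), b]
    else ser [b, H (merkleTop H bs (i - 2 ^ bs.length) leaf)]

/-- All strings hashed while a branch is checked, listed from the root down to the leaf. -/
def merklePath (H : Bits → Bits) : List Bits → ℕ → Bits → List Bits
  | [], _, leaf => [ser [leaf]]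
  | b :: bs, i, leaf =>
    merkleTop H (b :: bs) i leaf ::
      merklePath H bs (if i < 2 ^ bs.length then i else i - 2 ^ bs.length) leaf

/-- Validity of a branch of a tree of depth `d`. -/
def merkleVerify (H : Bits → Bits) (d i : ℕ) (root leaf : Bits) (branch : List Bits) : Bool :=
  decide (branch.length = d) && decide (H (merkleTop H branch i leaf) = root)

/-! ## Cryptographic primitives: syntax and correctness -/

/-- The four algorithms of a non-interactive threshold signature scheme for `n` signers. -/
structure SigAlg (n : ℕ) where
  /-- secret key, message -/
  shareSign : Bits → Bits → Bits
  /-- public key, signer, message, share -/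
  shareVerify : Bits → Fin n → Bits → Bits → Bool
  /-- public key, message, one optional share per signer -/
  combine : Bits → Bits → (Fin n → Option Bits) → Bits
  /-- public key, message, signature -/
  verify : Bits → Bits → Bits → Bool

/-- A `(t, n)` threshold signature scheme: the algorithms, key generation for every security
parameter (public key and one secret key per node), and correctness. -/
structure ThresholdSig (n t : ℕ) extends SigAlg n where
  gen : ℕ → PMF (Bits × (Fin n → Bits))
  share_correct : ∀ l, ∀ K ∈ (gen l).support, ∀ i m,
    shareVerify K.1 i m (shareSign (K.2 i) m) = true
  combine_correct : ∀ l, ∀ K ∈ (gen l).support, ∀ m (c : Fin n → Option Bits),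
    (∀ i σ, c i = some σ → shareVerify K.1 i m σ = true) →
    t ≤ (Finset.univ.filter fun i => (c i).isSome).card →
    verify K.1 m (combine K.1 m c) = true

/-- A keyed family of hash functions. -/
structure HashFamily where
  gen : ℕ → PMF Bits
  eval : Bits → Bits → Bits

/-- A `(k, n)` erasure code: any `k` of the `n` fragments determine the encoded batch. -/
structure ErasureCode (k n : ℕ) where
  encode : Batch → Fin n → Bits
  decode : (Fin n → Option Bits) → Batch
  decode_encode : ∀ w (c : Fin n → Option Bits),
    (∀ i m, c i = some m → m = encode w i) →
    k ≤ (Finset.univ.filter fun i => (c i).isSome).card → decode c = w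

/-! ## The protocol: messages and local state -/

/-- An entry `(current_j, digest_j, Σ_j)` of a vector of broadcast certificates. -/
structure Cert where
  slot : ℕ
  digest : Bits
  sig : Bits
deriving DecidableEq, Countable

/-- Certificate vectors; these are the values that the MVBA instances agree on. -/
abbrev Vec (n : ℕ) := Fin n → Cert

inductive Msg (n : ℕ) where
  /-- `Proposal(s, TX_s, digest_{s-1}, Σ_{s-1})`, the last two being absent for `s = 1` -/
  | proposal (s : ℕ) (tx : Batch) (cert : Option (Bits × Bits))
  | vote (s : ℕ) (share : Bits)
  | callHelp (j : Fin n) (k : ℕ) (sig : Option Bits)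
  | help (j : Fin n) (k : ℕ) (root leaf : Bits) (branch : List Bits)
deriving DecidableEq, Countable

/-- Local state of a node. The processes of a node share it; the fields `queue`, `votes`, `calls`
and `helps` hold the messages received, in order of arrival. -/
structure Node (n : ℕ) where
  buffer : List Bits := []
  /-- broadcast sender: current slot, the batch proposed in it (if already multicast), and the
  certificate (digest, signature) of the previous slot -/
  sendSlot : ℕ := 1
  sendBatch : Option Batch := none
  sendCert : Option (Bits × Bits) := none
  votes : List (Fin n × ℕ × Bits) := []
  /-- broadcast receivers, one for each sender `j`: unhandled proposals, slots for which a
  proposal was handled, current slot, the latest batch with its slot number, and a proposal for a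
  later slot that waits for missing batches -/
  queue : Fin n → List (ℕ × Batch × Option (Bits × Bits)) := fun _ => []
  seen : Fin n → List ℕ := fun _ => []
  recvSlot : Fin n → ℕ := fun _ => 1
  latest : Fin n → Option (ℕ × Batch) := fun _ => none
  jump : Fin n → Option (ℕ × Batch × Bits × Bits) := fun _ => none
  /-- `fixed-TX_j[k]` -/
  fixed : Fin n → ℕ → Option Batch := fun _ _ => none
  /-- `current-cert` -/
  current : Vec n := fun _ => ⟨0, [], []⟩
  /-- the messages for which this node has issued a signature share -/
  signed : List Bits := []
  /-- `CallHelp` daemon: `max-missing_j` with digest and certificate; the loop variable `k`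
  of a running loop, with a flag telling whether the request for `k` was multicast -/
  maxMissing : Vec n := fun _ => ⟨0, [], []⟩
  loop : Fin n → Option (ℕ × Bool) := fun _ => none
  helps : List (Fin n × Fin n × ℕ × Bits × Bits × List Bits) := []
  /-- `Help` daemon: unhandled requests `(requester, j, k, Σ)` and the handled `(requester, j, k)` -/
  calls : List (Fin n × Fin n × ℕ × Option Bits) := []
  answered : List (Fin n × Fin n × ℕ) := []
  /-- consensus: epoch, the ordered indices with the certificates that were agreed for them,
  inputs to and outputs from the MVBA instances, and the blocks output so far -/
  epoch : ℕ := 1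
  ordered : Vec n := fun _ => ⟨0, [], []⟩
  mvbaIn : ℕ → Option (Vec n) := fun _ => none
  mvbaOut : ℕ → Option (Vec n) := fun _ => none
  blocks : List (List Bits) := []

/-- Keys: public key and secret keys of the threshold signature, and the hash key. -/
structure Setup (n : ℕ) where
  pk : Bits
  sk : Fin n → Bits
  hk : Bits
deriving Countable

/-- The parameters and algorithms that the protocol is built from. -/
structure System (n f : ℕ) where
  batchSize : ℕ
  sig : SigAlg n
  hash : Bits → Bits → Bits
  code : ErasureCode (n - 2 * f) n

/-- The processes run by a node. -/
inductive Proc (n : ℕ) where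
  | sender
  | receiver (j : Fin n)
  | callHelp (j : Fin n)
  | help
  | consensus
deriving DecidableEq, Countable

section Protocol

variable {n f : ℕ} (Y : System n f) (S : Setup n)

/-- Hash of a batch. -/
def digest (tx : Batch) : Bits := Y.hash S.hk (ser tx)

/-- Leaves of the Merkle tree over the `n` fragments of a batch (padded with empty strings). -/
def leaves (tx : Batch) (k : ℕ) : Bits :=
  if h : k < n then Y.code.encode tx ⟨k, h⟩ else []

/-- `Sig-Verify(j || c.slot || c.digest, c.sig)`. -/
def certValid (j : Fin n) (c : Cert) : Bool :=
  Y.sig.verify S.pk (sigMsg j c.slot c.digest) c.sig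

def multicast (m : Msg n) : List (Fin n × Msg n) := (List.finRange n).map fun d => (d, m)

/-- The valid shares received for slot `s` of the own broadcast: the first one from every voter. -/
def validShares (i : Fin n) (s : ℕ) (tx : Batch) (nd : Node n) (j : Fin n) : Option Bits :=
  (nd.votes.find? fun w => decide (w.1 = j) && decide (w.2.1 = s) &&
    Y.sig.shareVerify S.pk j (sigMsg i s (digest Y S tx)) w.2.2).map fun w => w.2.2

/-- One step of the broadcast sender: multicast the proposal of the current slot, or, once there
are `n - f` valid shares from distinct nodes, combine them and move to the next slot. -/
def senderStep (i : Fin n) (nd : Node n) : Node n × List (Fin n × Msg n) :=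
  match nd.sendBatch with
  | none =>
    let tx := nd.buffer.take Y.batchSize
    ({ nd with sendBatch := some tx }, multicast (.proposal nd.sendSlot tx nd.sendCert))
  | some tx =>
    let c := validShares Y S i nd.sendSlot tx nd
    if n - f ≤ (Finset.univ.filter fun j => (c j).isSome).card then
      let d := digest Y S tx
      ({ nd with
          sendCert := some (d, Y.sig.combine S.pk (sigMsg i nd.sendSlot d) c)
          sendSlot := nd.sendSlot + 1
          sendBatch := none }, [])
    else (nd, [])

/-- Record the batch of slot `s` of the broadcast of `j`, vote for it, move to slot `s + 1`. -/
def castVote (i j : Fin n) (s : ℕ) (tx : Batch) (nd : Node n) : Node n × List (Fin n × Msg n) :=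
  let m := sigMsg j s (digest Y S tx)
  ({ nd with
      signed := m :: nd.signed
      latest := Function.update nd.latest j (some (s, tx))
      recvSlot := Function.update nd.recvSlot j (s + 1) },
    [(j, .vote s (Y.sig.shareSign (S.sk i) m))])

/-- `Pull(j, c.slot, c.digest, c.sig)` handed to the node's own `CallHelp` daemon. -/
def pull (j : Fin n) (c : Cert) (nd : Node n) : Node n :=
  if (nd.maxMissing j).slot < c.slot ∧ (nd.current j).slot < c.slot ∧ certValid Y S j c = true then
    { nd with
        maxMissing := Function.update nd.maxMissing j c
        loop := match nd.loop j with
          | none => Function.update nd.loop j (some ((nd.current j).slot + 1, false))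
          | some _ => nd.loop }
  else nd

/-- One step of the broadcast receiver for sender `j`: resume a proposal that waits for missing
batches, or handle the next received proposal. -/
def receiverStep (i j : Fin n) (nd : Node n) : Node n × List (Fin n × Msg n) :=
  match nd.jump j with
  | some (s', tx, d, σ) =>
    if ∀ k ∈ List.range s', nd.recvSlot j - 1 ≤ k → 1 ≤ k → (nd.fixed j k).isSome = true then
      castVote Y S i j s' tx
        { nd with
            current := Function.update nd.current j ⟨s' - 1, d, σ⟩
            jump := Function.update nd.jump j none }
    else (nd, [])
  | none =>
    match nd.queue j with
    | [] => (nd, [])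
    | (s', tx, cert) :: rest =>
      let nd₁ := { nd with queue := Function.update nd.queue j rest }
      if s' ∈ nd.seen j then (nd₁, []) else
      let nd₂ := { nd₁ with seen := Function.update nd.seen j (s' :: nd.seen j) }
      if s' = nd.recvSlot j then
        if s' = 1 then castVote Y S i j 1 tx nd₂ else
        match cert, nd.latest j with
        | some (d, σ), some (k, tx₀) =>
          if k = s' - 1 ∧ d = digest Y S tx₀ ∧ certValid Y S j ⟨s' - 1, d, σ⟩ = true then
            castVote Y S i j s' tx
              { nd₂ with
                  fixed := Function.update nd.fixed j
                    (Function.update (nd.fixed j) (s' - 1) (some tx₀))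
                  current := Function.update nd.current j ⟨s' - 1, d, σ⟩ }
          else (nd₂, [])
        | _, _ => (nd₂, [])
      else if nd.recvSlot j < s' then
        match cert with
        | some (d, σ) =>
          if certValid Y S j ⟨s' - 1, d, σ⟩ = true then
            (pull Y S j ⟨s' - 1, d, σ⟩
              { nd₂ with jump := Function.update nd.jump j (some (s', tx, d, σ)) }, [])
          else (nd₂, [])
        | none => (nd₂, [])
      else (nd₂, [])

/-- The fragments of `fixed-TX_j[k]` received with valid Merkle branches for `root`, the first one
from every node. -/
def fragments (j : Fin n) (k : ℕ) (root : Bits) (nd : Node n) (s : Fin n) : Option Bits :=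
  (nd.helps.find? fun w => decide (w.1 = s) && decide (w.2.1 = j) && decide (w.2.2.1 = k) &&
    decide (w.2.2.2.1 = root) &&
    merkleVerify (Y.hash S.hk) (Nat.clog 2 n) s root w.2.2.2.2.1 w.2.2.2.2.2).map
      fun w => w.2.2.2.2.1

/-- A received Merkle root with valid fragments of `fixed-TX_j[k]` from `n - 2 f` distinct nodes. -/
def fullRoot (j : Fin n) (k : ℕ) (nd : Node n) : Option Bits :=
  (nd.helps.map fun w => w.2.2.2.1).find? fun root =>
    decide (n - 2 * f ≤ (Finset.univ.filter fun s => (fragments Y S j k root nd s).isSome).card)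

/-- One step of the `CallHelp` daemon for the broadcast of `j`. -/
def callHelpStep (j : Fin n) (nd : Node n) : Node n × List (Fin n × Msg n) :=
  match nd.loop j with
  | none => (nd, [])
  | some (k, asked) =>
    let c := nd.maxMissing j
    if c.slot < k then ({ nd with loop := Function.update nd.loop j none }, [])
    else if asked = false then
      ({ nd with loop := Function.update nd.loop j (some (k, true)) },
        multicast (.callHelp j k (if k < c.slot then none else some c.sig)))
    else
      match fullRoot Y S j k nd with
      | none => (nd, [])
      | some root =>
        ({ nd with
            fixed := Function.update nd.fixed j (Function.update (nd.fixed j) k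
              (some (Y.code.decode (fragments Y S j k root nd))))
            loop := Function.update nd.loop j (some (k + 1, false)) }, [])

/-- One step of the `Help` daemon: handle the next received request. -/
def helpStep (i : Fin n) (nd : Node n) : Node n × List (Fin n × Msg n) :=
  match nd.calls with
  | [] => (nd, [])
  | (src, j, k, sig) :: rest =>
    let nd₁ := { nd with calls := rest }
    if (src, j, k) ∈ nd.answered then (nd₁, []) else
    let nd₂ := { nd₁ with answered := (src, j, k) :: nd.answered }
    let nd₃ :=
      match nd.latest j, sig with
      | some (s, tx), some σ =>
        if s = k ∧ certValid Y S j ⟨k, digest Y S tx, σ⟩ = true then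
          { nd₂ with
              fixed := Function.update nd.fixed j (Function.update (nd.fixed j) k (some tx)) }
        else nd₂
      | _, _ => nd₂
    match nd₃.fixed j k with
    | none => (nd₃, [])
    | some tx =>
      let H := Y.hash S.hk
      let d := Nat.clog 2 n
      (nd₃, [(src, .help j k (merkleRoot H d (leaves Y tx)) (leaves Y tx i)
        (merkleBranch H d (leaves Y tx) i))])

/-- The predicate `Q_e` of the MVBA instance of an epoch, given the ordered indices. -/
def ValidVec (ordered v : Vec n) : Prop :=
  (∀ j, certValid Y S j (v j) = true ∨ (v j).slot = 0) ∧
  n - f ≤ (Finset.univ.filter fun j => (ordered j).slot < (v j).slot).card ∧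
  ∀ j, (ordered j).slot ≤ (v j).slot

/-- The node's MVBA input: `current-cert`, where an entry that lags behind the slot already
ordered is replaced by the certificate that the previous MVBA instances agreed on. -/
def inputVec (nd : Node n) : Vec n :=
  fun j => if (nd.ordered j).slot ≤ (nd.current j).slot then nd.current j else nd.ordered j

/-- The slots of the broadcast of `j` that are ordered when the agreed vector is `v`. -/
def newSlots (nd : Node n) (v : Vec n) (j : Fin n) : List ℕ :=
  List.range' ((nd.ordered j).slot + 1) ((v j).slot - (nd.ordered j).slot)

/-- All batches of the broadcast of `j` that are ordered by `v` are recorded. -/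
def complete (nd : Node n) (v : Vec n) (j : Fin n) : Bool :=
  (newSlots nd v j).all fun k => (nd.fixed j k).isSome

/-- The block of an epoch: the set of all newly ordered transactions, sorted. -/
def blockOf (nd : Node n) (v : Vec n) : List Bits :=
  (((List.finRange n).flatMap fun j =>
    (newSlots nd v j).flatMap fun k => (nd.fixed j k).getD []).toFinset).sort (· ≤ ·)

/-- One step of the consensus process: input to the MVBA instance of the epoch once `n - f`
broadcasts have grown; after its output, fetch what is missing and then output the block. -/
def consensusStep (nd : Node n) : Node n × List (Fin n × Msg n) :=
  match nd.mvbaIn nd.epoch, nd.mvbaOut nd.epoch with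
  | none, _ =>
    if n - f ≤ (Finset.univ.filter fun j => (nd.ordered j).slot < (nd.current j).slot).card then
      ({ nd with mvbaIn := Function.update nd.mvbaIn nd.epoch (some (inputVec nd)) }, [])
    else (nd, [])
  | some _, none => (nd, [])
  | some _, some v =>
    if ∀ j, complete nd v j = true then
      let b := blockOf nd v
      ({ nd with
          blocks := nd.blocks ++ [b]
          buffer := nd.buffer.filter fun tx => decide (tx ∉ b)
          ordered := v
          epoch := nd.epoch + 1 }, [])
    else
      ((List.finRange n).foldl
        (fun nd' j => if complete nd v j = true then nd' else pull Y S j (v j) nd') nd, [])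

/-- One step of a process of node `i`: new local state and messages to send. -/
def runProcess (i : Fin n) (p : Proc n) (nd : Node n) : Node n × List (Fin n × Msg n) :=
  match p with
  | .sender => senderStep Y S i nd
  | .receiver j => receiverStep Y S i j nd
  | .callHelp j => callHelpStep Y S j nd
  | .help => helpStep Y S i nd
  | .consensus => consensusStep Y S nd

/-- A message from `src` arrives. -/
def receive (src : Fin n) (m : Msg n) (nd : Node n) : Node n :=
  match m with
  | .proposal s tx cert =>
    { nd with queue := Function.update nd.queue src (nd.queue src ++ [(s, tx, cert)]) }
  | .vote s σ => { nd with votes := nd.votes ++ [(src, s, σ)] }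
  | .callHelp j k sig => { nd with calls := nd.calls ++ [(src, j, k, sig)] }
  | .help j k root leaf branch => { nd with helps := nd.helps ++ [(src, j, k, root, leaf, branch)] }

end Protocol

/-! ## Executions -/

/-- The events of an execution. `input i tx`: transaction `tx` enters the buffer of `i`.
`deliver src dst m`: the network delivers `m`. `run i p`: process `p` of node `i` makes a step.
`mvba i v`: the MVBA instance of the current epoch of `i` outputs `v` to `i`. -/
inductive Label (n : ℕ) where
  | input (i : Fin n) (tx : Bits)
  | deliver (src dst : Fin n) (m : Msg n)
  | run (i : Fin n) (p : Proc n)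
  | mvba (i : Fin n) (v : Vec n)
deriving Countable

/-- Global state: the local states of the honest nodes and the messages they have sent
(as source, destination, message). -/
structure Config (n : ℕ) where
  node : Fin n → Node n := fun _ => {}
  sent : List (Fin n × Fin n × Msg n) := []

/-- An outcome: the keys and the infinite sequence of events. -/
abbrev Outcome (n : ℕ) := Setup n × (ℕ → Label n)

instance (n : ℕ) : MeasurableSpace (Setup n) := ⊤
instance (n : ℕ) : MeasurableSpace (Label n) := ⊤

section Execution

variable {n f : ℕ} (Y : System n f) (C : Finset (Fin n))

/-- Effect of an event when the nodes in `C` are corrupted. A corrupted node may send any message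
at any time under its own name; a message of an honest node is only delivered if it was sent. An
event that is impossible has no effect. -/
def applyLabel (S : Setup n) (g : Config n) (a : Label n) : Config n :=
  match a with
  | .input i tx =>
    if i ∈ C then g else
      let nd := g.node i
      { g with node := Function.update g.node i { nd with buffer := nd.buffer ++ [tx] } }
  | .deliver src dst m =>
    if dst ∉ C ∧ (src ∈ C ∨ (src, dst, m) ∈ g.sent) then
      { g with node := Function.update g.node dst (receive src m (g.node dst)) }
    else g
  | .run i p =>
    if i ∈ C then g else
      let r := runProcess Y S i p (g.node i)
      { node := Function.update g.node i r.1
        sent := g.sent ++ r.2.map fun w => (i, w.1, w.2) }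
  | .mvba i v =>
    let nd := g.node i
    if i ∉ C ∧ (nd.mvbaIn nd.epoch).isSome = true ∧ (nd.mvbaOut nd.epoch).isNone = true then
      { g with node :=
          Function.update g.node i { nd with mvbaOut := Function.update nd.mvbaOut nd.epoch (some v) } }
    else g

/-- The global state after the first `t` events. -/
def exec (x : Outcome n) : ℕ → Config n
  | 0 => {}
  | t + 1 => applyLabel Y C x.1 (exec x t) (x.2 t)

/-- Local state of node `i` after `t` events. -/
def nodeAt (x : Outcome n) (t : ℕ) (i : Fin n) : Node n := (exec Y C x t).node i

/-- Asynchronous network: every message between honest nodes is eventually delivered, and every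
process of an honest node makes infinitely many steps. There is no bound on delays. -/
def Fair (x : Outcome n) : Prop :=
  (∀ t src dst m, src ∉ C → dst ∉ C → (src, dst, m) ∈ (exec Y C x t).sent →
    ∃ t', (src, dst, m) ∈ (exec Y C x t').sent ∧ x.2 t' = .deliver src dst m) ∧
  ∀ i, i ∉ C → ∀ p t, ∃ t', t ≤ t' ∧ x.2 t' = .run i p

/-! ### The properties of atomic broadcast -/

/-- The sequence of transactions output by node `i` within the first `t` events. -/
def output (x : Outcome n) (t : ℕ) (i : Fin n) : List Bits := (nodeAt Y C x t i).blocks.flatten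

def Agreement (x : Outcome n) : Prop :=
  ∀ i i', i ∉ C → i' ∉ C → ∀ t, ∀ tx ∈ output Y C x t i, ∃ t', tx ∈ output Y C x t' i'

def TotalOrder (x : Outcome n) : Prop :=
  ∀ i i', i ∉ C → i' ∉ C → ∀ (t t' k : ℕ) (a b : Bits),
    (output Y C x t i)[k]? = some a → (output Y C x t' i')[k]? = some b → a = b

/-- Strong validity: what any honest node inputs is eventually output (by every honest node). -/
def Liveness (x : Outcome n) : Prop :=
  ∀ i, i ∉ C → ∀ t tx, x.2 t = .input i tx → ∀ i', i' ∉ C → ∃ t', tx ∈ output Y C x t' i'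

/-! ### The properties of the MVBA instances -/

/-- Termination, agreement and external validity of the MVBA instance of epoch `e`. -/
def MvbaSafe (x : Outcome n) (e : ℕ) : Prop :=
  ((∀ i, i ∉ C → ∃ t v, (nodeAt Y C x t i).epoch = e ∧ (nodeAt Y C x t i).mvbaIn e = some v ∧
      ValidVec Y x.1 (nodeAt Y C x t i).ordered v) →
    ∀ i, i ∉ C → ∃ t, ((nodeAt Y C x t i).mvbaOut e).isSome = true) ∧
  (∀ i i', i ∉ C → i' ∉ C → ∀ t t' v v', (nodeAt Y C x t i).mvbaOut e = some v →
    (nodeAt Y C x t' i').mvbaOut e = some v' → v = v') ∧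
  ∀ i, i ∉ C → ∀ t v, (nodeAt Y C x t i).epoch = e → (nodeAt Y C x t i).mvbaOut e = some v →
    ValidVec Y x.1 (nodeAt Y C x t i).ordered v

/-- The output of the MVBA instance of epoch `e` was input by the adversary: when it was first
output to an honest node, no honest node had input it. -/
def AdvOutput (x : Outcome n) (e : ℕ) : Prop :=
  ∃ t i v, i ∉ C ∧ (nodeAt Y C x t i).mvbaOut e = some v ∧
    (∀ t' < t, ∀ i', i' ∉ C → (nodeAt Y C x t' i').mvbaOut e = none) ∧
    ∀ i', i' ∉ C → (nodeAt Y C x t i').mvbaIn e ≠ some v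

/-- Some honest node has given its input to the MVBA instance of epoch `e`. -/
def Begun (x : Outcome n) (e t : ℕ) : Prop :=
  ∃ i, i ∉ C ∧ ((nodeAt Y C x t i).mvbaIn e).isSome = true

open Classical in
/-- The slot numbers of the certificates held by the nodes when the instance of `e` begins. -/
noncomputable def slotsAtStart (x : Outcome n) (e : ℕ) : Fin n → Fin n → ℕ :=
  if h : ∃ t, Begun Y C x e t then
    fun i j => ((nodeAt Y C x (Nat.find h) i).current j).slot
  else fun _ _ => 0

/-- What the quality of the instance of epoch `e` is conditioned on: the instance begins, and the
record of slot numbers at the beginning of the instances `0, …, e` and of those among the earlier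
instances whose output came from the adversary lies in `R`. -/
def History (e : ℕ) (R : Set ((Fin (e + 1) → Fin n → Fin n → ℕ) × Set (Fin e))) :
    Set (Outcome n) :=
  {x | (∃ t, Begun Y C x e t) ∧
    ((fun e' : Fin (e + 1) => slotsAtStart Y C x e'), {e' : Fin e | AdvOutput Y C x e'}) ∈ R}

/-! ### Number of MVBA instances needed -/

/-- The batch that node `j` proposes in slot `s` of its broadcast is `b`. -/
def Proposed (x : Outcome n) (j : Fin n) (s : ℕ) (b : Batch) : Prop :=
  ∃ t, (nodeAt Y C x t j).sendSlot = s ∧ (nodeAt Y C x t j).sendBatch = some b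

/-- All honest nodes hold a certificate for slot `s` or a later slot of the broadcast of `j`. -/
def Certified (x : Outcome n) (j : Fin n) (s t : ℕ) : Prop :=
  ∀ i, i ∉ C → s ≤ ((nodeAt Y C x t i).current j).slot

/-- The number of MVBA instances that have begun at some honest node within `t` events. -/
def begunCount (x : Outcome n) (t : ℕ) : ℕ :=
  (Finset.univ.filter fun i => i ∉ C).sup fun i =>
    if ((nodeAt Y C x t i).mvbaIn (nodeAt Y C x t i).epoch).isSome = true
    then (nodeAt Y C x t i).epoch else (nodeAt Y C x t i).epoch - 1

/-- Every honest node outputs all transactions of slot `s` of the broadcast of `j` at the latest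
with the `m`-th MVBA instance that begins after all honest nodes are `Certified` for the slot. -/
def OutputWithin (x : Outcome n) (j : Fin n) (s m : ℕ) : Prop :=
  ∃ t₀ b t, Certified Y C x j s t₀ ∧ (∀ t' < t₀, ¬ Certified Y C x j s t') ∧
    Proposed Y C x j s b ∧
    ∀ i, i ∉ C → ∀ tx ∈ b,
      tx ∈ ((nodeAt Y C x t i).blocks.take (begunCount Y C x t₀ + m)).flatten

/-- The number of MVBA instances needed to output slot `s` of the broadcast of `j`. -/
noncomputable def instancesNeeded (x : Outcome n) (j : Fin n) (s : ℕ) : ℕ∞ :=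
  ⨅ m ∈ {m : ℕ | OutputWithin Y C x j s m}, (m : ℕ∞)

end Execution

/-! ## Security notions -/

/-- Negligible functions of the security parameter. -/
def Negligible (ε : ℕ → ℝ≥0∞) : Prop :=
  ∀ c : ℕ, ∃ N : ℕ, ∀ l ≥ N, ε l ≤ ((l : ℝ≥0∞) ^ c)⁻¹

/-- An attack on a threshold signature scheme, as an experiment for every security parameter: the
keys, the corrupted signers, the pairs (honest signer, message) for which a share was issued on
request by time `t`, and the pairs (message, signature) presented as forgeries at time `t`. -/
structure ForgeryAttack (n : ℕ) where
  Ω : ℕ → Type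
  mΩ : ∀ l, MeasurableSpace (Ω l)
  μ : ∀ l, @Measure (Ω l) (mΩ l)
  corrupt : ℕ → Finset (Fin n)
  keys : ∀ l, Ω l → Bits × (Fin n → Bits)
  issued : ∀ l, Ω l → ℕ → Set (Fin n × Bits)
  shown : ∀ l, Ω l → ℕ → Set (Bits × Bits)

/-- Unforgeability under chosen message attacks: in an attack of the class with properly generated
keys and fewer than `t` corrupted signers, it happens only with negligible probability that a valid
signature is presented on a message for which fewer than `t` signers are corrupted or have issued
a share. -/
def UnforgeableAgainst {n t : ℕ} (sig : ThresholdSig n t) (𝓐 : Set (ForgeryAttack n)) : Prop :=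
  ∀ A ∈ 𝓐, (∀ l K, A.μ l {ω | A.keys l ω = K} = sig.gen l K) →
    (∀ l, (A.corrupt l).card < t) →
    Negligible fun l => A.μ l {ω | ∃ τ m σ, (m, σ) ∈ A.shown l ω τ ∧
      sig.verify (A.keys l ω).1 m σ = true ∧
      ({i | i ∈ A.corrupt l ∨ (i, m) ∈ A.issued l ω τ} : Set (Fin n)).ncard < t}

/-- An attack on a hash family: the key and the pairs of strings presented as collisions. -/
structure CollisionAttack where
  Ω : ℕ → Type
  mΩ : ∀ l, MeasurableSpace (Ω l)
  μ : ∀ l, @Measure (Ω l) (mΩ l)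
  key : ∀ l, Ω l → Bits
  shown : ∀ l, Ω l → Set (Bits × Bits)

/-- Collision resistance against a class of attacks. -/
def CollisionResistantAgainst (hash : HashFamily) (𝓐 : Set CollisionAttack) : Prop :=
  ∀ A ∈ 𝓐, (∀ l k, A.μ l {ω | A.key l ω = k} = hash.gen l k) →
    Negligible fun l => A.μ l {ω | ∃ a b, (a, b) ∈ A.shown l ω ∧ a ≠ b ∧
      hash.eval (A.key l ω) a = hash.eval (A.key l ω) b}

/-- The class of attacks that are regarded as efficient. -/
structure AttackClass (n : ℕ) where
  forgers : Set (ForgeryAttack n)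
  finders : Set CollisionAttack

/-- An adversary together with its environment: for every security parameter the statically
corrupted nodes and the resulting law of the outcome. -/
structure Ensemble (n : ℕ) where
  corrupt : ℕ → Finset (Fin n)
  law : ∀ _ : ℕ, Measure (Outcome n)
  isProb : ∀ l, IsProbabilityMeasure (law l)

section Attacks

variable {n f : ℕ} (Y : System n f)

/-- The signatures that honest nodes verify in an outcome: the certificates they hold or wait with,
those presented in requests for the batch they hold, and those output by MVBA instances. -/
def shownSigs (C : Finset (Fin n)) (x : Outcome n) (t : ℕ) : Set (Bits × Bits) :=
  {w | ∃ i j, i ∉ C ∧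
    ((0 < ((nodeAt Y C x t i).current j).slot ∧
        w = (sigMsg j ((nodeAt Y C x t i).current j).slot ((nodeAt Y C x t i).current j).digest,
          ((nodeAt Y C x t i).current j).sig)) ∨
      (∃ s tx d σ, (nodeAt Y C x t i).jump j = some (s, tx, d, σ) ∧
        w = (sigMsg j (s - 1) d, σ)) ∨
      (∃ src k tx σ, (src, j, k, some σ) ∈ (nodeAt Y C x t i).calls ∧
        (nodeAt Y C x t i).latest j = some (k, tx) ∧
        w = (sigMsg j k (digest Y x.1 tx), σ)) ∨
      ∃ e v, (nodeAt Y C x t i).mvbaOut e = some v ∧ 0 < (v j).slot ∧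
        w = (sigMsg j (v j).slot (v j).digest, (v j).sig))}

/-- The adversary run with the honest nodes, as an attack on the threshold signature. -/
def Ensemble.forgeryAttack (E : Ensemble n) : ForgeryAttack n where
  Ω := fun _ => Outcome n
  mΩ := fun _ => inferInstance
  μ := E.law
  corrupt := E.corrupt
  keys := fun _ x => (x.1.pk, x.1.sk)
  issued := fun l x t =>
    {w | w.1 ∉ E.corrupt l ∧ w.2 ∈ (nodeAt Y (E.corrupt l) x t w.1).signed}
  shown := fun l x t => shownSigs Y (E.corrupt l) x t

/-- The pairs of strings hashed for the same purpose by honest nodes: batches recorded for the same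
slot of the same broadcast, and strings at the same position of Merkle trees for the same slot, one
from the tree over a recorded batch and one from a received branch. -/
def shownPairs (C : Finset (Fin n)) (x : Outcome n) : Set (Bits × Bits) :=
  {w | ∃ i i' j k t t', i ∉ C ∧ i' ∉ C ∧
    ((∃ a b, (nodeAt Y C x t i).latest j = some (k, a) ∧
        (nodeAt Y C x t' i').latest j = some (k, b) ∧ w = (ser a, ser b)) ∨
      ∃ a src root leaf branch, (nodeAt Y C x t i).fixed j k = some a ∧
        (src, j, k, root, leaf, branch) ∈ (nodeAt Y C x t' i').helps ∧
        w ∈ (merklePath (Y.hash x.1.hk)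
            (merkleBranch (Y.hash x.1.hk) (Nat.clog 2 n) (leaves Y a) src) src
            (leaves Y a src)).zip
          (merklePath (Y.hash x.1.hk) branch src leaf))}

/-- The adversary run with the honest nodes, as an attack on the hash family. -/
def Ensemble.collisionAttack (E : Ensemble n) : CollisionAttack where
  Ω := fun _ => Outcome n
  mΩ := fun _ => inferInstance
  μ := E.law
  key := fun _ x => x.1.hk
  shown := fun l x => shownPairs Y (E.corrupt l) x

/-- An adversary is efficient if running it with the honest nodes gives efficient attacks. -/
def Ensemble.Efficient (E : Ensemble n) (𝓟 : AttackClass n) : Prop :=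
  E.forgeryAttack Y ∈ 𝓟.forgers ∧ E.collisionAttack Y ∈ 𝓟.finders

/-- The MVBA instances are secure with quality `q`, except with negligible probability: outside an
event of negligible probability all instances have termination, agreement and external validity,
and, whatever happened before an instance begins, its output comes from the adversary with
probability at most `1 - q`. -/
def Ensemble.MvbaSecure (E : Ensemble n) (q : ℝ) : Prop :=
  ∃ bad : ℕ → Set (Outcome n), (Negligible fun l => E.law l (bad l)) ∧
    (∀ l x, x ∉ bad l → ∀ e, MvbaSafe Y (E.corrupt l) x e) ∧
    ∀ l e R, E.law l ({x ∈ History Y (E.corrupt l) e R | AdvOutput Y (E.corrupt l) x e} \ bad l) ≤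
      ENNReal.ofReal (1 - q) * E.law l (History Y (E.corrupt l) e R)

end Attacks

/-- Honest setup: signature keys and hash key are generated independently by the generators. -/
def Ensemble.HonestSetup {n t : ℕ} (E : Ensemble n) (sig : ThresholdSig n t) (hash : HashFamily) :
    Prop :=
  ∀ l (S : Setup n), E.law l {x | x.1 = S} = sig.gen l (S.pk, S.sk) * hash.gen l S.hk

end DumboNG

namespace DumboNG

/-! ## Serialization and Merkle trees -/

/-! The probabilistic and the combinatorial arguments are separated. An outcome is `Good` if its
schedule is fair, its keys work, all MVBA instances are safe, no signature verified by an honest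
node is forged and no pair of strings compared by honest nodes is a collision.
`Ensemble.negligible_not_good` bounds the complement by a null set plus the forgery, collision and
exceptional MVBA events. On `Good` outcomes safety and progress are deterministic, and only the
quality of the MVBA instances is used probabilistically afterwards.

Safety. An honest node votes for at most one batch per slot (`latest_unique`). Two quorums of `n -
f` nodes share an honest node because `n > 3f`, so a slot has at most one certified digest, and
collision resistance turns this into one batch. Every batch recorded as fixed is the certified one
(`Good.certBatch_of_fixed`): a batch decoded from `n - 2f > f` fragments has at least one fragment
from an honest node, and Merkle binding forces all the others to belong to the same codeword. A
block is therefore a function of agreed MVBA outputs and of uniquely determined batches, which gives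
total order.

Progress. A certificate for a slot means that enough honest nodes hold the batch of this slot and
all earlier ones, so every request for a missing batch is eventually answered by `n - 2f` honest
nodes with fragments for one common root (`Good.fullRoot_eventually`, `Good.fixed_eventually`).
Hence receivers waiting for batches resume, honest senders collect all honest votes and advance
forever (`Good.current_unbounded`), at least `n - f` broadcasts outgrow the ordered slots in every
epoch, and every epoch is reached (`Good.epoch_reached`). Agreement follows.

Output. If an instance begins after all honest nodes are certified for a slot and its output was
input by an honest node, the slot is ordered (`Good.ordered_of_not_adv`). So `K > m` forces `m`
consecutive adversarial outputs, starting with the first instance that begins with everyone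
certified. The index of that instance is determined by the record on which the quality is
conditioned. Summing over its possible values gives a recursion `g (k + 1) ≤ r * g k + μ bad` with
`r = 1 - q`, hence `g k ≤ r ^ k + μ bad / q` (`le_pow_add_div`, `measure_advRun_le`). The
expectation bound is the sum of these tails.

Liveness. The same recursion shows that, up to probability `μ bad / q`, infinitely many outputs are
not adversarial (`measure_forall_advOutput_le`). Then every slot of an honest broadcast is ordered.
A transaction that is never output keeps its place in the FIFO buffer from some time on, with a
constant head in front of it or equal to it. But this head enters a later proposal and is removed
when that slot is ordered (`Good.head_changes`), a contradiction. -/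

theorem ser_cons (b : Bits) (l : List Bits) :
    ser (b :: l) = (b.flatMap fun x => [true, x]) ++ false :: ser l := by
  simp [ser]

/-- Every bit of a string is preceded by `true` and the string is closed by `false`, so the end of
the first string can be located by reading from the left. -/
theorem flatMap_true_append_inj {b b' r r' : Bits}
    (h : (b.flatMap fun x => [true, x]) ++ false :: r =
      (b'.flatMap fun x => [true, x]) ++ false :: r') : b = b' ∧ r = r' := by
  induction b generalizing b' with
  | nil => cases b' <;> simp_all
  | cons x b ih =>
    cases b' with
    | nil => simp at h
    | cons y b' =>
      simp only [List.flatMap_cons, List.cons_append, List.nil_append, List.cons.injEq,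
        true_and] at h
      obtain ⟨h1, h2⟩ := h
      obtain ⟨h3, h4⟩ := ih h2
      exact ⟨by rw [h1, h3], h4⟩

theorem ser_injective : Function.Injective ser := by
  intro l
  induction l with
  | nil =>
    intro l' h
    cases l' with
    | nil => rfl
    | cons b l' => rw [ser_cons] at h; cases b <;> simp [ser] at h
  | cons b l ih =>
    intro l' h
    cases l' with
    | nil => rw [ser_cons] at h; cases b <;> simp [ser] at h
    | cons b' l' =>
      rw [ser_cons, ser_cons] at h
      obtain ⟨h1, h2⟩ := flatMap_true_append_inj h
      rw [h1, ih h2]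

theorem natBits_injective : Function.Injective Nat.bits := by
  intro a b h
  have : ∀ k : ℕ, k.bits.foldr (fun x r => Nat.bit x r) 0 = k := by
    intro k
    induction k using Nat.binaryRec' with
    | zero => simp
    | bit x m hm ih => rw [Nat.bits_append_bit m x hm, List.foldr_cons, ih]
  rw [← this a, ← this b, h]

theorem sigMsg_inj {j j' s s' : ℕ} {d d' : Bits} (h : sigMsg j s d = sigMsg j' s' d') :
    j = j' ∧ s = s' ∧ d = d' := by
  have := ser_injective h
  simp only [List.cons.injEq, and_true] at this
  exact ⟨natBits_injective this.1, natBits_injective this.2.1, this.2.2⟩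

theorem merkleBranch_length (H : Bits → Bits) (d : ℕ) (l : ℕ → Bits) (i : ℕ) :
    (merkleBranch H d l i).length = d := by
  induction d generalizing l i with
  | zero => rfl
  | succ d ih => simp only [merkleBranch]; split <;> simp [ih]

theorem merkleTop_merkleBranch (H : Bits → Bits) (d : ℕ) (l : ℕ → Bits) (i : ℕ)
    (hi : i < 2 ^ d) : H (merkleTop H (merkleBranch H d l i) i (l i)) = merkleRoot H d l := by
  induction d generalizing l i with
  | zero =>
    have : i = 0 := by simpa using hi
    subst this; rfl
  | succ d ih =>
    simp only [merkleBranch]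
    split
    · rename_i h
      simp only [merkleTop, merkleBranch_length, h, if_true, merkleRoot, ih l i h]
    · rename_i h
      have h' : i - 2 ^ d < 2 ^ d := by rw [pow_succ] at hi; omega
      have := ih (fun k => l (2 ^ d + k)) (i - 2 ^ d) h'
      rw [show 2 ^ d + (i - 2 ^ d) = i by omega] at this
      simp only [merkleTop, merkleBranch_length, h, if_false, merkleRoot, this]

theorem merkleVerify_merkleBranch (H : Bits → Bits) (d : ℕ) (l : ℕ → Bits) (i : ℕ)
    (hi : i < 2 ^ d) :
    merkleVerify H d i (merkleRoot H d l) (l i) (merkleBranch H d l i) = true := by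
  simp [merkleVerify, merkleBranch_length, merkleTop_merkleBranch H d l i hi]

/-- Binding of Merkle trees: descend from the root along both branches. Equal hashes come from equal
strings, and by injectivity of `ser` equal strings contain equal hashes of the next node on the
path. Only pairs at the same depth need to be free of collisions, which is what `shownPairs`
provides. -/
theorem merkle_leaf_unique (H : Bits → Bits) (b b' : List Bits) (i : ℕ) (leaf leaf' : Bits)
    (hl : b.length = b'.length) (ht : H (merkleTop H b i leaf) = H (merkleTop H b' i leaf'))
    (hc : ∀ w ∈ (merklePath H b i leaf).zip (merklePath H b' i leaf'),
      H w.1 = H w.2 → w.1 = w.2) : leaf = leaf' := by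
  induction b generalizing b' i with
  | nil =>
    cases b' with
    | nil =>
      have := hc (ser [leaf], ser [leaf']) (by simp [merklePath]) ht
      simpa using ser_injective this
    | cons => simp at hl
  | cons x b ih =>
    cases b' with
    | nil => simp at hl
    | cons y b' =>
      have hl' : b.length = b'.length := by simpa using hl
      have h1 := hc (merkleTop H (x :: b) i leaf, merkleTop H (y :: b') i leaf')
        (by simp [merklePath]) ht
      simp only [merklePath, List.zip_cons_cons, List.mem_cons, ← hl'] at hc
      simp only [merkleTop, ← hl'] at h1
      split at h1
      · rename_i h
        have h2 := ser_injective h1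
        simp only [List.cons.injEq, and_true] at h2
        simp only [h, if_true] at hc
        exact ih b' i hl' h2.1 fun w hw => hc w (Or.inr hw)
      · rename_i h
        have h2 := ser_injective h1
        simp only [List.cons.injEq, and_true] at h2
        simp only [h, if_false] at hc
        exact ih b' _ hl' h2.2 fun w hw => hc w (Or.inr hw)

/-! ## Queues -/

/-- Every element of a queue that is emptied again and again is eventually at its head when the
queue is popped. -/
theorem fifo {α : Type*} (Q : ℕ → List α) (pop : ℕ → Prop)
    (h1 : ∀ t, ¬ pop t → ∃ l, Q (t + 1) = Q t ++ l)
    (h2 : ∀ t q l, pop t → Q t = q :: l → Q (t + 1) = l)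
    (h3 : ∀ t, ∃ t' ≥ t, pop t') (t : ℕ) (q : α) (hq : q ∈ Q t) :
    ∃ t' ≥ t, pop t' ∧ ∃ l, Q t' = q :: l := by
  obtain ⟨pre, post, h⟩ := List.append_of_mem hq
  clear hq
  induction pre generalizing t post with
  | nil =>
    -- Until the first pop, the queue only grows at its end, so its head stays.
    have key : ∀ k, (∃ l, Q (t + k) = q :: l) ∨ ∃ t' ≥ t, pop t' ∧ ∃ l, Q t' = q :: l := by
      intro k
      induction k with
      | zero => exact Or.inl ⟨post, by simpa using h⟩
      | succ k ih =>
        rcases ih with ⟨l, hl⟩ | h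
        · by_cases hp : pop (t + k)
          · exact Or.inr ⟨t + k, by omega, hp, l, hl⟩
          · obtain ⟨l', hl'⟩ := h1 _ hp
            exact Or.inl ⟨l ++ l', by rw [← add_assoc, hl', hl]; rfl⟩
        · exact Or.inr h
    obtain ⟨t', ht', hp⟩ := h3 t
    obtain ⟨k, rfl⟩ := Nat.exists_eq_add_of_le ht'
    rcases key k with hl | h
    · exact ⟨_, ht', hp, hl⟩
    · exact h
  | cons p pre ih =>
    have key : ∀ k, (∃ l, Q (t + k) = p :: pre ++ q :: l) ∨
        ∃ t' ≥ t, ∃ l, Q t' = pre ++ q :: l := by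
      intro k
      induction k with
      | zero => exact Or.inl ⟨post, by simpa using h⟩
      | succ k ih =>
        rcases ih with ⟨l, hl⟩ | h
        · by_cases hp : pop (t + k)
          · exact Or.inr ⟨t + k + 1, by omega, l, h2 _ _ _ hp (by simpa using hl)⟩
          · obtain ⟨l', hl'⟩ := h1 _ hp
            exact Or.inl ⟨l ++ l', by rw [← add_assoc, hl', hl]; simp⟩
        · exact Or.inr h
    obtain ⟨t', ht', hp⟩ := h3 t
    obtain ⟨k, rfl⟩ := Nat.exists_eq_add_of_le ht'
    have : ∃ t' ≥ t, ∃ l, Q t' = pre ++ q :: l := by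
      rcases key k with ⟨l, hl⟩ | h
      · exact ⟨t + k + 1, by omega, l, h2 _ _ _ hp (by simpa using hl)⟩
      · exact h
    obtain ⟨t₁, ht₁, l, hl⟩ := this
    obtain ⟨t₂, ht₂, hr⟩ := ih t₁ l hl
    exact ⟨t₂, le_trans ht₁ ht₂, hr⟩

/-! ## Transitions of a node -/

section Transitions

variable {n f : ℕ} (Y : System n f) (S : Setup n)

/-- What a call of `pull` for the certificate `c` may do to the entries `max-missing_j` and
`loop j`. -/
def Pulled (nd : Node n) (j : Fin n) (c mm : Cert) (lp : Option (ℕ × Bool)) : Prop :=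
  (mm = nd.maxMissing j ∧ lp = nd.loop j ∧ (certValid Y S j c = true →
    c.slot ≤ (nd.maxMissing j).slot ∨ c.slot ≤ (nd.current j).slot)) ∨
  (mm = c ∧ (nd.maxMissing j).slot < c.slot ∧ (nd.current j).slot < c.slot ∧
    certValid Y S j c = true ∧ lp = some ((nd.loop j).getD ((nd.current j).slot + 1, false)))

/-- This puts `pull` into the form of an update of two entries, as the constructors of `Tr` need it.
A running loop is not restarted, whence the `getD` in `Pulled`. -/
theorem pull_eq (j : Fin n) (c : Cert) (nd : Node n) :
    ∃ mm lp, Pulled Y S nd j c mm lp ∧ pull Y S j c nd =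
      { nd with
          maxMissing := Function.update nd.maxMissing j mm
          loop := Function.update nd.loop j lp } := by
  by_cases h : (nd.maxMissing j).slot < c.slot ∧ (nd.current j).slot < c.slot ∧
      certValid Y S j c = true
  · refine ⟨_, _, Or.inr ⟨rfl, h.1, h.2.1, h.2.2, rfl⟩, ?_⟩
    simp only [pull, h, and_self, if_true]
    congr 1
    cases hl : nd.loop j with
    | none => simp
    | some w =>
      have : some (Option.getD (some w) ((nd.current j).slot + 1, false)) = nd.loop j := by
        rw [hl]; rfl
      rw [this, Function.update_eq_self]
  · refine ⟨_, _, Or.inl ⟨rfl, rfl, fun hv => ?_⟩, ?_⟩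
    · simp only [hv, and_true, not_and_or, not_lt] at h
      exact h
    · simp only [pull, h, if_false, Function.update_eq_self]

/-- Pulls for distinct senders touch different entries, so each of them acts as on the original
state. The induction runs over states whose entries outside the remaining list have already been
changed. -/
theorem foldl_pull_eq (v : Vec n) (nd : Node n) (l : List (Fin n)) (hl : l.Nodup) :
    ∀ (mm : Vec n) (lp : Fin n → Option (ℕ × Bool)),
      (∀ j ∈ l, mm j = nd.maxMissing j ∧ lp j = nd.loop j) →
      ∃ (mm' : Vec n) (lp' : Fin n → Option (ℕ × Bool)),
        l.foldl (fun nd' j => if complete nd v j = true then nd' else pull Y S j (v j) nd')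
          { nd with maxMissing := mm, loop := lp } = { nd with maxMissing := mm', loop := lp' } ∧
        (∀ j, j ∉ l → mm' j = mm j ∧ lp' j = lp j) ∧
        ∀ j ∈ l, (mm' j = nd.maxMissing j ∧ lp' j = nd.loop j ∧ complete nd v j = true) ∨
          Pulled Y S nd j (v j) (mm' j) (lp' j) := by
  induction l with
  | nil => intro mm lp _; exact ⟨mm, lp, rfl, fun _ _ => ⟨rfl, rfl⟩, by simp⟩
  | cons a l ih =>
    intro mm lp hs
    have ha : a ∉ l := (List.nodup_cons.1 hl).1
    have hl' := (List.nodup_cons.1 hl).2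
    have hsa := hs a (by simp)
    simp only [List.foldl_cons]
    by_cases hc : complete nd v a = true
    · simp only [hc, if_true]
      obtain ⟨mm', lp', h1, h2, h3⟩ := ih hl' mm lp fun j hj => hs j (by simp [hj])
      refine ⟨mm', lp', h1, fun j hj => h2 j fun h => hj (by simp [h]), fun j hj => ?_⟩
      rcases List.mem_cons.1 hj with rfl | hj
      · exact Or.inl ⟨(h2 j ha).1.trans hsa.1, (h2 j ha).2.trans hsa.2, hc⟩
      · exact h3 j hj
    · simp only [hc]
      obtain ⟨m, p, hp, he⟩ := pull_eq Y S a (v a) { nd with maxMissing := mm, loop := lp }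
      rw [if_neg (by simp), he]
      obtain ⟨mm', lp', h1, h2, h3⟩ := ih hl' (Function.update mm a m) (Function.update lp a p)
        fun j hj => by
          have : j ≠ a := fun h => ha (h ▸ hj)
          simpa [this] using hs j (by simp [hj])
      refine ⟨mm', lp', h1, fun j hj => ?_, fun j hj => ?_⟩
      · have h := h2 j fun h => hj (by simp [h])
        have : j ≠ a := fun h => hj (by simp [h])
        simpa [this] using h
      · rcases List.mem_cons.1 hj with rfl | hj
        · right
          have h := h2 j ha
          simp only [Function.update_self] at h
          rw [h.1, h.2]
          simpa only [Pulled, hsa] using hp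
        · exact h3 j hj

/-- The possible transitions of node `i`, with the messages sent; `L src m` says that `m` may
arrive from `src`. -/
inductive Tr (L : Fin n → Msg n → Prop) (i : Fin n) (nd : Node n) :
    Node n → List (Fin n × Msg n) → Prop where
  | idle : Tr L i nd nd []
  | input (tx : Bits) : Tr L i nd { nd with buffer := nd.buffer ++ [tx] } []
  | recvProposal (src : Fin n) (s : ℕ) (tx : Batch) (cert : Option (Bits × Bits)) :
      L src (.proposal s tx cert) → Tr L i nd { nd with
        queue := Function.update nd.queue src (nd.queue src ++ [(s, tx, cert)]) } []
  | recvVote (src : Fin n) (s : ℕ) (σ : Bits) : L src (.vote s σ) →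
      Tr L i nd { nd with votes := nd.votes ++ [(src, s, σ)] } []
  | recvCall (src j : Fin n) (k : ℕ) (sig : Option Bits) : L src (.callHelp j k sig) →
      Tr L i nd { nd with calls := nd.calls ++ [(src, j, k, sig)] } []
  | recvHelp (src j : Fin n) (k : ℕ) (root leaf : Bits) (branch : List Bits) :
      L src (.help j k root leaf branch) →
      Tr L i nd { nd with helps := nd.helps ++ [(src, j, k, root, leaf, branch)] } []
  | agree (v : Vec n) : (nd.mvbaIn nd.epoch).isSome = true → nd.mvbaOut nd.epoch = none →
      Tr L i nd { nd with mvbaOut := Function.update nd.mvbaOut nd.epoch (some v) } []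
  | propose : nd.sendBatch = none → Tr L i nd
      { nd with sendBatch := some (nd.buffer.take Y.batchSize) }
      (multicast (.proposal nd.sendSlot (nd.buffer.take Y.batchSize) nd.sendCert))
  | advance (tx : Batch) : nd.sendBatch = some tx →
      n - f ≤ (Finset.univ.filter fun j =>
        (validShares Y S i nd.sendSlot tx nd j).isSome).card →
      Tr L i nd { nd with
        sendCert := some (digest Y S tx, Y.sig.combine S.pk
          (sigMsg i nd.sendSlot (digest Y S tx)) (validShares Y S i nd.sendSlot tx nd))
        sendSlot := nd.sendSlot + 1
        sendBatch := none } []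
  | skipSeen (j : Fin n) (s : ℕ) (tx : Batch) (cert : Option (Bits × Bits))
      (rest : List (ℕ × Batch × Option (Bits × Bits))) : nd.jump j = none →
      nd.queue j = (s, tx, cert) :: rest → s ∈ nd.seen j →
      Tr L i nd { nd with queue := Function.update nd.queue j rest } []
  | skipBad (j : Fin n) (s : ℕ) (tx : Batch) (cert : Option (Bits × Bits))
      (rest : List (ℕ × Batch × Option (Bits × Bits))) : nd.jump j = none →
      nd.queue j = (s, tx, cert) :: rest → s ∉ nd.seen j →
      (s = nd.recvSlot j → s ≠ 1 ∧ ∀ d σ k tx₀, cert = some (d, σ) → nd.latest j = some (k, tx₀) →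
        k = s - 1 → d = digest Y S tx₀ → certValid Y S j ⟨s - 1, d, σ⟩ = true → False) →
      (nd.recvSlot j < s → ∀ d σ, cert = some (d, σ) →
        certValid Y S j ⟨s - 1, d, σ⟩ = true → False) →
      Tr L i nd { nd with
        queue := Function.update nd.queue j rest
        seen := Function.update nd.seen j (s :: nd.seen j) } []
  | voteFirst (j : Fin n) (tx : Batch) (cert : Option (Bits × Bits))
      (rest : List (ℕ × Batch × Option (Bits × Bits))) : nd.jump j = none →
      nd.queue j = (1, tx, cert) :: rest → 1 ∉ nd.seen j → nd.recvSlot j = 1 →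
      Tr L i nd { nd with
        queue := Function.update nd.queue j rest
        seen := Function.update nd.seen j (1 :: nd.seen j)
        signed := sigMsg j 1 (digest Y S tx) :: nd.signed
        latest := Function.update nd.latest j (some (1, tx))
        recvSlot := Function.update nd.recvSlot j (1 + 1) }
        [(j, .vote 1 (Y.sig.shareSign (S.sk i) (sigMsg j 1 (digest Y S tx))))]
  | voteNext (j : Fin n) (s : ℕ) (tx : Batch) (σ : Bits) (tx₀ : Batch)
      (rest : List (ℕ × Batch × Option (Bits × Bits))) : nd.jump j = none →
      nd.queue j = (s, tx, some (digest Y S tx₀, σ)) :: rest → s ∉ nd.seen j →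
      s = nd.recvSlot j → s ≠ 1 → nd.latest j = some (s - 1, tx₀) →
      certValid Y S j ⟨s - 1, digest Y S tx₀, σ⟩ = true →
      Tr L i nd { nd with
        queue := Function.update nd.queue j rest
        seen := Function.update nd.seen j (s :: nd.seen j)
        fixed := Function.update nd.fixed j (Function.update (nd.fixed j) (s - 1) (some tx₀))
        current := Function.update nd.current j ⟨s - 1, digest Y S tx₀, σ⟩
        signed := sigMsg j s (digest Y S tx) :: nd.signed
        latest := Function.update nd.latest j (some (s, tx))
        recvSlot := Function.update nd.recvSlot j (s + 1) }
        [(j, .vote s (Y.sig.shareSign (S.sk i) (sigMsg j s (digest Y S tx))))]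
  | jumpStart (j : Fin n) (s : ℕ) (tx : Batch) (d σ : Bits)
      (rest : List (ℕ × Batch × Option (Bits × Bits))) (mm : Cert) (lp : Option (ℕ × Bool)) :
      nd.jump j = none → nd.queue j = (s, tx, some (d, σ)) :: rest → s ∉ nd.seen j →
      nd.recvSlot j < s → certValid Y S j ⟨s - 1, d, σ⟩ = true →
      Pulled Y S nd j ⟨s - 1, d, σ⟩ mm lp →
      Tr L i nd { nd with
        queue := Function.update nd.queue j rest
        seen := Function.update nd.seen j (s :: nd.seen j)
        jump := Function.update nd.jump j (some (s, tx, d, σ))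
        maxMissing := Function.update nd.maxMissing j mm
        loop := Function.update nd.loop j lp } []
  | voteJump (j : Fin n) (s : ℕ) (tx : Batch) (d σ : Bits) :
      nd.jump j = some (s, tx, d, σ) →
      (∀ k < s, nd.recvSlot j - 1 ≤ k → 1 ≤ k → (nd.fixed j k).isSome = true) →
      Tr L i nd { nd with
        current := Function.update nd.current j ⟨s - 1, d, σ⟩
        jump := Function.update nd.jump j none
        signed := sigMsg j s (digest Y S tx) :: nd.signed
        latest := Function.update nd.latest j (some (s, tx))
        recvSlot := Function.update nd.recvSlot j (s + 1) }
        [(j, .vote s (Y.sig.shareSign (S.sk i) (sigMsg j s (digest Y S tx))))]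
  | loopEnd (j : Fin n) (k : ℕ) (asked : Bool) : nd.loop j = some (k, asked) →
      (nd.maxMissing j).slot < k → Tr L i nd { nd with loop := Function.update nd.loop j none } []
  | ask (j : Fin n) (k : ℕ) : nd.loop j = some (k, false) → k ≤ (nd.maxMissing j).slot →
      Tr L i nd { nd with loop := Function.update nd.loop j (some (k, true)) }
        (multicast (.callHelp j k
          (if k < (nd.maxMissing j).slot then none else some (nd.maxMissing j).sig)))
  | store (j : Fin n) (k : ℕ) (root : Bits) : nd.loop j = some (k, true) →
      k ≤ (nd.maxMissing j).slot → fullRoot Y S j k nd = some root →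
      Tr L i nd { nd with
        fixed := Function.update nd.fixed j (Function.update (nd.fixed j) k
          (some (Y.code.decode (fragments Y S j k root nd))))
        loop := Function.update nd.loop j (some (k + 1, false)) } []
  | dropCall (src j : Fin n) (k : ℕ) (sig : Option Bits)
      (rest : List (Fin n × Fin n × ℕ × Option Bits)) : nd.calls = (src, j, k, sig) :: rest →
      (src, j, k) ∈ nd.answered → Tr L i nd { nd with calls := rest } []
  | answer (src j : Fin n) (k : ℕ) (sig : Option Bits)
      (rest : List (Fin n × Fin n × ℕ × Option Bits)) (fx : Fin n → ℕ → Option Batch)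
      (out : List (Fin n × Msg n)) : nd.calls = (src, j, k, sig) :: rest →
      (src, j, k) ∉ nd.answered →
      ((fx = nd.fixed ∧ ¬ ∃ tx σ, nd.latest j = some (k, tx) ∧ sig = some σ ∧
          certValid Y S j ⟨k, digest Y S tx, σ⟩ = true) ∨
        ∃ tx σ, nd.latest j = some (k, tx) ∧ sig = some σ ∧
        certValid Y S j ⟨k, digest Y S tx, σ⟩ = true ∧
        fx = Function.update nd.fixed j (Function.update (nd.fixed j) k (some tx))) →
      ((out = [] ∧ fx j k = none) ∨ ∃ tx, fx j k = some tx ∧ out = [(src, .help j k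
        (merkleRoot (Y.hash S.hk) (Nat.clog 2 n) (leaves Y tx)) (leaves Y tx i)
        (merkleBranch (Y.hash S.hk) (Nat.clog 2 n) (leaves Y tx) i))]) →
      Tr L i nd { nd with
        calls := rest
        answered := (src, j, k) :: nd.answered
        fixed := fx } out
  | give : nd.mvbaIn nd.epoch = none →
      n - f ≤ (Finset.univ.filter fun j => (nd.ordered j).slot < (nd.current j).slot).card →
      Tr L i nd
        { nd with mvbaIn := Function.update nd.mvbaIn nd.epoch (some (inputVec nd)) } []
  | output (v : Vec n) : (nd.mvbaIn nd.epoch).isSome = true → nd.mvbaOut nd.epoch = some v →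
      (∀ j, complete nd v j = true) → Tr L i nd { nd with
        blocks := nd.blocks ++ [blockOf nd v]
        buffer := nd.buffer.filter fun tx => decide (tx ∉ blockOf nd v)
        ordered := v
        epoch := nd.epoch + 1 } []
  | fetch (v : Vec n) (mm : Vec n) (lp : Fin n → Option (ℕ × Bool)) :
      nd.mvbaOut nd.epoch = some v →
      (∀ j, (mm j = nd.maxMissing j ∧ lp j = nd.loop j ∧ complete nd v j = true) ∨
        Pulled Y S nd j (v j) (mm j) (lp j)) →
      Tr L i nd { nd with maxMissing := mm, loop := lp } []

variable (L : Fin n → Msg n → Prop) (i : Fin n) (nd : Node n)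

theorem tr_sender : Tr Y S L i nd (senderStep Y S i nd).1 (senderStep Y S i nd).2 := by
  unfold senderStep
  split
  · rename_i h; exact .propose h
  · rename_i tx h
    dsimp only
    split
    · rename_i h'; exact .advance tx h h'
    · exact .idle

theorem tr_receiver (j : Fin n) :
    Tr Y S L i nd (receiverStep Y S i j nd).1 (receiverStep Y S i j nd).2 := by
  unfold receiverStep
  split
  · rename_i s tx d σ h
    split
    · rename_i h'
      exact .voteJump j s tx d σ h fun k hk => h' k (List.mem_range.2 hk)
    · exact .idle
  · rename_i h
    split
    · exact .idle
    · rename_i s tx cert rest hq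
      dsimp only
      split
      · rename_i hs; exact .skipSeen j s tx cert rest h hq hs
      rename_i hs
      split
      · rename_i hr
        split
        · rename_i h1
          subst h1
          exact .voteFirst j tx cert rest h hq hs hr.symm
        rename_i h1
        split
        · rename_i d σ k tx₀ hl
          split
          · rename_i hc
            obtain ⟨rfl, rfl, hv⟩ := hc
            exact .voteNext j s tx σ tx₀ rest h hq hs hr h1 hl hv
          · rename_i hc
            refine .skipBad j s tx _ rest h hq hs (fun _ => ⟨h1, ?_⟩) fun hlt => by omega
            intro d' σ' k' tx' e1 e2 e3 e4 e5
            rw [hl] at e2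
            simp only [Option.some.injEq, Prod.mk.injEq] at e1 e2
            obtain ⟨rfl, rfl⟩ := e1
            obtain ⟨rfl, rfl⟩ := e2
            exact hc ⟨e3, e4, e5⟩
        · rename_i hc
          refine .skipBad j s tx _ rest h hq hs (fun _ => ⟨h1, ?_⟩) fun hlt => by omega
          intro d' σ' k' tx' e1 e2 e3 e4 e5
          exact hc _ _ _ _ e1 e2
      · rename_i hr
        split
        · rename_i hlt
          split
          · rename_i d σ
            split
            · rename_i hv
              obtain ⟨mm, lp, hp, he⟩ := pull_eq Y S j ⟨s - 1, d, σ⟩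
                { nd with
                    queue := Function.update nd.queue j rest
                    seen := Function.update nd.seen j (s :: nd.seen j)
                    jump := Function.update nd.jump j (some (s, tx, d, σ)) }
              rw [he]
              exact .jumpStart j s tx d σ rest mm lp h hq hs hlt hv hp
            · rename_i hv
              refine .skipBad j s tx _ rest h hq hs (fun h => absurd h hr) fun _ d' σ' e => ?_
              simp only [Option.some.injEq, Prod.mk.injEq] at e
              obtain ⟨rfl, rfl⟩ := e
              exact hv
          · refine .skipBad j s tx _ rest h hq hs (fun h => absurd h hr) fun _ d' σ' e => ?_
            simp at e
        · rename_i hlt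
          exact .skipBad j s tx _ rest h hq hs (fun h => absurd h hr) fun h => absurd h hlt

theorem tr_callHelp (j : Fin n) :
    Tr Y S L i nd (callHelpStep Y S j nd).1 (callHelpStep Y S j nd).2 := by
  unfold callHelpStep
  split
  · exact .idle
  · rename_i k asked h
    dsimp only
    split
    · rename_i hk; exact .loopEnd j k asked h hk
    rename_i hk
    split
    · rename_i ha; subst ha; exact .ask j k h (not_lt.1 hk)
    rename_i ha
    split
    · exact .idle
    · rename_i root hr
      exact .store j k root (by rw [h]; simp [ha]) (not_lt.1 hk) hr

theorem tr_help : Tr Y S L i nd (helpStep Y S i nd).1 (helpStep Y S i nd).2 := by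
  rcases h : nd.calls with _ | ⟨⟨src, j, k, sig⟩, rest⟩
  · simp only [helpStep, h]; exact .idle
  by_cases ha : (src, j, k) ∈ nd.answered
  · simp only [helpStep, h, ha, if_true]; exact .dropCall src j k sig rest h ha
  by_cases hc : ∃ tx σ, nd.latest j = some (k, tx) ∧ sig = some σ ∧
      certValid Y S j ⟨k, digest Y S tx, σ⟩ = true
  · obtain ⟨tx, σ, hl, rfl, hv⟩ := hc
    simp only [helpStep, h, ha, hl, hv, if_false, and_self, if_true, Function.update_self]
    exact .answer src j k _ rest _ _ h ha (Or.inr ⟨tx, σ, hl, rfl, hv, rfl⟩)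
      (Or.inr ⟨tx, by simp, rfl⟩)
  -- Without a valid certificate for the latest batch nothing is newly recorded, and all remaining
  -- branches of the daemon reduce to a lookup in `fixed`.
  · have key : helpStep Y S i nd =
        match nd.fixed j k with
        | none => ({ nd with calls := rest, answered := (src, j, k) :: nd.answered }, [])
        | some tx => ({ nd with calls := rest, answered := (src, j, k) :: nd.answered },
          [(src, .help j k (merkleRoot (Y.hash S.hk) (Nat.clog 2 n) (leaves Y tx)) (leaves Y tx i)
            (merkleBranch (Y.hash S.hk) (Nat.clog 2 n) (leaves Y tx) i))]) := by
      rcases hl : nd.latest j with _ | ⟨s, tx⟩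
      · simp only [helpStep, h, ha, hl, if_false]
      · rcases sig with _ | σ
        · simp only [helpStep, h, ha, hl, if_false]
        · have : ¬ (s = k ∧ certValid Y S j ⟨k, digest Y S tx, σ⟩ = true) := by
            rintro ⟨rfl, hv⟩; exact hc ⟨tx, σ, hl, rfl, hv⟩
          simp only [helpStep, h, ha, hl, if_false, this]
    rw [key]
    split
    · rename_i hf
      exact .answer src j k _ rest _ _ h ha (Or.inl ⟨rfl, hc⟩) (Or.inl ⟨rfl, hf⟩)
    · rename_i tx' hf
      exact .answer src j k _ rest _ _ h ha (Or.inl ⟨rfl, hc⟩) (Or.inr ⟨tx', hf, rfl⟩)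

theorem foldl_pull (v : Vec n) : ∃ (mm : Vec n) (lp : Fin n → Option (ℕ × Bool)),
    (List.finRange n).foldl
      (fun nd' j => if complete nd v j = true then nd' else pull Y S j (v j) nd') nd =
        { nd with maxMissing := mm, loop := lp } ∧
    ∀ j, (mm j = nd.maxMissing j ∧ lp j = nd.loop j ∧ complete nd v j = true) ∨
      Pulled Y S nd j (v j) (mm j) (lp j) := by
  obtain ⟨mm, lp, h1, -, h3⟩ := foldl_pull_eq Y S v nd (List.finRange n) (List.nodup_finRange n)
    nd.maxMissing nd.loop fun _ _ => ⟨rfl, rfl⟩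
  exact ⟨mm, lp, h1, fun j => h3 j (List.mem_finRange j)⟩

theorem tr_consensus : Tr Y S L i nd (consensusStep Y S nd).1 (consensusStep Y S nd).2 := by
  unfold consensusStep
  split
  · rename_i h
    split
    · rename_i h'; exact .give h h'
    · exact .idle
  · exact .idle
  · rename_i w v h1 h2
    dsimp only
    split
    · rename_i hc; exact .output v (by simp [h1]) h2 hc
    · obtain ⟨mm, lp, h3, h4⟩ := foldl_pull Y S nd v
      rw [h3]
      exact .fetch v mm lp h2 h4

theorem tr_run (p : Proc n) :
    Tr Y S L i nd (runProcess Y S i p nd).1 (runProcess Y S i p nd).2 := by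
  cases p with
  | sender => exact tr_sender Y S L i nd
  | receiver j => exact tr_receiver Y S L i nd j
  | callHelp j => exact tr_callHelp Y S L i nd j
  | help => exact tr_help Y S L i nd
  | consensus => exact tr_consensus Y S L i nd

theorem tr_receive (src : Fin n) (m : Msg n) (h : L src m) :
    Tr Y S L i nd (receive src m nd) [] := by
  cases m with
  | proposal s tx cert => exact .recvProposal src s tx cert h
  | vote s σ => exact .recvVote src s σ h
  | callHelp j k sig => exact .recvCall src j k sig h
  | help j k root leaf branch => exact .recvHelp src j k root leaf branch h

end Transitions

/-! ### Events of an execution as transitions of single nodes -/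

section Steps

variable {n f : ℕ} (Y : System n f) (C : Finset (Fin n)) (x : Outcome n)

/-- `m` may be delivered from `src` to `dst` after `t` events. -/
def Deliverable (t : ℕ) (dst src : Fin n) (m : Msg n) : Prop :=
  src ∈ C ∨ (src, dst, m) ∈ (exec Y C x t).sent

/-- Every event is a transition of every node (idle for all but one of them), and the
messages sent are recorded. -/
theorem tr_step (t : ℕ) (i : Fin n) :
    ∃ out, Tr Y x.1 (Deliverable Y C x t i) i (nodeAt Y C x t i) (nodeAt Y C x (t + 1) i) out ∧
      ∀ dst m, (i, dst, m) ∈ (exec Y C x (t + 1)).sent ↔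
        (i, dst, m) ∈ (exec Y C x t).sent ∨ (dst, m) ∈ out := by
  have hex : exec Y C x (t + 1) = applyLabel Y C x.1 (exec Y C x t) (x.2 t) := rfl
  unfold nodeAt
  rw [hex]
  cases hl : x.2 t with
  | input i' tx =>
    refine ⟨[], ?_, ?_⟩
    · by_cases hC : i' ∈ C
      · simp only [applyLabel, hC, if_true]; exact .idle
      · simp only [applyLabel, hC, if_false]
        by_cases h : i = i'
        · subst h; simp only [Function.update_self]; exact .input tx
        · simp only [Function.update_of_ne h]; exact .idle
    · intro dst m
      by_cases hC : i' ∈ C <;> simp [applyLabel, hC]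
  | deliver src dst m =>
    refine ⟨[], ?_, ?_⟩
    · by_cases hC : dst ∉ C ∧ (src ∈ C ∨ (src, dst, m) ∈ (exec Y C x t).sent)
      · rw [applyLabel, if_pos hC]
        by_cases h : i = dst
        · subst h; simp only [Function.update_self]; exact tr_receive _ _ _ _ _ _ _ hC.2
        · simp only [Function.update_of_ne h]; exact .idle
      · rw [applyLabel, if_neg hC]; exact .idle
    · intro dst' m'
      by_cases hC : dst ∉ C ∧ (src ∈ C ∨ (src, dst, m) ∈ (exec Y C x t).sent)
      · rw [applyLabel, if_pos hC]; simp
      · rw [applyLabel, if_neg hC]; simp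
  | run i' p =>
    by_cases hC : i' ∈ C
    · refine ⟨[], ?_, ?_⟩
      · simp only [applyLabel, hC, if_true]; exact .idle
      · intro dst m
        simp [applyLabel, hC]
    · simp only [applyLabel, hC, if_false]
      by_cases h : i = i'
      · subst h
        refine ⟨_, by simp only [Function.update_self]; exact tr_run _ _ _ _ _ _, ?_⟩
        intro dst m
        simp
      · refine ⟨[], by simp only [Function.update_of_ne h]; exact .idle, ?_⟩
        intro dst m
        simp only [List.mem_append, List.mem_map, Prod.mk.injEq, List.not_mem_nil, or_false,
          or_iff_left_iff_imp]
        rintro ⟨_, _, h', _⟩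
        exact absurd h'.symm h
  | mvba i' v =>
    refine ⟨[], ?_, ?_⟩
    · by_cases hC : i' ∉ C ∧
        (((exec Y C x t).node i').mvbaIn ((exec Y C x t).node i').epoch).isSome = true ∧
        (((exec Y C x t).node i').mvbaOut ((exec Y C x t).node i').epoch).isNone = true
      · rw [applyLabel, if_pos hC]
        by_cases h : i = i'
        · subst h; simp only [Function.update_self]
          exact .agree v hC.2.1 (by simpa using hC.2.2)
        · simp only [Function.update_of_ne h]; exact .idle
      · rw [applyLabel, if_neg hC]; exact .idle
    · intro dst m
      by_cases hC : i' ∉ C ∧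
        (((exec Y C x t).node i').mvbaIn ((exec Y C x t).node i').epoch).isSome = true ∧
        (((exec Y C x t).node i').mvbaOut ((exec Y C x t).node i').epoch).isNone = true
      · rw [applyLabel, if_pos hC]; simp
      · rw [applyLabel, if_neg hC]; simp

/-- What a step of a process does to its node. -/
theorem nodeAt_run (t : ℕ) (i : Fin n) (hi : i ∉ C) (p : Proc n) (h : x.2 t = .run i p) :
    nodeAt Y C x (t + 1) i = (runProcess Y x.1 i p (nodeAt Y C x t i)).1 ∧
      ∀ w ∈ (runProcess Y x.1 i p (nodeAt Y C x t i)).2,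
        (i, w.1, w.2) ∈ (exec Y C x (t + 1)).sent := by
  have hex : exec Y C x (t + 1) = applyLabel Y C x.1 (exec Y C x t) (x.2 t) := rfl
  unfold nodeAt
  rw [hex, h]
  simp only [applyLabel, hi, if_false, Function.update_self, true_and]
  intro w hw
  exact List.mem_append_right _ (List.mem_map.2 ⟨w, hw, rfl⟩)

theorem nodeAt_deliver (t : ℕ) (src dst : Fin n) (m : Msg n) (hd : dst ∉ C)
    (hs : (src, dst, m) ∈ (exec Y C x t).sent) (h : x.2 t = .deliver src dst m) :
    nodeAt Y C x (t + 1) dst = receive src m (nodeAt Y C x t dst) := by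
  have hex : exec Y C x (t + 1) = applyLabel Y C x.1 (exec Y C x t) (x.2 t) := rfl
  unfold nodeAt
  rw [hex, h, applyLabel, if_pos ⟨hd, Or.inr hs⟩]
  simp

end Steps

/-! ## Local invariants -/

section Invariants

variable {n f : ℕ} (Y : System n f) (S : Setup n)

/-- Invariants of the broadcast receivers and of the `CallHelp` daemon of a node. -/
structure Inv (nd : Node n) : Prop where
  recv_pos : ∀ j, 1 ≤ nd.recvSlot j
  latest_none : ∀ j, nd.latest j = none → nd.recvSlot j = 1
  latest_some : ∀ j k tx, nd.latest j = some (k, tx) → nd.recvSlot j = k + 1 ∧ 1 ≤ k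
  -- A receiver in slot `r` has voted for `r - 1`, hence has seen a certificate for `r - 2`.
  -- Truncated subtraction covers `r = 1`.
  current_slot : ∀ j, (nd.current j).slot = nd.recvSlot j - 2
  current_valid : ∀ j, (nd.current j).slot = 0 ∨ certValid Y S j (nd.current j) = true
  jump_some : ∀ j s tx d σ, nd.jump j = some (s, tx, d, σ) → nd.recvSlot j < s ∧
    certValid Y S j ⟨s - 1, d, σ⟩ = true ∧ s - 1 ≤ (nd.maxMissing j).slot
  fixed_current : ∀ j k, 1 ≤ k → k ≤ (nd.current j).slot → (nd.fixed j k).isSome = true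
  loop_some : ∀ j k b, nd.loop j = some (k, b) →
    1 ≤ k ∧ ∀ k', 1 ≤ k' → k' < k → (nd.fixed j k').isSome = true
  loop_none : ∀ j k, nd.loop j = none → 1 ≤ k → k ≤ (nd.maxMissing j).slot →
    (nd.fixed j k).isSome = true

theorem update_update_apply {α β γ : Type*} [DecidableEq α] [DecidableEq β] (F : α → β → γ)
    (a a' : α) (b b' : β) (v : γ) :
    Function.update F a (Function.update (F a) b v) a' b' =
      if a' = a ∧ b' = b then v else F a' b' := by
  by_cases h : a' = a
  · subst h; simp [Function.update_apply]
  · simp [h]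

variable {Y S}
variable {L : Fin n → Msg n → Prop} {i : Fin n} {nd nd' : Node n} {out : List (Fin n × Msg n)}

/-- Only presence is claimed: an entry may be overwritten. That the new batch equals the old one
needs a good outcome, see `Good.fixed_unique`. -/
theorem Tr.fixed_isSome (h : Tr Y S L i nd nd' out) (j : Fin n) (k : ℕ)
    (hf : (nd.fixed j k).isSome = true) : (nd'.fixed j k).isSome = true := by
  cases h <;> try exact hf
  case answer hfx _ =>
    rcases hfx with ⟨rfl, -⟩ | ⟨tx, σ, -, -, -, rfl⟩
    · exact hf
    · grind [update_update_apply]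
  all_goals grind [Function.update_apply, update_update_apply]

theorem Tr.maxMissing_le (h : Tr Y S L i nd nd' out) (j : Fin n) :
    (nd.maxMissing j).slot ≤ (nd'.maxMissing j).slot := by
  cases h <;> try exact le_rfl
  all_goals grind [Function.update_apply, update_update_apply, Pulled]

theorem Inv.initial : Inv Y S ({} : Node n) := by
  constructor <;> simp <;> omega

theorem Inv.tr_recv_pos (h : Tr Y S L i nd nd' out) (hI : Inv Y S nd) (j : Fin n) :
    1 ≤ nd'.recvSlot j := by
  have := hI.recv_pos
  cases h <;> try exact this j
  all_goals grind [Function.update_apply, update_update_apply]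

theorem Inv.tr_latest_none (h : Tr Y S L i nd nd' out) (hI : Inv Y S nd) (j : Fin n) :
    nd'.latest j = none → nd'.recvSlot j = 1 := by
  have := hI.latest_none
  cases h <;> try exact this j
  all_goals grind [Function.update_apply, update_update_apply]

theorem Inv.tr_latest_some (h : Tr Y S L i nd nd' out) (hI : Inv Y S nd) (j : Fin n) (k : ℕ)
    (tx : Batch) : nd'.latest j = some (k, tx) → nd'.recvSlot j = k + 1 ∧ 1 ≤ k := by
  have := hI.latest_some
  have h1 := hI.recv_pos
  have h2 := hI.jump_some
  cases h <;> try exact this j k tx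
  all_goals grind [Function.update_apply, update_update_apply]

theorem Inv.tr_current_slot (h : Tr Y S L i nd nd' out) (hI : Inv Y S nd) (j : Fin n) :
    (nd'.current j).slot = nd'.recvSlot j - 2 := by
  have := hI.current_slot
  have h1 := hI.recv_pos
  have h2 := hI.jump_some
  cases h <;> try exact this j
  all_goals grind [Function.update_apply, update_update_apply]

theorem Inv.tr_current_valid (h : Tr Y S L i nd nd' out) (hI : Inv Y S nd) (j : Fin n) :
    (nd'.current j).slot = 0 ∨ certValid Y S j (nd'.current j) = true := by
  have := hI.current_valid
  have h2 := hI.jump_some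
  cases h <;> try exact this j
  all_goals grind [Function.update_apply, update_update_apply]

/-- The pull started together with a jump cannot be refused on account of `current`, which is at
slot `recvSlot - 2 < s - 1`. So afterwards `maxMissing` covers `s - 1`, and the daemon will fetch
all that the jump waits for. -/
theorem Inv.tr_jump_some (h : Tr Y S L i nd nd' out) (hI : Inv Y S nd) (j : Fin n) (s : ℕ)
    (tx : Batch) (d σ : Bits) : nd'.jump j = some (s, tx, d, σ) → nd'.recvSlot j < s ∧
    certValid Y S j ⟨s - 1, d, σ⟩ = true ∧ s - 1 ≤ (nd'.maxMissing j).slot := by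
  have h1 := hI.recv_pos
  have h2 := hI.jump_some
  have h3 := hI.current_slot
  have h4 := h.maxMissing_le j
  cases h <;> try exact h2 j s tx d σ
  all_goals grind [Function.update_apply, update_update_apply, Pulled]

/-- A jump to slot `s` checks the slots from `recvSlot - 1` to `s - 1`; those up to `recvSlot - 2`
are covered by the previous value of `current`. -/
theorem Inv.tr_fixed_current (h : Tr Y S L i nd nd' out) (hI : Inv Y S nd) (j : Fin n) (k : ℕ)
    (hk : 1 ≤ k) : k ≤ (nd'.current j).slot → (nd'.fixed j k).isSome = true := by
  have h1 := hI.recv_pos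
  have h2 := hI.jump_some
  have h3 := hI.current_slot
  have h4 := hI.fixed_current
  have h5 := h.fixed_isSome j k
  cases h <;> try exact h4 j k hk
  all_goals grind [Function.update_apply, update_update_apply]

/-- A loop starts just above `current`, below which everything is recorded, and it moves past `k`
only by recording slot `k`. -/
theorem Inv.tr_loop_some (h : Tr Y S L i nd nd' out) (hI : Inv Y S nd) (j : Fin n) (k : ℕ)
    (b : Bool) : nd'.loop j = some (k, b) →
      1 ≤ k ∧ ∀ k', 1 ≤ k' → k' < k → (nd'.fixed j k').isSome = true := by
  have h4 := hI.fixed_current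
  have h6 := hI.loop_some
  have h5 := h.fixed_isSome j
  cases h <;> try exact h6 j k b
  case fetch v mm lp _ h7 => 
    have := h7 j
    cases hl : nd.loop j <;> grind [Pulled]
  case jumpStart => cases hl : nd.loop j <;> grind [Function.update_apply, update_update_apply, Pulled]
  all_goals grind [Function.update_apply, update_update_apply]

/-- A loop ends only above `maxMissing`, and whenever `maxMissing` is raised a loop is running or is
started. -/
theorem Inv.tr_loop_none (h : Tr Y S L i nd nd' out) (hI : Inv Y S nd) (j : Fin n) (k : ℕ) :
    nd'.loop j = none → 1 ≤ k → k ≤ (nd'.maxMissing j).slot →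
      (nd'.fixed j k).isSome = true := by
  have h6 := hI.loop_some
  have h7 := hI.loop_none
  have h5 := h.fixed_isSome j k
  cases h <;> try exact h7 j k
  all_goals grind [Function.update_apply, update_update_apply, Pulled]

theorem Inv.tr (h : Tr Y S L i nd nd' out) (hI : Inv Y S nd) : Inv Y S nd' where
  recv_pos := hI.tr_recv_pos h
  latest_none := hI.tr_latest_none h
  latest_some := hI.tr_latest_some h
  current_slot := hI.tr_current_slot h
  current_valid := hI.tr_current_valid h
  jump_some := hI.tr_jump_some h
  fixed_current := hI.tr_fixed_current h
  loop_some := hI.tr_loop_some h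
  loop_none := hI.tr_loop_none h

end Invariants

/-! ## Monotonicity -/

section Monotone

variable {n f : ℕ} {Y : System n f} {S : Setup n}
variable {L : Fin n → Msg n → Prop} {i : Fin n} {nd nd' : Node n} {out : List (Fin n × Msg n)}

theorem Tr.recvSlot_le (h : Tr Y S L i nd nd' out) (hI : Inv Y S nd) (j : Fin n) :
    nd.recvSlot j ≤ nd'.recvSlot j ∧
      (nd'.recvSlot j = nd.recvSlot j → nd'.latest j = nd.latest j) := by
  have h1 := hI.jump_some
  cases h <;> try exact ⟨le_rfl, fun _ => rfl⟩
  all_goals grind [Function.update_apply]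

theorem Tr.signed_subset (h : Tr Y S L i nd nd' out) (m : Bits) (hm : m ∈ nd.signed) :
    m ∈ nd'.signed := by
  cases h <;> try exact hm
  all_goals exact List.mem_cons_of_mem _ hm

theorem Tr.mvbaIn_some (h : Tr Y S L i nd nd' out) (e : ℕ) (v : Vec n)
    (he : nd.mvbaIn e = some v) : nd'.mvbaIn e = some v := by
  cases h <;> try exact he
  all_goals grind [Function.update_apply]

theorem Tr.mvbaOut_some (h : Tr Y S L i nd nd' out) (e : ℕ) (v : Vec n)
    (he : nd.mvbaOut e = some v) : nd'.mvbaOut e = some v := by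
  cases h <;> try exact he
  all_goals grind [Function.update_apply]

theorem Tr.votes_subset (h : Tr Y S L i nd nd' out) (w : Fin n × ℕ × Bits) (hw : w ∈ nd.votes) :
    w ∈ nd'.votes := by
  cases h <;> try exact hw
  all_goals exact List.mem_append_left _ hw

theorem Tr.helps_subset (h : Tr Y S L i nd nd' out)
    (w : Fin n × Fin n × ℕ × Bits × Bits × List Bits) (hw : w ∈ nd.helps) : w ∈ nd'.helps := by
  cases h <;> try exact hw
  all_goals exact List.mem_append_left _ hw

theorem Tr.seen_subset (h : Tr Y S L i nd nd' out) (j : Fin n) (s : ℕ) (hs : s ∈ nd.seen j) :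
    s ∈ nd'.seen j := by
  cases h <;> try exact hs
  all_goals grind [Function.update_apply]

theorem Tr.send_mono (h : Tr Y S L i nd nd' out) : nd.sendSlot ≤ nd'.sendSlot ∧
    (nd'.sendSlot = nd.sendSlot → nd'.sendCert = nd.sendCert ∧
      ∀ b, nd.sendBatch = some b → nd'.sendBatch = some b) := by
  cases h <;> try exact ⟨le_rfl, fun _ => ⟨rfl, fun _ h => h⟩⟩
  all_goals grind

theorem Tr.epoch_le (h : Tr Y S L i nd nd' out) : nd.epoch ≤ nd'.epoch ∧
    (nd'.epoch = nd.epoch → nd'.ordered = nd.ordered) := by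
  cases h <;> try exact ⟨le_rfl, fun _ => rfl⟩
  all_goals grind

theorem Tr.blocks_prefix (h : Tr Y S L i nd nd' out) : nd.blocks <+: nd'.blocks := by
  cases h <;> try exact List.prefix_rfl
  all_goals exact List.prefix_append _ _

/-- Invariants of the consensus process of a node. -/
structure ConsInv (nd : Node n) : Prop where
  epoch_pos : 1 ≤ nd.epoch
  in_le : ∀ e, (nd.mvbaIn e).isSome = true → 1 ≤ e ∧ e ≤ nd.epoch
  out_lt : ∀ e, 1 ≤ e → e < nd.epoch → (nd.mvbaOut e).isSome = true
  out_in : ∀ e, (nd.mvbaOut e).isSome = true → (nd.mvbaIn e).isSome = true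
  ordered_first : nd.epoch = 1 → nd.ordered = fun _ => ⟨0, [], []⟩
  ordered_succ : ∀ e, 1 ≤ e → nd.epoch = e + 1 → nd.mvbaOut e = some nd.ordered
  blocks_length : nd.blocks.length + 1 = nd.epoch

theorem ConsInv.initial : ConsInv ({} : Node n) := by
  constructor <;> simp <;> omega

theorem ConsInv.tr (h : Tr Y S L i nd nd' out) (hI : ConsInv nd) : ConsInv nd' := by
  obtain ⟨h1, h2, h3, h4, h5, h6, h7⟩ := hI
  cases h <;> try exact ⟨h1, h2, h3, h4, h5, h6, h7⟩
  all_goals constructor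
  all_goals grind [Function.update_apply]

end Monotone

/-! ### Invariants, monotonicity and uniqueness along an execution -/

section Trace

variable {n f : ℕ} (Y : System n f) (C : Finset (Fin n)) (x : Outcome n)

local notation "𝒩" => nodeAt Y C x

theorem inv_nodeAt (t : ℕ) (i : Fin n) : Inv Y x.1 (𝒩 t i) := by
  induction t with
  | zero => exact Inv.initial
  | succ t ih => obtain ⟨out, h, -⟩ := tr_step Y C x t i; exact ih.tr h

theorem consInv_nodeAt (t : ℕ) (i : Fin n) : ConsInv (𝒩 t i) := by
  induction t with
  | zero => exact ConsInv.initial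
  | succ t ih => obtain ⟨out, h, -⟩ := tr_step Y C x t i; exact ih.tr h

/-- A property of the state of a node that no transition destroys is never lost. -/
theorem persists (i : Fin n) (P : Node n → Prop)
    (hP : ∀ L nd nd' out, Tr Y x.1 L i nd nd' out → Inv Y x.1 nd → P nd → P nd') {t t' : ℕ}
    (h : t ≤ t') (ht : P (𝒩 t i)) : P (𝒩 t' i) := by
  induction t', h using Nat.le_induction with
  | base => exact ht
  | succ t' _ ih =>
    obtain ⟨out, h, -⟩ := tr_step Y C x t' i
    exact hP _ _ _ _ h (inv_nodeAt Y C x t' i) ih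

theorem fixed_isSome_mono {t t' : ℕ} (h : t ≤ t') (i j : Fin n) (k : ℕ)
    (hf : ((𝒩 t i).fixed j k).isSome = true) : ((𝒩 t' i).fixed j k).isSome = true :=
  persists Y C x i (fun nd => (nd.fixed j k).isSome = true)
    (fun _ _ _ _ h _ => h.fixed_isSome j k) h hf

theorem maxMissing_mono {t t' : ℕ} (h : t ≤ t') (i j : Fin n) :
    ((𝒩 t i).maxMissing j).slot ≤ ((𝒩 t' i).maxMissing j).slot :=
  persists Y C x i (fun nd => ((𝒩 t i).maxMissing j).slot ≤ (nd.maxMissing j).slot)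
    (fun _ _ _ _ h _ h' => h'.trans (h.maxMissing_le j)) h le_rfl

theorem recvSlot_mono {t t' : ℕ} (h : t ≤ t') (i j : Fin n) :
    (𝒩 t i).recvSlot j ≤ (𝒩 t' i).recvSlot j :=
  persists Y C x i (fun nd => (𝒩 t i).recvSlot j ≤ nd.recvSlot j)
    (fun _ _ _ _ h hI h' => h'.trans (h.recvSlot_le hI j).1) h le_rfl

theorem current_mono {t t' : ℕ} (h : t ≤ t') (i j : Fin n) :
    ((𝒩 t i).current j).slot ≤ ((𝒩 t' i).current j).slot := by
  rw [(inv_nodeAt Y C x t i).current_slot, (inv_nodeAt Y C x t' i).current_slot]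
  exact Nat.sub_le_sub_right (recvSlot_mono Y C x h i j) 2

theorem signed_mono {t t' : ℕ} (h : t ≤ t') (i : Fin n) (m : Bits) (hm : m ∈ (𝒩 t i).signed) :
    m ∈ (𝒩 t' i).signed :=
  persists Y C x i (fun nd => m ∈ nd.signed) (fun _ _ _ _ h _ => h.signed_subset m) h hm

theorem mvbaIn_mono {t t' : ℕ} (h : t ≤ t') (i : Fin n) (e : ℕ) (v : Vec n)
    (hv : (𝒩 t i).mvbaIn e = some v) : (𝒩 t' i).mvbaIn e = some v :=
  persists Y C x i (fun nd => nd.mvbaIn e = some v) (fun _ _ _ _ h _ => h.mvbaIn_some e v) h hv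

theorem mvbaOut_mono {t t' : ℕ} (h : t ≤ t') (i : Fin n) (e : ℕ) (v : Vec n)
    (hv : (𝒩 t i).mvbaOut e = some v) : (𝒩 t' i).mvbaOut e = some v :=
  persists Y C x i (fun nd => nd.mvbaOut e = some v) (fun _ _ _ _ h _ => h.mvbaOut_some e v) h hv

theorem votes_mono {t t' : ℕ} (h : t ≤ t') (i : Fin n) (w : Fin n × ℕ × Bits)
    (hw : w ∈ (𝒩 t i).votes) : w ∈ (𝒩 t' i).votes :=
  persists Y C x i (fun nd => w ∈ nd.votes) (fun _ _ _ _ h _ => h.votes_subset w) h hw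

theorem helps_mono {t t' : ℕ} (h : t ≤ t') (i : Fin n)
    (w : Fin n × Fin n × ℕ × Bits × Bits × List Bits)
    (hw : w ∈ (𝒩 t i).helps) : w ∈ (𝒩 t' i).helps :=
  persists Y C x i (fun nd => w ∈ nd.helps) (fun _ _ _ _ h _ => h.helps_subset w) h hw

theorem seen_mono {t t' : ℕ} (h : t ≤ t') (i j : Fin n) (s : ℕ) (hs : s ∈ (𝒩 t i).seen j) :
    s ∈ (𝒩 t' i).seen j :=
  persists Y C x i (fun nd => s ∈ nd.seen j) (fun _ _ _ _ h _ => h.seen_subset j s) h hs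

theorem sendSlot_mono {t t' : ℕ} (h : t ≤ t') (i : Fin n) :
    (𝒩 t i).sendSlot ≤ (𝒩 t' i).sendSlot :=
  persists Y C x i (fun nd => (𝒩 t i).sendSlot ≤ nd.sendSlot)
    (fun _ _ _ _ h _ h' => h'.trans h.send_mono.1) h le_rfl

theorem epoch_mono {t t' : ℕ} (h : t ≤ t') (i : Fin n) :
    (𝒩 t i).epoch ≤ (𝒩 t' i).epoch :=
  persists Y C x i (fun nd => (𝒩 t i).epoch ≤ nd.epoch)
    (fun _ _ _ _ h _ h' => h'.trans h.epoch_le.1) h le_rfl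

theorem blocks_mono {t t' : ℕ} (h : t ≤ t') (i : Fin n) :
    (𝒩 t i).blocks <+: (𝒩 t' i).blocks :=
  persists Y C x i (fun nd => (𝒩 t i).blocks <+: nd.blocks)
    (fun _ _ _ _ h _ h' => h'.trans h.blocks_prefix) h List.prefix_rfl

theorem sent_mono {t t' : ℕ} (h : t ≤ t') (w : Fin n × Fin n × Msg n)
    (hw : w ∈ (exec Y C x t).sent) : w ∈ (exec Y C x t').sent := by
  induction t', h using Nat.le_induction with
  | base => exact hw
  | succ t' _ ih =>
    obtain ⟨out, -, h⟩ := tr_step Y C x t' w.1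
    exact (h w.2.1 w.2.2).2 (Or.inl ih)

/-- The latest batch is replaced only in the steps that increase `recvSlot`. -/
theorem latest_eq_of_recvSlot_eq {t t' : ℕ} (h : t ≤ t') (i j : Fin n)
    (he : (𝒩 t' i).recvSlot j = (𝒩 t i).recvSlot j) :
    (𝒩 t' i).latest j = (𝒩 t i).latest j := by
  have := persists Y C x i (fun nd => (𝒩 t i).recvSlot j ≤ nd.recvSlot j ∧
    (nd.recvSlot j = (𝒩 t i).recvSlot j → nd.latest j = (𝒩 t i).latest j))
    (fun _ _ _ _ h hI h' => by
      have h1 := h.recvSlot_le hI j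
      refine ⟨h'.1.trans h1.1, fun h2 => ?_⟩
      have h3 := le_antisymm h1.1 (h2.le.trans h'.1)
      rw [h1.2 h3.symm, h'.2 (h3.trans h2)]) h ⟨le_rfl, fun _ => rfl⟩
  exact this.2 he

/-- No double voting: holding a batch of slot `k` as the latest one means `recvSlot = k + 1`, and
the batch cannot change while `recvSlot` keeps this value. -/
theorem latest_unique {t t' : ℕ} {i j : Fin n} {k : ℕ} {a b : Batch}
    (ha : (𝒩 t i).latest j = some (k, a)) (hb : (𝒩 t' i).latest j = some (k, b)) : a = b := by
  have h1 := ((inv_nodeAt Y C x t i).latest_some j k a ha).1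
  have h2 := ((inv_nodeAt Y C x t' i).latest_some j k b hb).1
  rcases le_total t t' with h | h
  · have := latest_eq_of_recvSlot_eq Y C x h i j (by omega)
    rw [ha, hb] at this; simp at this; exact this.symm
  · have := latest_eq_of_recvSlot_eq Y C x h i j (by omega)
    rw [ha, hb] at this; simpa using this

/-- A batch that was voted for stays the latest one until it is recorded as fixed. -/
theorem latest_or_fixed {t t' : ℕ} (h : t ≤ t') {i j : Fin n} {k : ℕ} {a : Batch}
    (ha : (𝒩 t i).latest j = some (k, a)) :
    (𝒩 t' i).latest j = some (k, a) ∨ ((𝒩 t' i).fixed j k).isSome = true := by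
  have h1 := (inv_nodeAt Y C x t i).latest_some j k a ha
  have h2 := recvSlot_mono Y C x h i j
  have hI := inv_nodeAt Y C x t' i
  rcases h2.eq_or_lt with h3 | h3
  · left; rw [latest_eq_of_recvSlot_eq Y C x h i j h3.symm, ha]
  · right
    refine hI.fixed_current j k h1.2 ?_
    rw [hI.current_slot]; omega

/-- Signing a share and recording the batch as the latest one happen in the same step. -/
theorem signed_origin {t : ℕ} {i : Fin n} {m : Bits} (hm : m ∈ (𝒩 t i).signed) :
    ∃ t' ≤ t, ∃ j s tx, (𝒩 t' i).latest j = some (s, tx) ∧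
      m = sigMsg j s (digest Y x.1 tx) := by
  induction t with
  | zero => simp [nodeAt, exec] at hm
  | succ t ih =>
    obtain ⟨out, h, -⟩ := tr_step Y C x t i
    have key : m ∈ (𝒩 t i).signed ∨ ∃ j s tx, (𝒩 (t + 1) i).latest j = some (s, tx) ∧
        m = sigMsg j s (digest Y x.1 tx) := by
      revert hm
      generalize 𝒩 (t + 1) i = nd' at h
      intro hm
      cases h <;> try exact Or.inl hm
      case voteFirst j tx _ _ _ _ _ _ =>
        exact (List.mem_cons.1 hm).symm.imp id fun h => ⟨j, 1, tx, by simp, h⟩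
      case voteNext j s tx _ _ _ _ _ _ _ _ _ _ =>
        exact (List.mem_cons.1 hm).symm.imp id fun h => ⟨j, s, tx, by simp, h⟩
      case voteJump j s tx _ _ _ _ =>
        exact (List.mem_cons.1 hm).symm.imp id fun h => ⟨j, s, tx, by simp, h⟩
    rcases key with hm | hr
    · obtain ⟨t', ht', hr⟩ := ih hm
      exact ⟨t', by omega, hr⟩
    · exact ⟨t + 1, le_rfl, hr⟩

theorem latest_of_signed {t : ℕ} {i j : Fin n} {k : ℕ} {d : Bits}
    (hm : sigMsg j k d ∈ (𝒩 t i).signed) :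
    ∃ t' ≤ t, ∃ tx, (𝒩 t' i).latest j = some (k, tx) ∧ digest Y x.1 tx = d := by
  obtain ⟨t', ht', j', s, tx, hl, he⟩ := signed_origin Y C x hm
  obtain ⟨h1, rfl, rfl⟩ := sigMsg_inj he
  obtain rfl := Fin.ext h1
  exact ⟨t', ht', tx, hl, rfl⟩

theorem vote_sent {t : ℕ} {i j : Fin n} {k : ℕ} {a : Batch}
    (ha : (𝒩 t i).latest j = some (k, a)) : (i, j, .vote k
      (Y.sig.shareSign (x.1.sk i) (sigMsg j k (digest Y x.1 a)))) ∈ (exec Y C x t).sent := by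
  induction t with
  | zero => simp [nodeAt, exec] at ha
  | succ t ih =>
    obtain ⟨out, h, hs⟩ := tr_step Y C x t i
    rw [hs]
    revert ha
    generalize 𝒩 (t + 1) i = nd' at h
    intro ha
    cases h <;> try exact Or.inl (ih ha)
    case voteFirst j' tx _ _ _ _ _ _ =>
      by_cases hj : j = j'
      · subst hj; simp at ha; obtain ⟨rfl, rfl⟩ := ha; simp
      · exact Or.inl (ih (by simpa [hj] using ha))
    case voteNext j' s tx _ _ _ _ _ _ _ _ _ _ =>
      by_cases hj : j = j'
      · subst hj; simp at ha; obtain ⟨rfl, rfl⟩ := ha; simp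
      · exact Or.inl (ih (by simpa [hj] using ha))
    case voteJump j' s tx _ _ _ _ =>
      by_cases hj : j = j'
      · subst hj; simp at ha; obtain ⟨rfl, rfl⟩ := ha; simp
      · exact Or.inl (ih (by simpa [hj] using ha))

/-! ### Origin of messages -/

theorem queue_origin {t : ℕ} {i j : Fin n} {s : ℕ} {tx : Batch} {cert : Option (Bits × Bits)}
    (hj : j ∉ C) (hq : (s, tx, cert) ∈ (𝒩 t i).queue j) :
    (j, i, .proposal s tx cert) ∈ (exec Y C x t).sent := by
  induction t with
  | zero => simp [nodeAt, exec] at hq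
  | succ t ih =>
    obtain ⟨out, h, -⟩ := tr_step Y C x t i
    apply sent_mono Y C x (Nat.le_succ t)
    revert hq
    generalize 𝒩 (t + 1) i = nd' at h
    intro hq
    cases h <;> try exact ih hq
    case recvProposal src s' tx' cert' hL =>
      by_cases e : j = src
      · subst e
        simp only [Function.update_self, List.mem_append, List.mem_singleton] at hq
        rcases hq with hq | hq
        · exact ih hq
        · simp only [Prod.mk.injEq] at hq
          obtain ⟨rfl, rfl, rfl⟩ := hq
          exact hL.resolve_left hj
      · exact ih (by simpa [e] using hq)
    all_goals
      apply ih
      grind [Function.update_apply]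

theorem jump_origin {t : ℕ} {i j : Fin n} {s : ℕ} {tx : Batch} {d σ : Bits}
    (hj : j ∉ C) (hq : (𝒩 t i).jump j = some (s, tx, d, σ)) :
    (j, i, .proposal s tx (some (d, σ))) ∈ (exec Y C x t).sent := by
  induction t with
  | zero => simp [nodeAt, exec] at hq
  | succ t ih =>
    obtain ⟨out, h, -⟩ := tr_step Y C x t i
    apply sent_mono Y C x (Nat.le_succ t)
    revert hq
    have ho := @queue_origin n f Y C x t i j
    generalize 𝒩 (t + 1) i = nd' at h
    intro hq
    cases h <;> try exact ih hq
    all_goals grind [Function.update_apply]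

theorem latest_origin {t : ℕ} {i j : Fin n} {s : ℕ} {tx : Batch}
    (hj : j ∉ C) (hq : (𝒩 t i).latest j = some (s, tx)) :
    ∃ cert, (j, i, .proposal s tx cert) ∈ (exec Y C x t).sent := by
  induction t with
  | zero => simp [nodeAt, exec] at hq
  | succ t ih =>
    obtain ⟨out, h, -⟩ := tr_step Y C x t i
    suffices h : ∃ cert, (j, i, .proposal s tx cert) ∈ (exec Y C x t).sent from
      h.imp fun _ => sent_mono Y C x (Nat.le_succ t) _
    revert hq
    have ho := @queue_origin n f Y C x t i j
    have ho' := @jump_origin n f Y C x t i j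
    generalize 𝒩 (t + 1) i = nd' at h
    intro hq
    cases h <;> try exact ih hq
    all_goals grind [Function.update_apply]

theorem helps_origin {t : ℕ} {i src j : Fin n} {k : ℕ} {root leaf : Bits} {branch : List Bits}
    (hs : src ∉ C) (hq : (src, j, k, root, leaf, branch) ∈ (𝒩 t i).helps) :
    (src, i, .help j k root leaf branch) ∈ (exec Y C x t).sent := by
  induction t with
  | zero => simp [nodeAt, exec] at hq
  | succ t ih =>
    obtain ⟨out, h, -⟩ := tr_step Y C x t i
    apply sent_mono Y C x (Nat.le_succ t)
    revert hq
    generalize 𝒩 (t + 1) i = nd' at h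
    intro hq
    cases h <;> try exact ih hq
    case recvHelp hL =>
      rcases List.mem_append.1 hq with hq | hq
      · exact ih hq
      · simp only [List.mem_singleton, Prod.mk.injEq] at hq
        obtain ⟨rfl, rfl, rfl, rfl, rfl, rfl⟩ := hq
        exact hL.resolve_left hs

theorem calls_origin {t : ℕ} {i src j : Fin n} {k : ℕ} {sig : Option Bits}
    (hs : src ∉ C) (hq : (src, j, k, sig) ∈ (𝒩 t i).calls) :
    (src, i, .callHelp j k sig) ∈ (exec Y C x t).sent := by
  induction t with
  | zero => simp [nodeAt, exec] at hq
  | succ t ih =>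
    obtain ⟨out, h, -⟩ := tr_step Y C x t i
    apply sent_mono Y C x (Nat.le_succ t)
    revert hq
    generalize 𝒩 (t + 1) i = nd' at h
    intro hq
    cases h <;> try exact ih hq
    case recvCall hL =>
      rcases List.mem_append.1 hq with hq | hq
      · exact ih hq
      · simp only [List.mem_singleton, Prod.mk.injEq] at hq
        obtain ⟨rfl, rfl, rfl, rfl⟩ := hq
        exact hL.resolve_left hs
    all_goals
      apply ih
      grind

/-- The bound `t' ≤ t` makes this usable in an induction on time, where a decoded batch is traced
back to an earlier record of an honest node. -/
theorem help_sent_origin {t : ℕ} {i dst j : Fin n} {k : ℕ} {root leaf : Bits}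
    {branch : List Bits} (hq : (i, dst, .help j k root leaf branch) ∈ (exec Y C x t).sent) :
    ∃ t' ≤ t, ∃ a, (𝒩 t' i).fixed j k = some a ∧
      root = merkleRoot (Y.hash x.1.hk) (Nat.clog 2 n) (leaves Y a) ∧ leaf = leaves Y a i ∧
      branch = merkleBranch (Y.hash x.1.hk) (Nat.clog 2 n) (leaves Y a) i := by
  induction t with
  | zero => simp [exec] at hq
  | succ t ih =>
    obtain ⟨out, h, hs⟩ := tr_step Y C x t i
    rcases (hs _ _).1 hq with hq | hq
    · obtain ⟨t', ht', hr⟩ := ih hq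
      exact ⟨t', by omega, hr⟩
    · refine ⟨t + 1, le_rfl, ?_⟩
      generalize 𝒩 (t + 1) i = nd' at h
      cases h <;> try simp [multicast] at hq
      case answer src j' k' sig rest fx _ _ _ ho =>
        rcases ho with ⟨rfl, -⟩ | ⟨tx, hf, rfl⟩
        · simp at hq
        · simp only [List.mem_singleton, Prod.mk.injEq, Msg.help.injEq] at hq
          obtain ⟨rfl, rfl, rfl, rfl, rfl, rfl⟩ := hq
          exact ⟨tx, hf, rfl, rfl, rfl⟩

end Trace

section Trace

variable {n f : ℕ} (Y : System n f) (C : Finset (Fin n)) (x : Outcome n)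

local notation "𝒩" => nodeAt Y C x

/-! ### The broadcast sender -/

theorem send_eq {t t' : ℕ} (h : t ≤ t') (j : Fin n)
    (he : (𝒩 t' j).sendSlot = (𝒩 t j).sendSlot) : (𝒩 t' j).sendCert = (𝒩 t j).sendCert ∧
      ∀ b, (𝒩 t j).sendBatch = some b → (𝒩 t' j).sendBatch = some b := by
  have := persists Y C x j (fun nd => (𝒩 t j).sendSlot ≤ nd.sendSlot ∧
    (nd.sendSlot = (𝒩 t j).sendSlot → nd.sendCert = (𝒩 t j).sendCert ∧
      ∀ b, (𝒩 t j).sendBatch = some b → nd.sendBatch = some b))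
    (fun _ _ _ _ h _ h' => by
      have h1 := h.send_mono
      refine ⟨h'.1.trans h1.1, fun h2 => ?_⟩
      have h3 := le_antisymm h1.1 (h2.le.trans h'.1)
      have h4 := h'.2 (h3.trans h2)
      have h5 := h1.2 h3.symm
      exact ⟨h5.1.trans h4.1, fun b hb => h5.2 b (h4.2 b hb)⟩)
    h ⟨le_rfl, fun _ => ⟨rfl, fun _ h => h⟩⟩
  exact this.2 he

theorem sendBatch_unique {t t' : ℕ} {j : Fin n} {a b : Batch}
    (he : (𝒩 t j).sendSlot = (𝒩 t' j).sendSlot) (ha : (𝒩 t j).sendBatch = some a)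
    (hb : (𝒩 t' j).sendBatch = some b) : a = b := by
  rcases le_total t t' with h | h
  · have := (send_eq Y C x h j he.symm).2 a ha
    rw [hb] at this; simpa using this.symm
  · have := (send_eq Y C x h j he).2 b hb
    rw [ha] at this; simpa using this

theorem Proposed.unique {j : Fin n} {s : ℕ} {a b : Batch} (ha : Proposed Y C x j s a)
    (hb : Proposed Y C x j s b) : a = b := by
  obtain ⟨t, h1, h2⟩ := ha
  obtain ⟨t', h3, h4⟩ := hb
  exact sendBatch_unique Y C x (h1.trans h3.symm) h2 h4

theorem proposal_sent {t : ℕ} {j : Fin n} {a : Batch} (ha : (𝒩 t j).sendBatch = some a)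
    (dst : Fin n) : (j, dst, .proposal (𝒩 t j).sendSlot a (𝒩 t j).sendCert) ∈
      (exec Y C x t).sent := by
  induction t with
  | zero => simp [nodeAt, exec] at ha
  | succ t ih =>
    obtain ⟨out, h, hs⟩ := tr_step Y C x t j
    rw [hs]
    revert ha
    generalize 𝒩 (t + 1) j = nd' at h
    intro ha
    cases h <;> try exact Or.inl (ih ha)
    case propose hn =>
      right
      simp only [Option.some.injEq] at ha
      subst ha
      simp [multicast]
    case advance => simp at ha

theorem proposal_origin {t : ℕ} {j dst : Fin n} {s : ℕ} {a : Batch}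
    {cert : Option (Bits × Bits)} (h : (j, dst, .proposal s a cert) ∈ (exec Y C x t).sent) :
    ∃ t' ≤ t, (𝒩 t' j).sendSlot = s ∧ (𝒩 t' j).sendBatch = some a ∧
      (𝒩 t' j).sendCert = cert := by
  induction t with
  | zero => simp [exec] at h
  | succ t ih =>
    obtain ⟨out, ht, hs⟩ := tr_step Y C x t j
    rcases (hs _ _).1 h with h | h
    · obtain ⟨t', ht', hr⟩ := ih h
      exact ⟨t', by omega, hr⟩
    · refine ⟨t + 1, le_rfl, ?_⟩
      generalize 𝒩 (t + 1) j = nd' at ht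
      cases ht <;> try simp [multicast] at h
      case propose =>
        obtain ⟨rfl, rfl, rfl⟩ := h
        simp
      case answer ho =>
        rcases ho with ⟨rfl, -⟩ | ⟨tx, hf, rfl⟩ <;> simp at h

theorem sendSlot_pos (t : ℕ) (j : Fin n) : 1 ≤ (𝒩 t j).sendSlot := by
  have := sendSlot_mono Y C x (Nat.zero_le t) j
  exact this.trans' (by simp [nodeAt, exec])

theorem sendCert_origin {t : ℕ} {j : Fin n} {s : ℕ} (hs : 1 ≤ s)
    (h : (𝒩 t j).sendSlot = s + 1) : ∃ t' < t, ∃ tx, (𝒩 t' j).sendSlot = s ∧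
      (𝒩 t' j).sendBatch = some tx ∧
      n - f ≤ (Finset.univ.filter fun i =>
        (validShares Y x.1 j s tx (𝒩 t' j) i).isSome).card ∧
      (𝒩 t j).sendCert = some (digest Y x.1 tx, Y.sig.combine x.1.pk
        (sigMsg j s (digest Y x.1 tx)) (validShares Y x.1 j s tx (𝒩 t' j))) := by
  induction t with
  | zero => simp [nodeAt, exec] at h; omega
  | succ t ih =>
    obtain ⟨out, ht, -⟩ := tr_step Y C x t j
    have h1 := ht.send_mono
    by_cases he : (𝒩 (t + 1) j).sendSlot = (𝒩 t j).sendSlot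
    · obtain ⟨t', ht', tx, h2⟩ := ih (he ▸ h)
      rw [(h1.2 he).1]
      exact ⟨t', by omega, tx, h2⟩
    · refine ⟨t, by omega, ?_⟩
      revert h he
      generalize 𝒩 (t + 1) j = nd' at ht
      intro h he
      cases ht <;> try exact absurd rfl he
      case advance tx h3 h4 =>
        have : (𝒩 t j).sendSlot = s := by simpa using h
        subst this
        exact ⟨tx, rfl, h3, h4, rfl⟩

theorem proposed_of_lt {t : ℕ} {j : Fin n} {s : ℕ} (hs : 1 ≤ s) (h : s < (𝒩 t j).sendSlot) :
    ∃ b, Proposed Y C x j s b := by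
  induction t with
  | zero => simp [nodeAt, exec] at h; omega
  | succ t ih =>
    by_cases hlt : s < (𝒩 t j).sendSlot
    · exact ih hlt
    · obtain ⟨out, ht, -⟩ := tr_step Y C x t j
      have h1 : (𝒩 (t + 1) j).sendSlot ≤ (𝒩 t j).sendSlot + 1 := by
        generalize 𝒩 (t + 1) j = nd' at ht
        cases ht <;> simp
      obtain ⟨t', -, tx, h2, h3, -⟩ := sendCert_origin Y C x (t := t + 1) (j := j) hs (by omega)
      exact ⟨tx, t', h2, h3⟩

/-! ### Consensus -/

/-- Both the state before the input, which determines its value, and the state after it, at which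
`MvbaSafe` wants it to be valid, are retained. -/
theorem mvbaIn_origin {t : ℕ} {i : Fin n} {e : ℕ} {v : Vec n} (h : (𝒩 t i).mvbaIn e = some v) :
    ∃ t' < t, (𝒩 t' i).epoch = e ∧ (𝒩 t' i).mvbaIn e = none ∧ v = inputVec (𝒩 t' i) ∧
      n - f ≤ (Finset.univ.filter fun j =>
        ((𝒩 t' i).ordered j).slot < ((𝒩 t' i).current j).slot).card ∧
      (𝒩 (t' + 1) i).epoch = e ∧ (𝒩 (t' + 1) i).mvbaIn e = some v ∧
      (𝒩 (t' + 1) i).ordered = (𝒩 t' i).ordered := by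
  induction t with
  | zero => simp [nodeAt, exec] at h
  | succ t ih =>
    obtain ⟨out, ht, -⟩ := tr_step Y C x t i
    by_cases hn : (𝒩 t i).mvbaIn e = some v
    · obtain ⟨t', ht', hr⟩ := ih hn
      exact ⟨t', by omega, hr⟩
    · refine ⟨t, by omega, ?_⟩
      revert h
      generalize 𝒩 (t + 1) i = nd' at ht
      intro h
      cases ht <;> try exact absurd h hn
      case give h1 h2 =>
        by_cases he : e = (𝒩 t i).epoch
        · subst he
          simp only [Function.update_self, Option.some.injEq] at h
          subst h
          exact ⟨rfl, h1, rfl, h2, rfl, by simp, rfl⟩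
        · exact absurd (by simpa [he] using h) hn

/-- Epochs count from `1` and list positions from `0`, so the block at position `e` belongs to epoch
`e + 1`. -/
theorem block_origin {t : ℕ} {i : Fin n} {e : ℕ} {b : List Bits}
    (h : (𝒩 t i).blocks[e]? = some b) :
    ∃ t' < t, ∃ v, (𝒩 t' i).epoch = e + 1 ∧ (𝒩 t' i).mvbaOut (e + 1) = some v ∧
      (∀ j, complete (𝒩 t' i) v j = true) ∧ b = blockOf (𝒩 t' i) v := by
  induction t with
  | zero => simp [nodeAt, exec] at h
  | succ t ih =>
    obtain ⟨out, ht, -⟩ := tr_step Y C x t i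
    by_cases hn : (𝒩 t i).blocks[e]? = some b
    · obtain ⟨t', ht', hr⟩ := ih hn
      exact ⟨t', by omega, hr⟩
    · refine ⟨t, by omega, ?_⟩
      revert h
      have hI := (consInv_nodeAt Y C x t i).blocks_length
      generalize 𝒩 (t + 1) i = nd' at ht
      intro h
      cases ht <;> try exact absurd h hn
      case output v h1 h2 h3 =>
        rcases lt_trichotomy e (𝒩 t i).blocks.length with hl | hl | hl
        · exact absurd (by simpa [List.getElem?_append_left hl] using h) hn
        · subst hl
          simp only [List.getElem?_concat_length, Option.some.injEq] at h
          exact ⟨v, hI.symm, by rw [hI]; exact h2, h3, h.symm⟩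
        · rw [List.getElem?_eq_none (by simp; omega)] at h
          simp at h

end Trace

/-! ### Collecting fragments for one Merkle root -/

section Fragments

variable {n f : ℕ} (Y : System n f) (S : Setup n)

theorem fragments_eq_some {j : Fin n} {k : ℕ} {root leaf : Bits} {nd : Node n} {s : Fin n}
    (h : fragments Y S j k root nd s = some leaf) : ∃ branch,
      (s, j, k, root, leaf, branch) ∈ nd.helps ∧
      merkleVerify (Y.hash S.hk) (Nat.clog 2 n) s root leaf branch = true := by
  unfold fragments at h
  rw [Option.map_eq_some_iff] at h
  obtain ⟨⟨s', j', k', root', leaf', branch⟩, h1, h2⟩ := h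
  have h3 := List.find?_some h1
  have h4 := List.mem_of_find?_eq_some h1
  simp only [Bool.and_eq_true, decide_eq_true_eq] at h2 h3
  obtain ⟨⟨⟨⟨rfl, rfl⟩, rfl⟩, rfl⟩, h5⟩ := h3
  subst h2
  exact ⟨branch, h4, h5⟩

theorem fragments_isSome {j : Fin n} {k : ℕ} {root leaf : Bits} {branch : List Bits}
    {nd : Node n} {s : Fin n} (h : (s, j, k, root, leaf, branch) ∈ nd.helps)
    (hv : merkleVerify (Y.hash S.hk) (Nat.clog 2 n) s root leaf branch = true) :
    (fragments Y S j k root nd s).isSome = true := by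
  unfold fragments
  rw [Option.isSome_map, List.find?_isSome]
  exact ⟨_, h, by simp [hv]⟩

theorem fullRoot_eq_some {j : Fin n} {k : ℕ} {root : Bits} {nd : Node n}
    (h : fullRoot Y S j k nd = some root) : n - 2 * f ≤
      (Finset.univ.filter fun s => (fragments Y S j k root nd s).isSome).card := by
  simpa using List.find?_some h

/-- The search runs only over the roots that occur in received messages. Since `n - 2f > 0`, at
least one fragment for `root` was received, so `root` is among them. The root found may be a
different one. -/
theorem fullRoot_isSome (hn : 3 * f < n) {j : Fin n} {k : ℕ} {root : Bits} {nd : Node n}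
    (h : n - 2 * f ≤
      (Finset.univ.filter fun s => (fragments Y S j k root nd s).isSome).card) :
    (fullRoot Y S j k nd).isSome = true := by
  have hpos : 0 < (Finset.univ.filter fun s =>
    (fragments Y S j k root nd s).isSome = true).card := by omega
  obtain ⟨s, hs⟩ := Finset.card_pos.1 hpos
  obtain ⟨leaf, hl⟩ := Option.isSome_iff_exists.1 (Finset.mem_filter.1 hs).2
  obtain ⟨branch, hm, -⟩ := fragments_eq_some Y S hl
  unfold fullRoot
  rw [List.find?_isSome]
  exact ⟨root, List.mem_map.2 ⟨_, hm, rfl⟩, by simpa using h⟩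

theorem fullRoot_isSome_mono (hn : 3 * f < n) {j : Fin n} {k : ℕ} {nd nd' : Node n}
    (hh : ∀ w ∈ nd.helps, w ∈ nd'.helps) (h : (fullRoot Y S j k nd).isSome = true) :
    (fullRoot Y S j k nd').isSome = true := by
  obtain ⟨root, hr⟩ := Option.isSome_iff_exists.1 h
  refine fullRoot_isSome Y S hn (root := root) ((fullRoot_eq_some Y S hr).trans ?_)
  refine Finset.card_le_card fun s hs => ?_
  obtain ⟨leaf, hl⟩ := Option.isSome_iff_exists.1 (Finset.mem_filter.1 hs).2
  obtain ⟨branch, hm, hv⟩ := fragments_eq_some Y S hl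
  exact Finset.mem_filter.2 ⟨Finset.mem_univ _, fragments_isSome Y S (hh _ hm) hv⟩

theorem fin_lt_two_pow_clog (s : Fin n) : (s : ℕ) < 2 ^ Nat.clog 2 n :=
  s.isLt.trans_le (Nat.le_pow_clog one_lt_two n)

end Fragments

/-! ## Good outcomes -/

section Good

variable {n f : ℕ} (Y : System n f) (C : Finset (Fin n)) (x : Outcome n)

/-- Outcomes with a fair schedule, correct keys and secure MVBA instances, in which no signature
is forged and no collision is found. -/
structure Good : Prop where
  card_corrupt : C.card ≤ f
  three_mul_lt : 3 * f < n
  batch_pos : 0 < Y.batchSize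
  fair : Fair Y C x
  unforged : ∀ t m σ, (m, σ) ∈ shownSigs Y C x t → Y.sig.verify x.1.pk m σ = true →
    n - f ≤ ({i | i ∈ C ∨ (i ∉ C ∧ m ∈ (nodeAt Y C x t i).signed)} : Set (Fin n)).ncard
  no_collision : ∀ a b, (a, b) ∈ shownPairs Y C x → Y.hash x.1.hk a = Y.hash x.1.hk b → a = b
  mvba : ∀ e, MvbaSafe Y C x e
  share_ok : ∀ i m, Y.sig.shareVerify x.1.pk i m (Y.sig.shareSign (x.1.sk i) m) = true
  combine_ok : ∀ m (c : Fin n → Option Bits),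
    (∀ i σ, c i = some σ → Y.sig.shareVerify x.1.pk i m σ = true) →
    n - f ≤ (Finset.univ.filter fun i => (c i).isSome).card →
    Y.sig.verify x.1.pk m (Y.sig.combine x.1.pk m c) = true

local notation "𝒩" => nodeAt Y C x

/-- Together with the corrupted nodes, at least `n - f` nodes have signed `m`. -/
def Quorum (t : ℕ) (m : Bits) : Prop :=
  ∃ Q : Finset (Fin n), n - f ≤ Q.card + C.card ∧ ∀ i ∈ Q, i ∉ C ∧ m ∈ (𝒩 t i).signed

/-- The batch `a` of slot `k` of the broadcast of `j` is certified, and known to an honest node. -/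
def CertBatch (j : Fin n) (k : ℕ) (a : Batch) : Prop :=
  (∃ t, Quorum Y C x t (sigMsg j k (digest Y x.1 a))) ∧
    ∃ i, i ∉ C ∧ ∃ t, (𝒩 t i).latest j = some (k, a)

variable {Y C x}

theorem Quorum.mono {t t' : ℕ} (h : t ≤ t') {m : Bits} (hq : Quorum Y C x t m) :
    Quorum Y C x t' m :=
  hq.imp fun _ hQ => ⟨hQ.1, fun i hi => ⟨(hQ.2 i hi).1, signed_mono Y C x h i m (hQ.2 i hi).2⟩⟩

/-- Unforgeability in a form for counting: the signers are split into the corrupted nodes and a set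
of honest ones. -/
theorem Good.quorum_of_shown (G : Good Y C x) {t : ℕ} {m σ : Bits}
    (h : (m, σ) ∈ shownSigs Y C x t) (hv : Y.sig.verify x.1.pk m σ = true) :
    Quorum Y C x t m := by
  classical
  have h1 := G.unforged t m σ h hv
  refine ⟨Finset.univ.filter fun i => i ∉ C ∧ m ∈ (𝒩 t i).signed, h1.trans ?_, fun i hi =>
    (Finset.mem_filter.1 hi).2⟩
  rw [add_comm, Set.ncard_eq_toFinset_card']
  refine le_trans (Finset.card_le_card fun i hi => ?_) (Finset.card_union_le _ _)
  simpa using hi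

/-- The honest parts have at least `n - f - |C|` elements each and lie in a set of `n - |C|`
elements, so they share at least `n - 2f - |C| ≥ n - 3f > 0` nodes. -/
theorem Good.quorum_inter (G : Good Y C x) {t t' : ℕ} {m m' : Bits} (h : Quorum Y C x t m)
    (h' : Quorum Y C x t' m') : ∃ i, i ∉ C ∧ m ∈ (𝒩 t i).signed ∧ m' ∈ (𝒩 t' i).signed := by
  obtain ⟨Q, h1, h2⟩ := h
  obtain ⟨Q', h1', h2'⟩ := h'
  have h3 : (Q ∪ Q').card ≤ n - C.card := by
    have hc : Cᶜ.card = n - C.card := by rw [Finset.card_compl, Fintype.card_fin]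
    rw [← hc]
    refine Finset.card_le_card fun i hi => Finset.mem_compl.2 ?_
    rcases Finset.mem_union.1 hi with hi | hi
    · exact (h2 i hi).1
    · exact (h2' i hi).1
  have h4 := Finset.card_union_add_card_inter Q Q'
  have h5 := G.card_corrupt
  have h6 := G.three_mul_lt
  obtain ⟨i, hi⟩ := Finset.card_pos.1 (show 0 < (Q ∩ Q').card by omega)
  have hi := Finset.mem_inter.1 hi
  exact ⟨i, (h2 i hi.1).1, (h2 i hi.1).2, (h2' i hi.2).2⟩

theorem Good.quorum_current (G : Good Y C x) {t : ℕ} {i j : Fin n} (hi : i ∉ C)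
    (h : 0 < ((𝒩 t i).current j).slot) : Quorum Y C x t
      (sigMsg j ((𝒩 t i).current j).slot ((𝒩 t i).current j).digest) :=
  G.quorum_of_shown ⟨i, j, hi, Or.inl ⟨h, rfl⟩⟩
    (((inv_nodeAt Y C x t i).current_valid j).resolve_left h.ne')

theorem Good.quorum_jump (G : Good Y C x) {t : ℕ} {i j : Fin n} {s : ℕ} {tx : Batch}
    {d σ : Bits} (hi : i ∉ C) (h : (𝒩 t i).jump j = some (s, tx, d, σ)) :
    Quorum Y C x t (sigMsg j (s - 1) d) :=
  G.quorum_of_shown ⟨i, j, hi, Or.inr (Or.inl ⟨s, tx, d, σ, h, rfl⟩)⟩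
    ((inv_nodeAt Y C x t i).jump_some j s tx d σ h).2.1

theorem Good.quorum_call (G : Good Y C x) {t : ℕ} {i src j : Fin n} {k : ℕ} {tx : Batch}
    {σ : Bits} (hi : i ∉ C) (h : (src, j, k, some σ) ∈ (𝒩 t i).calls)
    (hl : (𝒩 t i).latest j = some (k, tx))
    (hv : certValid Y x.1 j ⟨k, digest Y x.1 tx, σ⟩ = true) :
    Quorum Y C x t (sigMsg j k (digest Y x.1 tx)) :=
  G.quorum_of_shown ⟨i, j, hi, Or.inr (Or.inr (Or.inl ⟨src, k, tx, σ, h, hl, rfl⟩))⟩ hv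

theorem Good.quorum_mvba (G : Good Y C x) {t : ℕ} {i : Fin n} {e : ℕ} {v : Vec n} {j : Fin n}
    (hi : i ∉ C) (h : (𝒩 t i).mvbaOut e = some v) (hs : 0 < (v j).slot)
    (hv : certValid Y x.1 j (v j) = true) :
    Quorum Y C x t (sigMsg j (v j).slot (v j).digest) :=
  G.quorum_of_shown ⟨i, j, hi, Or.inr (Or.inr (Or.inr ⟨e, v, h, hs, rfl⟩))⟩ hv

/-- The entry `maxMissing` is not among the shown signatures, but each of its values came either
from a pending jump or from an MVBA output, and both of these are. -/
theorem Good.quorum_maxMissing (G : Good Y C x) {t : ℕ} {i j : Fin n} (hi : i ∉ C)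
    (h : 0 < ((𝒩 t i).maxMissing j).slot) : Quorum Y C x t
      (sigMsg j ((𝒩 t i).maxMissing j).slot ((𝒩 t i).maxMissing j).digest) := by
  induction t with
  | zero => simp [nodeAt, exec] at h
  | succ t ih =>
    obtain ⟨out, ht, -⟩ := tr_step Y C x t i
    have hq := fun (s : ℕ) (tx : Batch) (d σ : Bits) =>
      G.quorum_jump (t := t + 1) (j := j) (s := s) (tx := tx) (d := d) (σ := σ) hi
    revert h
    replace ih := fun h => (ih h).mono (Nat.le_succ t)
    generalize 𝒩 (t + 1) i = nd' at ht hq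
    intro h
    cases ht <;> try exact ih h
    case jumpStart j' s tx d σ rest mm lp h1 h2 h3 h4 h5 h6 =>
      by_cases e : j = j'
      · subst e
        simp only [Function.update_self] at h hq ⊢
        rcases h6 with ⟨rfl, -⟩ | ⟨rfl, -⟩
        · exact ih h
        · exact hq s tx d σ rfl
      · simp only [Function.update_of_ne e] at h ⊢
        exact ih h
    case fetch v mm lp h1 h2 =>
      rcases h2 j with ⟨h3, -⟩ | ⟨h3, -⟩ | ⟨h3, -, -, h4, -⟩
      · simp only [h3] at h ⊢; exact ih h
      · simp only [h3] at h ⊢; exact ih h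
      · simp only [h3] at h ⊢
        exact (G.quorum_mvba hi h1 h h4).mono (Nat.le_succ t)

/-- An honest node common to both quorums would have signed both digests, but it votes for only one
batch in a slot. -/
theorem Good.digest_unique (G : Good Y C x) {t t' : ℕ} {j : Fin n} {k : ℕ} {d d' : Bits}
    (h : Quorum Y C x t (sigMsg j k d)) (h' : Quorum Y C x t' (sigMsg j k d')) : d = d' := by
  obtain ⟨i, hi, h1, h2⟩ := G.quorum_inter h h'
  obtain ⟨t₁, -, a, ha, rfl⟩ := latest_of_signed Y C x h1
  obtain ⟨t₂, -, b, hb, rfl⟩ := latest_of_signed Y C x h2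
  rw [latest_unique Y C x ha hb]

theorem Good.batch_unique (G : Good Y C x) {t t' : ℕ} {i i' j : Fin n} {k : ℕ} {a b : Batch}
    (hi : i ∉ C) (hi' : i' ∉ C) (ha : (𝒩 t i).latest j = some (k, a))
    (hb : (𝒩 t' i').latest j = some (k, b)) (h : digest Y x.1 a = digest Y x.1 b) : a = b :=
  ser_injective (G.no_collision _ _
    ⟨i, i', j, k, t, t', hi, hi', Or.inl ⟨a, b, ha, hb, rfl⟩⟩ h)

theorem Good.certBatch_unique (G : Good Y C x) {j : Fin n} {k : ℕ} {a b : Batch}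
    (ha : CertBatch Y C x j k a) (hb : CertBatch Y C x j k b) : a = b := by
  obtain ⟨⟨t, hq⟩, i, hi, t₁, hl⟩ := ha
  obtain ⟨⟨t', hq'⟩, i', hi', t₁', hl'⟩ := hb
  exact G.batch_unique hi hi' hl hl' (G.digest_unique hq hq')

/-- A received fragment with a valid branch for the root of the tree over a recorded batch is a
fragment of this batch. -/
theorem Good.fragment_eq (G : Good Y C x) {t t' : ℕ} {i i' j : Fin n} {k : ℕ} {a : Batch}
    (hi : i ∉ C) (hi' : i' ∉ C) (ha : (𝒩 t i).fixed j k = some a) {s : Fin n} {leaf : Bits}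
    (h : fragments Y x.1 j k (merkleRoot (Y.hash x.1.hk) (Nat.clog 2 n) (leaves Y a))
      (𝒩 t' i') s = some leaf) : leaf = Y.code.encode a s := by
  obtain ⟨branch, h1, h2⟩ := fragments_eq_some Y x.1 h
  simp only [merkleVerify, Bool.and_eq_true, decide_eq_true_eq] at h2
  have h3 := merkleTop_merkleBranch (Y.hash x.1.hk) (Nat.clog 2 n) (leaves Y a) s
    (fin_lt_two_pow_clog s)
  have h4 : leaves Y a s = leaf := by
    refine merkle_leaf_unique (Y.hash x.1.hk) _ branch s _ _
      ((merkleBranch_length _ _ _ _).trans h2.1.symm) (h3.trans h2.2.symm) fun w hw => ?_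
    exact G.no_collision _ _
      ⟨i, i', j, k, t, t', hi, hi', Or.inr ⟨a, s, _, leaf, branch, ha, h1, hw⟩⟩
  rw [← h4]
  simp [leaves]

/-- Because `n - 2f > f ≥ |C|`. -/
theorem Good.exists_honest (G : Good Y C x) {A : Finset (Fin n)} (h : n - 2 * f ≤ A.card) :
    ∃ i ∈ A, i ∉ C := by
  by_contra! hc
  have h1 := Finset.card_le_card (show A ⊆ C from hc)
  have h2 := G.card_corrupt
  have h3 := G.three_mul_lt
  omega

/-- Strong induction on time, over all honest nodes at once. A batch is recorded either together
with a valid certificate, which gives a quorum, or by decoding. In the latter case it equals a batch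
recorded earlier at another honest node. -/
theorem Good.certBatch_of_fixed (G : Good Y C x) {t : ℕ} {i j : Fin n} {k : ℕ} {a : Batch}
    (hi : i ∉ C) (h : (𝒩 t i).fixed j k = some a) : CertBatch Y C x j k a := by
  induction t using Nat.strong_induction_on generalizing i a with
  | _ t ih =>
  rcases t with _ | t
  · simp [nodeAt, exec] at h
  obtain ⟨out, ht, -⟩ := tr_step Y C x t i
  replace ih : ∀ t' ≤ t, ∀ {i : Fin n} {a : Batch}, i ∉ C → (𝒩 t' i).fixed j k = some a →
    CertBatch Y C x j k a := fun t' ht' => ih t' (by omega)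
  have hq := G.quorum_current (t := t + 1) (j := j) hi
  revert h
  generalize 𝒩 (t + 1) i = nd' at ht hq
  intro h
  cases ht <;> try exact ih t le_rfl hi h
  case voteNext j' s tx σ tx₀ rest h1 h2 h3 h4 h5 h6 h7 =>
    simp only [update_update_apply] at h
    split at h
    · rename_i e
      obtain ⟨rfl, rfl⟩ := e
      simp only [Option.some.injEq] at h
      subst h
      have := (inv_nodeAt Y C x t i).recv_pos j
      simp only [Function.update_self] at hq
      exact ⟨⟨t + 1, hq (by omega)⟩, i, hi, t, h6⟩
    · exact ih t le_rfl hi h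
  case store j' k' root h1 h2 h3 =>
    simp only [update_update_apply] at h
    split at h
    · rename_i e
      obtain ⟨rfl, rfl⟩ := e
      simp only [Option.some.injEq] at h
      have h4 := fullRoot_eq_some Y x.1 h3
      -- An honest contributor `src` ties the root to a batch `b` that it had recorded. By Merkle
      -- binding all collected fragments, including those from corrupted nodes, are fragments of
      -- `b`, so decoding returns `b`.
      obtain ⟨src, hs, hsC⟩ := G.exists_honest h4
      obtain ⟨leaf, hl⟩ := Option.isSome_iff_exists.1 (Finset.mem_filter.1 hs).2
      obtain ⟨branch, hm, -⟩ := fragments_eq_some Y x.1 hl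
      obtain ⟨t', ht', b, hb, rfl, -⟩ :=
        help_sent_origin Y C x (helps_origin Y C x hsC hm)
      have h5 := Y.code.decode_encode b _ (fun s m hm => G.fragment_eq hsC hi hb hm) h4
      rw [h5] at h
      subst h
      exact ih t' ht' hsC hb
    · exact ih t le_rfl hi h
  case answer src j' k' sig rest fx h2 h1 h4 h3 =>
    rcases h4 with ⟨rfl, -⟩ | ⟨tx, σ, h5, rfl, h6, rfl⟩
    · exact ih t le_rfl hi h
    · simp only [update_update_apply] at h
      split at h
      · rename_i e
        obtain ⟨rfl, rfl⟩ := e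
        simp only [Option.some.injEq] at h
        subst h
        exact ⟨⟨t, G.quorum_call (src := src) hi (by rw [h2]; simp) h5 h6⟩, i, hi, t, h5⟩
      · exact ih t le_rfl hi h

theorem Good.fixed_unique (G : Good Y C x) {t t' : ℕ} {i i' j : Fin n} {k : ℕ} {a b : Batch}
    (hi : i ∉ C) (hi' : i' ∉ C) (ha : (𝒩 t i).fixed j k = some a)
    (hb : (𝒩 t' i').fixed j k = some b) : a = b :=
  G.certBatch_unique (G.certBatch_of_fixed hi ha) (G.certBatch_of_fixed hi' hb)

theorem proposed_of_latest {t : ℕ} {i j : Fin n} {k : ℕ} {a : Batch} (hj : j ∉ C)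
    (h : (𝒩 t i).latest j = some (k, a)) : Proposed Y C x j k a := by
  obtain ⟨cert, h1⟩ := latest_origin Y C x hj h
  obtain ⟨t', -, h2, h3, -⟩ := proposal_origin Y C x h1
  exact ⟨t', h2, h3⟩

theorem Good.proposed_of_fixed (G : Good Y C x) {t : ℕ} {i j : Fin n} {k : ℕ} {a : Batch}
    (hi : i ∉ C) (hj : j ∉ C) (h : (𝒩 t i).fixed j k = some a) : Proposed Y C x j k a := by
  obtain ⟨-, i', -, t', h'⟩ := G.certBatch_of_fixed hi h
  exact proposed_of_latest hj h'

end Good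

/-! ### Blocks and total order -/

section Blocks

variable {n f : ℕ} {Y : System n f} {C : Finset (Fin n)} {x : Outcome n}

local notation "𝒩" => nodeAt Y C x

theorem mem_newSlots {nd : Node n} {v : Vec n} {j : Fin n} {k : ℕ} :
    k ∈ newSlots nd v j ↔ (nd.ordered j).slot < k ∧ k ≤ (v j).slot := by
  simp only [newSlots, List.mem_range'_1]
  omega

theorem complete_iff {nd : Node n} {v : Vec n} {j : Fin n} : complete nd v j = true ↔
    ∀ k, (nd.ordered j).slot < k → k ≤ (v j).slot → (nd.fixed j k).isSome = true := by
  simp only [complete, List.all_eq_true, mem_newSlots, and_imp]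

theorem mem_blockOf {nd : Node n} {v : Vec n} {tx : Bits} : tx ∈ blockOf nd v ↔
    ∃ j, ∃ k ∈ newSlots nd v j, tx ∈ (nd.fixed j k).getD [] := by
  simp [blockOf]

/-- All batches of the slots ordered so far are contained in the blocks output so far. -/
theorem ordered_output (t : ℕ) (i j : Fin n) (k : ℕ) (hk : 1 ≤ k)
    (h : k ≤ ((𝒩 t i).ordered j).slot) : ∃ t' a, (𝒩 t' i).fixed j k = some a ∧
      ∀ tx ∈ a, tx ∈ (𝒩 t i).blocks.flatten := by
  induction t with
  | zero => simp [nodeAt, exec] at h; omega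
  | succ t ih =>
    obtain ⟨out, ht, -⟩ := tr_step Y C x t i
    revert h
    generalize 𝒩 (t + 1) i = nd' at ht
    intro h
    cases ht <;> try exact ih h
    case output v h1 h2 h3 =>
      by_cases ho : k ≤ ((𝒩 t i).ordered j).slot
      · obtain ⟨t', a, h4, h5⟩ := ih ho
        refine ⟨t', a, h4, fun tx htx => ?_⟩
        rw [List.flatten_append]
        exact List.mem_append_left _ (h5 tx htx)
      · have h4 : k ∈ newSlots (𝒩 t i) v j := mem_newSlots.2 ⟨not_le.1 ho, h⟩
        obtain ⟨a, ha⟩ := Option.isSome_iff_exists.1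
          (complete_iff.1 (h3 j) k (not_le.1 ho) h)
        refine ⟨t, a, ha, fun tx htx => ?_⟩
        rw [List.flatten_append]
        refine List.mem_append_right _ ?_
        simp only [List.flatten_cons, List.flatten_nil, List.append_nil]
        exact mem_blockOf.2 ⟨j, k, h4, by rw [ha]; exact htx⟩

/-- The ordered indices are the output of the previous MVBA instance, or the initial zeros, so
agreement applies. -/
theorem Good.ordered_eq (G : Good Y C x) {t t' : ℕ} {i i' : Fin n} (hi : i ∉ C) (hi' : i' ∉ C)
    (h : (𝒩 t i).epoch = (𝒩 t' i').epoch) : (𝒩 t i).ordered = (𝒩 t' i').ordered := by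
  have h1 := consInv_nodeAt Y C x t i
  have h2 := consInv_nodeAt Y C x t' i'
  rcases h1.epoch_pos.eq_or_lt with h3 | h3
  · rw [h1.ordered_first h3.symm, h2.ordered_first (by omega)]
  · obtain ⟨e, he⟩ : ∃ e, (𝒩 t i).epoch = e + 1 := ⟨(𝒩 t i).epoch - 1, by omega⟩
    exact (G.mvba e).2.1 i i' hi hi' t t' _ _ (h1.ordered_succ e (by omega) he)
      (h2.ordered_succ e (by omega) (by omega))

/-- The two MVBA outputs and the ordered indices fix the slots of the block, and the recorded batch
of each of these slots is the same at all honest nodes. -/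
theorem Good.block_eq (G : Good Y C x) {t t' : ℕ} {i i' : Fin n} (hi : i ∉ C) (hi' : i' ∉ C)
    {e : ℕ} {b b' : List Bits} (hb : (𝒩 t i).blocks[e]? = some b)
    (hb' : (𝒩 t' i').blocks[e]? = some b') : b = b' := by
  obtain ⟨t₁, -, v, h1, h2, h3, rfl⟩ := block_origin Y C x hb
  obtain ⟨t₁', -, v', h1', h2', h3', rfl⟩ := block_origin Y C x hb'
  obtain rfl := (G.mvba (e + 1)).2.1 i i' hi hi' t₁ t₁' _ _ h2 h2'
  have ho := G.ordered_eq hi hi' (h1.trans h1'.symm)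
  have hn : ∀ j, newSlots (𝒩 t₁ i) v j = newSlots (𝒩 t₁' i') v j := fun j => by
    simp only [newSlots, ho]
  have hf : ∀ j, ∀ k ∈ newSlots (𝒩 t₁' i') v j,
      (𝒩 t₁ i).fixed j k = (𝒩 t₁' i').fixed j k := by
    intro j k hk
    have hk' := mem_newSlots.1 hk
    obtain ⟨a', ha'⟩ := Option.isSome_iff_exists.1 (complete_iff.1 (h3' j) k hk'.1 hk'.2)
    rw [← hn] at hk
    have hk := mem_newSlots.1 hk
    obtain ⟨a, ha⟩ := Option.isSome_iff_exists.1 (complete_iff.1 (h3 j) k hk.1 hk.2)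
    rw [ha, ha', G.fixed_unique hi hi' ha ha']
  have : ∀ j, (newSlots (𝒩 t₁ i) v j).flatMap (fun k => ((𝒩 t₁ i).fixed j k).getD []) =
      (newSlots (𝒩 t₁' i') v j).flatMap (fun k => ((𝒩 t₁' i').fixed j k).getD []) := by
    intro j
    rw [hn]
    exact List.flatMap_congr fun k hk => by rw [hf j k hk]
  simp only [blockOf, this]

theorem prefix_of_getElem?_agree {α : Type*} {l l' : List α} (hl : l.length ≤ l'.length)
    (h : ∀ (e : ℕ) (a b : α), l[e]? = some a → l'[e]? = some b → a = b) : l <+: l' := by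
  rw [List.prefix_iff_eq_take]
  refine List.ext_getElem (by simp [hl]) fun e h1 h2 => ?_
  rw [List.getElem_take]
  exact h e _ _ (List.getElem?_eq_getElem h1) (List.getElem?_eq_getElem (by omega))

theorem getElem?_eq_of_prefix {α : Type*} {l l' : List α} (h : l <+: l') {k : ℕ} {a b : α}
    (ha : l[k]? = some a) (hb : l'[k]? = some b) : a = b := by
  obtain ⟨r, rfl⟩ := h
  obtain ⟨hk, -⟩ := List.getElem?_eq_some_iff.1 ha
  rw [List.getElem?_append_left hk, ha] at hb
  exact Option.some.inj hb

theorem flatten_prefix {α : Type*} {l l' : List (List α)} (h : l <+: l') :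
    l.flatten <+: l'.flatten := by
  obtain ⟨r, rfl⟩ := h
  rw [List.flatten_append]
  exact List.prefix_append _ _

theorem Good.totalOrder (G : Good Y C x) : TotalOrder Y C x := by
  intro i i' hi hi' t t' k a b ha hb
  unfold output at ha hb
  rcases le_total (𝒩 t i).blocks.length (𝒩 t' i').blocks.length with h | h
  · exact getElem?_eq_of_prefix (flatten_prefix (prefix_of_getElem?_agree h
      fun e a b ha hb => G.block_eq hi hi' ha hb)) ha hb
  · exact (getElem?_eq_of_prefix (flatten_prefix (prefix_of_getElem?_agree h
      fun e a b ha hb => G.block_eq hi' hi ha hb)) hb ha).symm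

end Blocks

/-! ## Fetching missing batches -/

section Frame

variable {n f : ℕ} (Y : System n f) (S : Setup n) (i : Fin n) (nd : Node n)

theorem receiverStep_frame (j : Fin n) : (receiverStep Y S i j nd).1.calls = nd.calls ∧
    ∀ j' ≠ j, (receiverStep Y S i j nd).1.queue j' = nd.queue j' ∧
      (receiverStep Y S i j nd).1.jump j' = nd.jump j' := by
  unfold receiverStep
  repeat' split
  all_goals refine ⟨?_, fun j' hj => ⟨?_, ?_⟩⟩
  all_goals simp only [castVote, pull]
  all_goals try split
  all_goals first | rfl | simp [hj]

theorem consensusStep_frame : (consensusStep Y S nd).1.calls = nd.calls ∧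
    (consensusStep Y S nd).1.queue = nd.queue ∧ (consensusStep Y S nd).1.jump = nd.jump := by
  unfold consensusStep
  split
  · split <;> exact ⟨rfl, rfl, rfl⟩
  · exact ⟨rfl, rfl, rfl⟩
  · rename_i v _ _
    dsimp only
    split
    · exact ⟨rfl, rfl, rfl⟩
    · obtain ⟨mm, lp, h, -⟩ := foldl_pull Y S nd v
      rw [h]
      exact ⟨rfl, rfl, rfl⟩

/-- Supplies the hypothesis of `fifo` that nothing but the `Help` daemon takes requests out of the
queue. -/
theorem runProcess_calls (p : Proc n) (hp : p ≠ .help) :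
    (runProcess Y S i p nd).1.calls = nd.calls := by
  cases p with
  | sender =>
    simp only [runProcess, senderStep]
    repeat' split
    all_goals rfl
  | receiver j => exact (receiverStep_frame Y S i nd j).1
  | callHelp j =>
    simp only [runProcess, callHelpStep]
    repeat' split
    all_goals rfl
  | help => exact absurd rfl hp
  | consensus => exact (consensusStep_frame Y S nd).1

theorem runProcess_queue (p : Proc n) (j : Fin n) (hp : p ≠ .receiver j) :
    (runProcess Y S i p nd).1.queue j = nd.queue j ∧
      (runProcess Y S i p nd).1.jump j = nd.jump j := by
  cases p with
  | sender =>
    simp only [runProcess, senderStep]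
    repeat' split
    all_goals exact ⟨rfl, rfl⟩
  | receiver j' => exact (receiverStep_frame Y S i nd j').2 j fun h => hp (h ▸ rfl)
  | callHelp j =>
    simp only [runProcess, callHelpStep]
    repeat' split
    all_goals exact ⟨rfl, rfl⟩
  | help =>
    simp only [runProcess, helpStep]
    repeat' split
    all_goals exact ⟨rfl, rfl⟩
  | consensus =>
    have := consensusStep_frame Y S nd
    exact ⟨congrFun this.2.1 j, congrFun this.2.2 j⟩

theorem receive_calls (src : Fin n) (m : Msg n) :
    ∃ l, (receive src m nd).calls = nd.calls ++ l := by
  cases m <;> first | exact ⟨[], (List.append_nil _).symm⟩ | exact ⟨_, rfl⟩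

theorem receive_queue (src : Fin n) (m : Msg n) (j : Fin n) :
    (∃ l, (receive src m nd).queue j = nd.queue j ++ l) ∧
      (receive src m nd).jump j = nd.jump j := by
  cases m with
  | proposal s tx cert =>
    refine ⟨?_, rfl⟩
    by_cases h : j = src
    · subst h; exact ⟨[(s, tx, cert)], by simp [receive]⟩
    · exact ⟨[], by simp [receive, h]⟩
  | _ => exact ⟨⟨[], (List.append_nil _).symm⟩, rfl⟩

theorem helpStep_calls (q : Fin n × Fin n × ℕ × Option Bits)
    (l : List (Fin n × Fin n × ℕ × Option Bits)) (h : nd.calls = q :: l) :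
    (helpStep Y S i nd).1.calls = l ∧
      (q.1, q.2.1, q.2.2.1) ∈ (helpStep Y S i nd).1.answered := by
  obtain ⟨src, j, k, sig⟩ := q
  unfold helpStep
  rw [h]
  dsimp only
  split
  · rename_i ha; exact ⟨rfl, ha⟩
  · repeat' split
    all_goals exact ⟨rfl, List.mem_cons_self⟩

end Frame

/-! ### Life cycle of a request of the `CallHelp` daemon -/

section Requests

variable {n f : ℕ} {Y : System n f} {S : Setup n}
variable {L : Fin n → Msg n → Prop} {i : Fin n} {nd nd' : Node n} {out : List (Fin n × Msg n)}

theorem Tr.answered_subset (h : Tr Y S L i nd nd' out) (w : Fin n × Fin n × ℕ)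
    (hw : w ∈ nd.answered) : w ∈ nd'.answered := by
  cases h <;> try exact hw
  all_goals exact List.mem_cons_of_mem _ hw

theorem Tr.loop_asked_le (h : Tr Y S L i nd nd' out) (j : Fin n) (k : ℕ)
    (hn : nd.loop j = some (k, true) → k ≤ (nd.maxMissing j).slot) :
    nd'.loop j = some (k, true) → k ≤ (nd'.maxMissing j).slot := by
  cases h <;> try exact hn
  case fetch v mm lp _ h7 =>
    have := h7 j
    cases hl : nd.loop j <;> grind [Pulled]
  case jumpStart => cases hl : nd.loop j <;> grind [Function.update_apply, Pulled]
  all_goals grind [Function.update_apply]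

theorem Tr.maxMissing_valid (h : Tr Y S L i nd nd' out) (j : Fin n)
    (hn : (nd.maxMissing j).slot = 0 ∨ certValid Y S j (nd.maxMissing j) = true) :
    (nd'.maxMissing j).slot = 0 ∨ certValid Y S j (nd'.maxMissing j) = true := by
  cases h <;> try exact hn
  all_goals grind [Function.update_apply, Pulled]

theorem Tr.loop_notAsked (h : Tr Y S L i nd nd' out) {j : Fin n} {k : ℕ}
    (hl : nd.loop j = some (k, false)) (hk : k ≤ (nd.maxMissing j).slot) :
    nd'.loop j = some (k, false) ∨ nd'.loop j = some (k, true) := by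
  cases h <;> try exact Or.inl hl
  case fetch v mm lp _ h7 =>
    have := h7 j
    grind [Pulled]
  all_goals grind [Function.update_apply, Pulled]

/-- The loop leaves slot `k` only through a full set of fragments; it cannot be aborted or restarted
while `k` is still missing. -/
theorem Tr.loop_asked (h : Tr Y S L i nd nd' out) {j : Fin n} {k : ℕ}
    (hl : nd.loop j = some (k, true)) (hk : k ≤ (nd.maxMissing j).slot) :
    nd'.loop j = some (k, true) ∨
      (nd'.loop j = some (k + 1, false) ∧ (fullRoot Y S j k nd).isSome = true) := by
  cases h <;> try exact Or.inl hl
  case fetch v mm lp _ h7 =>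
    have := h7 j
    grind [Pulled]
  all_goals grind [Function.update_apply, Pulled]

theorem Tr.callHelp_sent (h : Tr Y S L i nd nd' out) {dst j : Fin n} {k : ℕ} {σ : Option Bits}
    (ho : (dst, Msg.callHelp j k σ) ∈ out) : nd.loop j = some (k, false) ∧
      k ≤ (nd.maxMissing j).slot ∧ nd'.loop j = some (k, true) ∧
      σ = if k < (nd.maxMissing j).slot then none else some (nd.maxMissing j).sig := by
  cases h <;> try simp [multicast] at ho
  case ask h1 h2 => obtain ⟨rfl, rfl, rfl⟩ := ho; exact ⟨h1, h2, by simp, rfl⟩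
  case answer h => rcases h with ⟨rfl, -⟩ | ⟨tx, -, rfl⟩ <;> simp at ho

theorem Tr.callHelp_of_asked (h : Tr Y S L i nd nd' out) {j : Fin n} {k : ℕ}
    (hl : nd'.loop j = some (k, true)) : nd.loop j = some (k, true) ∨
      ∀ dst, ∃ σ, (dst, Msg.callHelp j k σ) ∈ out := by
  cases h <;> try exact Or.inl hl
  case ask j' k' h1 h2 =>
    by_cases hj : j = j'
    · subst hj
      simp only [Function.update_self, Option.some.injEq, Prod.mk.injEq, and_true] at hl
      subst hl
      exact Or.inr fun dst => ⟨_, by simp [multicast]; rfl⟩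
    · exact Or.inl (by simpa [hj] using hl)
  case fetch v mm lp _ h7 =>
    have := h7 j
    cases hl : nd.loop j <;> grind [Pulled]
  case jumpStart => cases hl : nd.loop j <;> grind [Function.update_apply, Pulled]
  all_goals grind [Function.update_apply]

end Requests

section Trace

variable {n f : ℕ} (Y : System n f) (C : Finset (Fin n)) (x : Outcome n)

local notation "𝒩" => nodeAt Y C x

theorem nodeAt_succ_cases (t : ℕ) (i : Fin n) (P : Node n → Prop) (h0 : P (𝒩 t i))
    (h1 : ∀ tx, P { 𝒩 t i with buffer := (𝒩 t i).buffer ++ [tx] })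
    (h2 : ∀ src m, P (receive src m (𝒩 t i)))
    (h3 : ∀ p, i ∉ C → x.2 t = .run i p → P (runProcess Y x.1 i p (𝒩 t i)).1)
    (h4 : ∀ out, P { 𝒩 t i with mvbaOut := out }) : P (𝒩 (t + 1) i) := by
  have hex : exec Y C x (t + 1) = applyLabel Y C x.1 (exec Y C x t) (x.2 t) := rfl
  unfold nodeAt at *
  rw [hex]
  cases hl : x.2 t with
  | input i' tx =>
    simp only [applyLabel]
    split
    · exact h0
    · by_cases h : i = i'
      · subst h; simpa using h1 tx
      · simpa [h] using h0
  | deliver src dst m =>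
    simp only [applyLabel]
    split
    · by_cases h : i = dst
      · subst h; simpa using h2 src m
      · simpa [h] using h0
    · exact h0
  | run i' p =>
    simp only [applyLabel]
    split
    · exact h0
    · rename_i hC
      by_cases h : i = i'
      · subst h; simpa using h3 p hC hl
      · simpa [h] using h0
  | mvba i' v =>
    simp only [applyLabel]
    split
    · by_cases h : i = i'
      · subst h; simpa using h4 _
      · simpa [h] using h0
    · exact h0

theorem answered_mono {t t' : ℕ} (h : t ≤ t') (i : Fin n) (w : Fin n × Fin n × ℕ)
    (hw : w ∈ (𝒩 t i).answered) : w ∈ (𝒩 t' i).answered :=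
  persists Y C x i (fun nd => w ∈ nd.answered) (fun _ _ _ _ h _ => h.answered_subset w) h hw

theorem maxMissing_valid (t : ℕ) (i j : Fin n) : ((𝒩 t i).maxMissing j).slot = 0 ∨
    certValid Y x.1 j ((𝒩 t i).maxMissing j) = true :=
  persists Y C x i (fun nd => (nd.maxMissing j).slot = 0 ∨
    certValid Y x.1 j (nd.maxMissing j) = true) (fun _ _ _ _ h _ => h.maxMissing_valid j)
    (Nat.zero_le t) (Or.inl rfl)

theorem loop_asked_le (t : ℕ) (i j : Fin n) (k : ℕ) :
    (𝒩 t i).loop j = some (k, true) → k ≤ ((𝒩 t i).maxMissing j).slot :=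
  persists Y C x i (fun nd => nd.loop j = some (k, true) → k ≤ (nd.maxMissing j).slot)
    (fun _ _ _ _ h _ => h.loop_asked_le j k) (Nat.zero_le t) (by simp [nodeAt, exec])

theorem fullRoot_mono (hn : 3 * f < n) {t t' : ℕ} (h : t ≤ t') (i j : Fin n) (k : ℕ)
    (hf : (fullRoot Y x.1 j k (𝒩 t i)).isSome = true) :
    (fullRoot Y x.1 j k (𝒩 t' i)).isSome = true :=
  fullRoot_isSome_mono Y x.1 hn (fun w hw => helps_mono Y C x h i w hw) hf

theorem request_sent (t : ℕ) (i j : Fin n) (k : ℕ) (h : (𝒩 t i).loop j = some (k, true))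
    (dst : Fin n) : ∃ σ, (i, dst, .callHelp j k σ) ∈ (exec Y C x t).sent := by
  induction t with
  | zero => simp [nodeAt, exec] at h
  | succ t ih =>
    obtain ⟨out, ht, hs⟩ := tr_step Y C x t i
    rcases ht.callHelp_of_asked h with h | h
    · exact (ih h).imp fun σ hσ => (hs _ _).2 (Or.inl hσ)
    · exact (h dst).imp fun σ hσ => (hs _ _).2 (Or.inr hσ)

/-- A helper answers only the first request of each node for `(j, k)`, so a premature request would
spoil a later one with a certificate. This excludes it: a slot is not requested again before enough
fragments have arrived. -/
theorem request_unique (hn : 3 * f < n) {t : ℕ} {i dst j : Fin n} {k : ℕ} {σ : Option Bits}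
    (h : (i, dst, .callHelp j k σ) ∈ (exec Y C x t).sent) :
    (fullRoot Y x.1 j k (𝒩 t i)).isSome = true ∨ (𝒩 t i).loop j = some (k, true) := by
  induction t with
  | zero => simp [exec] at h
  | succ t ih =>
    obtain ⟨out, ht, hs⟩ := tr_step Y C x t i
    rcases (hs _ _).1 h with h | h
    · rcases ih h with h | h
      · exact Or.inl (fullRoot_mono Y C x hn (Nat.le_succ t) i j k h)
      · rcases ht.loop_asked h (loop_asked_le Y C x t i j k h) with h | h
        · exact Or.inr h
        · exact Or.inl (fullRoot_mono Y C x hn (Nat.le_succ t) i j k h.2)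
    · exact Or.inr (ht.callHelp_sent h).2.2.1

/-- Node `h` can answer the request `σ` for the batch of slot `k` of the broadcast of `j`. -/
def Able (t : ℕ) (h j : Fin n) (k : ℕ) (σ : Option Bits) : Prop :=
  ((𝒩 t h).fixed j k).isSome = true ∨ ∃ tx σ', (𝒩 t h).latest j = some (k, tx) ∧ σ = some σ' ∧
    certValid Y x.1 j ⟨k, digest Y x.1 tx, σ'⟩ = true

variable {Y C x}

theorem Able.mono {t t' : ℕ} (ht : t ≤ t') {h j : Fin n} {k : ℕ} {σ : Option Bits}
    (ha : Able Y C x t h j k σ) : Able Y C x t' h j k σ := by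
  rcases ha with ha | ⟨tx, σ', h1, h2⟩
  · exact Or.inl (fixed_isSome_mono Y C x ht h j k ha)
  · rcases latest_or_fixed Y C x ht h1 with h3 | h3
    · exact Or.inr ⟨tx, σ', h3, h2⟩
    · exact Or.inl h3

/-- A signer of the highest requested slot holds certificates, hence recorded batches, for all lower
slots. Of that slot itself it may hold only the uncertified latest batch, which is why this one
request has to carry the signature. -/
theorem able_of_signed {t : ℕ} {i h j : Fin n} {k : ℕ} (hk : 1 ≤ k)
    (hm : k ≤ ((𝒩 t i).maxMissing j).slot) (hs : sigMsg j ((𝒩 t i).maxMissing j).slot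
      ((𝒩 t i).maxMissing j).digest ∈ (𝒩 t h).signed) : Able Y C x t h j k
      (if k < ((𝒩 t i).maxMissing j).slot then none else some ((𝒩 t i).maxMissing j).sig) := by
  obtain ⟨t', ht', tx, h1, h2⟩ := latest_of_signed Y C x hs
  have hI := inv_nodeAt Y C x t h
  split
  · rename_i hlt
    left
    refine hI.fixed_current j k hk ?_
    rw [hI.current_slot]
    have h3 := recvSlot_mono Y C x ht' h j
    have h4 := (inv_nodeAt Y C x t' h).latest_some j _ _ h1
    omega
  · rename_i hlt
    obtain rfl : k = ((𝒩 t i).maxMissing j).slot := by omega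
    rcases latest_or_fixed Y C x ht' h1 with h3 | h3
    · right
      refine ⟨tx, _, h3, rfl, ?_⟩
      rw [h2]
      exact (maxMissing_valid Y C x t i j).resolve_left (by omega)
    · exact Or.inl h3

/-- As long as a node has not received enough fragments of a batch, there are sufficiently many
honest nodes that can answer its requests for this batch. -/
theorem Good.able_of_request (G : Good Y C x) {i j : Fin n} {k t : ℕ} (hi : i ∉ C)
    (hn : fullRoot Y x.1 j k (𝒩 t i) = none) : ∃ Q : Finset (Fin n), n - f ≤ Q.card + C.card ∧
      ∀ h ∈ Q, h ∉ C ∧ ∀ t' ≤ t, ∀ dst σ, (i, dst, .callHelp j k σ) ∈ (exec Y C x t').sent →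
        Able Y C x t' h j k σ := by
  induction t with
  | zero =>
    refine ⟨Cᶜ, ?_, fun h hh => ⟨Finset.mem_compl.1 hh, fun t' ht' dst σ hs => ?_⟩⟩
    · have := Finset.card_add_card_compl C
      rw [Fintype.card_fin] at this
      omega
    · obtain rfl : t' = 0 := by omega
      simp [exec] at hs
  | succ t ih =>
    have h3 := G.three_mul_lt
    have hn' : fullRoot Y x.1 j k (𝒩 t i) = none := by
      by_contra hc
      have := fullRoot_mono Y C x h3 (Nat.le_succ t) i j k (Option.isSome_iff_ne_none.2 hc)
      rw [hn] at this
      simp at this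
    obtain ⟨out, ht, hs⟩ := tr_step Y C x t i
    by_cases ho : ∃ dst σ, (dst, Msg.callHelp j k σ) ∈ out
    · obtain ⟨dst, σ, ho⟩ := ho
      obtain ⟨h4, h5, -, -⟩ := ht.callHelp_sent ho
      have hk := ((inv_nodeAt Y C x t i).loop_some j k _ h4).1
      obtain ⟨Q, h6, h7⟩ := G.quorum_maxMissing (t := t) (j := j) hi (by omega)
      refine ⟨Q, h6, fun h hh => ⟨(h7 h hh).1, fun t' ht' dst' σ' hs' => ?_⟩⟩
      -- An earlier request would have left the loop at `(k, true)` or produced a full root. So all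
      -- requests for `k` so far come from the present step, and the signers of the current
      -- `maxMissing` can answer every one of them.
      have hnone : ¬ (i, dst', .callHelp j k σ') ∈ (exec Y C x t).sent := by
        intro hc
        rcases request_unique Y C x h3 hc with hc | hc
        · rw [hn'] at hc; simp at hc
        · rw [h4] at hc; simp at hc
      rcases Nat.lt_or_ge t t' with hlt | hle
      · obtain rfl : t' = t + 1 := by omega
        have h8 := ((hs _ _).1 hs').resolve_left hnone
        rw [(ht.callHelp_sent h8).2.2.2]
        exact (able_of_signed hk h5 (h7 h hh).2).mono (Nat.le_succ t)
      · exact absurd (sent_mono Y C x hle _ hs') hnone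
    · obtain ⟨Q, h6, h7⟩ := ih hn'
      refine ⟨Q, h6, fun h hh => ⟨(h7 h hh).1, fun t' ht' dst' σ' hs' => ?_⟩⟩
      rcases Nat.lt_or_ge t t' with hlt | hle
      · obtain rfl : t' = t + 1 := by omega
        rcases (hs _ _).1 hs' with h8 | h8
        · exact ((h7 h hh).2 t le_rfl dst' σ' h8).mono (Nat.le_succ t)
        · exact absurd ⟨_, _, h8⟩ ho
      · exact (h7 h hh).2 t' hle dst' σ' hs'

theorem answered_origin {t : ℕ} {h src j : Fin n} {k : ℕ}
    (ha : (src, j, k) ∈ (𝒩 t h).answered) : ∃ t' < t, ∃ σ, (src, j, k, σ) ∈ (𝒩 t' h).calls ∧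
      (Able Y C x t' h j k σ → ∃ root leaf branch,
        (h, src, .help j k root leaf branch) ∈ (exec Y C x (t' + 1)).sent) := by
  induction t with
  | zero => simp [nodeAt, exec] at ha
  | succ t ih =>
    obtain ⟨out, ht, hs⟩ := tr_step Y C x t h
    by_cases hn : (src, j, k) ∈ (𝒩 t h).answered
    · obtain ⟨t', ht', hr⟩ := ih hn
      exact ⟨t', by omega, hr⟩
    · refine ⟨t, by omega, ?_⟩
      simp only [hs]
      revert ha
      generalize 𝒩 (t + 1) h = nd' at ht
      intro ha
      cases ht <;> try exact absurd ha hn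
      case answer src' j' k' sig rest fx h1 h2 h3 h4 =>
        rcases List.mem_cons.1 ha with ha | ha
        · simp only [Prod.mk.injEq] at ha
          obtain ⟨rfl, rfl, rfl⟩ := ha
          refine ⟨sig, by rw [h1]; simp, fun hab => ?_⟩
          rcases h4 with ⟨rfl, h5⟩ | ⟨tx, -, rfl⟩
          · exfalso
            rcases h3 with ⟨rfl, h6⟩ | ⟨tx, σ, -, -, -, rfl⟩
            · rcases hab with hab | hab
              · rw [h5] at hab; simp at hab
              · exact h6 hab
            · simp at h5
          · exact ⟨_, _, _, Or.inr (List.mem_singleton.2 rfl)⟩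
        · exact absurd ha hn

theorem Good.run_after (G : Good Y C x) {i : Fin n} (hi : i ∉ C) (p : Proc n) (t : ℕ) :
    ∃ t' ≥ t, x.2 t' = .run i p :=
  G.fair.2 i hi p t

theorem Good.delivered (G : Good Y C x) {src dst : Fin n} {m : Msg n} {t : ℕ} (hs : src ∉ C)
    (hd : dst ∉ C) (h : (src, dst, m) ∈ (exec Y C x t).sent) :
    ∃ t', 𝒩 (t' + 1) dst = receive src m (𝒩 t' dst) := by
  obtain ⟨t', h1, h2⟩ := G.fair.1 t src dst m hs hd h
  exact ⟨t', nodeAt_deliver Y C x t' src dst m hd h1 h2⟩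

/-- There are finitely many nodes, so the maximum of the individual times works. -/
theorem exists_forall_of_mono {P : ℕ → Fin n → Prop} (hm : ∀ t t' i, t ≤ t' → P t i → P t' i)
    (h : ∀ i, ∃ t, P t i) : ∃ t, ∀ i, P t i := by
  choose T hT using h
  exact ⟨Finset.univ.sup T, fun i => hm _ _ i (Finset.le_sup (Finset.mem_univ i)) (hT i)⟩

/-- The pattern of all fairness arguments: `P` persists until `Q` occurs, and the scheduled step at
`t₁` forces `Q` if `P` still holds. -/
theorem exists_of_until {P Q : ℕ → Prop} {t t₁ : ℕ} (h : ∀ s ≥ t, P s → P (s + 1) ∨ Q (s + 1))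
    (hp : P t) (ht : t ≤ t₁) (h₁ : P t₁ → Q (t₁ + 1)) : ∃ t' ≥ t, Q t' := by
  have key : ∀ s ≥ t, P s ∨ ∃ t' ≥ t, Q t' := by
    intro s hs
    induction s, hs using Nat.le_induction with
    | base => exact Or.inl hp
    | succ s hs ih =>
      rcases ih with ih | ih
      · exact (h s hs ih).imp id fun hq => ⟨s + 1, by omega, hq⟩
      · exact Or.inr ih
  rcases key t₁ ht with h2 | h2
  · exact ⟨t₁ + 1, by omega, h₁ h2⟩
  · exact h2

theorem calls_step (t : ℕ) (i : Fin n) (hi : i ∉ C) :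
    (x.2 t ≠ .run i .help → ∃ l, (𝒩 (t + 1) i).calls = (𝒩 t i).calls ++ l) ∧
    (x.2 t = .run i .help → ∀ q l, (𝒩 t i).calls = q :: l → (𝒩 (t + 1) i).calls = l ∧
      (q.1, q.2.1, q.2.2.1) ∈ (𝒩 (t + 1) i).answered) := by
  constructor
  · intro hne
    refine nodeAt_succ_cases Y C x t i (fun nd => ∃ l, nd.calls = (𝒩 t i).calls ++ l)
      ⟨[], by simp⟩ (fun tx => ⟨[], by simp⟩) (fun src m => receive_calls _ src m)
      (fun p _ hp => ⟨[], ?_⟩) fun _ => ⟨[], by simp⟩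
    rw [runProcess_calls Y x.1 i _ p (fun h => hne (h ▸ hp)), List.append_nil]
  · intro h q l hq
    rw [(nodeAt_run Y C x t i hi _ h).1]
    exact helpStep_calls Y x.1 i _ q l hq

theorem Good.answered_eventually (G : Good Y C x) {h i j : Fin n} {k t : ℕ} {σ : Option Bits}
    (hh : h ∉ C) (hi : i ∉ C) (hs : (i, h, .callHelp j k σ) ∈ (exec Y C x t).sent) :
    ∃ t', (i, j, k) ∈ (𝒩 t' h).answered := by
  obtain ⟨t', ht'⟩ := G.delivered hi hh hs
  obtain ⟨t₁, -, h1, l, h2⟩ := fifo (fun t => (𝒩 t h).calls) (fun t => x.2 t = .run h .help)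
    (fun t => (calls_step t h hh).1) (fun t q l hp hq => ((calls_step t h hh).2 hp q l hq).1)
    (G.run_after hh .help) (t' + 1) (i, j, k, σ) (by simp [ht', receive])
  exact ⟨t₁ + 1, ((calls_step t₁ h hh).2 h1 _ _ h2).2⟩

/-- Otherwise every honest node handles the request, and those of the set from
`Good.able_of_request` answer it. The batches they hold coincide by `Good.fixed_unique`, so all
their fragments carry the same root and are enough. -/
theorem Good.fullRoot_eventually (G : Good Y C x) {i j : Fin n} {k t : ℕ} (hi : i ∉ C)
    (hl : (𝒩 t i).loop j = some (k, true)) :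
    ∃ t', (fullRoot Y x.1 j k (𝒩 t' i)).isSome = true := by
  by_contra! hc
  have hnone : ∀ t', fullRoot Y x.1 j k (𝒩 t' i) = none := fun t' => by
    simpa using hc t'
  have h3 := G.three_mul_lt
  obtain ⟨T, hT⟩ := exists_forall_of_mono (P := fun t h => h ∉ C → (i, j, k) ∈ (𝒩 t h).answered)
    (fun t t' h ht hp hh => answered_mono Y C x ht h _ (hp hh)) fun h => by
      by_cases hh : h ∈ C
      · exact ⟨0, fun h => absurd hh h⟩
      · obtain ⟨σ, hσ⟩ := request_sent Y C x t i j k hl h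
        exact (G.answered_eventually hh hi hσ).imp fun _ h _ => h
  obtain ⟨Q, hQ, hQ'⟩ := G.able_of_request hi (hnone T)
  have hhelp : ∀ h ∈ Q, ∃ t' root leaf branch, (h, j, k, root, leaf, branch) ∈ (𝒩 t' i).helps ∧
      ∃ t₁ a, (𝒩 t₁ h).fixed j k = some a ∧
        root = merkleRoot (Y.hash x.1.hk) (Nat.clog 2 n) (leaves Y a) ∧ leaf = leaves Y a h ∧
        branch = merkleBranch (Y.hash x.1.hk) (Nat.clog 2 n) (leaves Y a) h := by
    intro h hh
    obtain ⟨hC, hab⟩ := hQ' h hh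
    obtain ⟨t', ht', σ, h1, h2⟩ := answered_origin (hT h hC)
    obtain ⟨root, leaf, branch, h4⟩ := h2 (hab t' ht'.le h σ (calls_origin Y C x hi h1))
    obtain ⟨t₂, h5⟩ := G.delivered hC hi h4
    obtain ⟨t₁, -, a, h6⟩ := help_sent_origin Y C x h4
    exact ⟨t₂ + 1, root, leaf, branch, by simp [h5, receive], t₁, a, h6⟩
  obtain ⟨T', hT'⟩ := exists_forall_of_mono (P := fun t' h => h ∈ Q → ∃ root leaf branch,
      (h, j, k, root, leaf, branch) ∈ (𝒩 t' i).helps ∧ ∃ t₁ a, (𝒩 t₁ h).fixed j k = some a ∧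
        root = merkleRoot (Y.hash x.1.hk) (Nat.clog 2 n) (leaves Y a) ∧ leaf = leaves Y a h ∧
        branch = merkleBranch (Y.hash x.1.hk) (Nat.clog 2 n) (leaves Y a) h)
    (fun t t' h ht hp hh => by
      obtain ⟨root, leaf, branch, h1, h2⟩ := hp hh
      exact ⟨root, leaf, branch, helps_mono Y C x ht i _ h1, h2⟩) fun h => by
      by_cases hh : h ∈ Q
      · exact (hhelp h hh).imp fun _ h _ => h
      · exact ⟨0, fun h => absurd h hh⟩
  have h5 := G.card_corrupt
  -- Since `|Q| ≥ n - f - |C| ≥ n - 2f > 0`, one member can serve as reference for the root.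
  obtain ⟨h₀, hh₀⟩ := Finset.card_pos.1 (show 0 < Q.card by omega)
  obtain ⟨root, -, -, -, t₀, a, ha, hroot, -⟩ := hT' h₀ hh₀
  refine hc T' (fullRoot_isSome Y x.1 h3 (root := root) (le_trans (show n - 2 * f ≤ Q.card by omega)
    (Finset.card_le_card fun h hh => Finset.mem_filter.2 ⟨Finset.mem_univ _, ?_⟩)))
  obtain ⟨root', leaf, branch, h6, t₁, b, hb, h7, h8, h9⟩ := hT' h hh
  obtain rfl := G.fixed_unique (hQ' h₀ hh₀).1 (hQ' h hh).1 ha hb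
  rw [← hroot] at h7
  subst h7
  refine fragments_isSome Y x.1 h6 ?_
  rw [hroot, h8, h9]
  exact merkleVerify_merkleBranch _ _ _ _ (fin_lt_two_pow_clog h)

theorem Good.loop_advances (G : Good Y C x) {i j : Fin n} {k t : ℕ} {b : Bool} (hi : i ∉ C)
    (hl : (𝒩 t i).loop j = some (k, b)) (hk : k ≤ ((𝒩 t i).maxMissing j).slot) :
    ∃ t' ≥ t, (𝒩 t' i).loop j = some (k + 1, false) := by
  have hk' : ∀ s ≥ t, k ≤ ((𝒩 s i).maxMissing j).slot := fun s hs =>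
    hk.trans (maxMissing_mono Y C x hs i j)
  have h1 : ∃ t₁ ≥ t, (𝒩 t₁ i).loop j = some (k, true) := by
    cases b with
    | true => exact ⟨t, le_rfl, hl⟩
    | false =>
      obtain ⟨t₁, ht₁, hr⟩ := G.run_after hi (.callHelp j) t
      refine exists_of_until (P := fun s => (𝒩 s i).loop j = some (k, false))
        (fun s hs hp => ?_) hl ht₁ fun hp => ?_
      · obtain ⟨out, ht, -⟩ := tr_step Y C x s i
        exact ht.loop_notAsked hp (hk' s hs)
      · rw [(nodeAt_run Y C x t₁ i hi _ hr).1]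
        simp [runProcess, callHelpStep, hp, not_lt.2 (hk' t₁ ht₁)]
  obtain ⟨t₁, ht₁, hl₁⟩ := h1
  obtain ⟨t₂, ht₂⟩ := G.fullRoot_eventually hi hl₁
  obtain ⟨t₃, ht₃, hr⟩ := G.run_after hi (.callHelp j) (max t₁ t₂)
  obtain ⟨t', ht', h⟩ := exists_of_until (P := fun s => (𝒩 s i).loop j = some (k, true))
    (Q := fun s => (𝒩 s i).loop j = some (k + 1, false)) (t := t₁) (t₁ := t₃)
    (fun s hs hp => by
      obtain ⟨out, ht, -⟩ := tr_step Y C x s i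
      exact (ht.loop_asked hp (hk' s (by omega))).imp id And.left) hl₁ (by omega) fun hp => by
      obtain ⟨root, hroot⟩ := Option.isSome_iff_exists.1
        (fullRoot_mono Y C x G.three_mul_lt (show t₂ ≤ t₃ by omega) i j k ht₂)
      rw [(nodeAt_run Y C x t₃ i hi _ hr).1]
      simp [runProcess, callHelpStep, hp, not_lt.2 (hk' t₃ (by omega)), hroot]
  exact ⟨t', by omega, h⟩

/-- All batches up to the highest missing one are eventually recorded. -/
theorem Good.fixed_eventually (G : Good Y C x) {i j : Fin n} {c t : ℕ} (hi : i ∉ C)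
    (hc : c ≤ ((𝒩 t i).maxMissing j).slot) :
    ∃ t' ≥ t, ∀ k, 1 ≤ k → k ≤ c → ((𝒩 t' i).fixed j k).isSome = true := by
  rcases hl : (𝒩 t i).loop j with _ | ⟨k, b⟩
  · exact ⟨t, le_rfl, fun k h1 h2 => (inv_nodeAt Y C x t i).loop_none j k hl h1 (h2.trans hc)⟩
  · induction hd : c + 1 - k generalizing t k b with
    | zero =>
      exact ⟨t, le_rfl, fun k' h1 h2 =>
        ((inv_nodeAt Y C x t i).loop_some j k b hl).2 k' h1 (by omega)⟩
    | succ d ih =>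
      obtain ⟨t₁, ht₁, hl₁⟩ := G.loop_advances hi hl (by omega)
      obtain ⟨t', ht', h⟩ := ih (hc.trans (maxMissing_mono Y C x ht₁ i j)) (k + 1) false hl₁
        (by omega)
      exact ⟨t', ht₁.trans ht', h⟩

end Trace

/-! ## Progress of the broadcasts -/

section Receiver

variable {n f : ℕ} {Y : System n f} {S : Setup n}
variable {L : Fin n → Msg n → Prop} {i : Fin n} {nd nd' : Node n} {out : List (Fin n × Msg n)}

theorem Tr.jump_step (h : Tr Y S L i nd nd' out) {j : Fin n} {w : ℕ × Batch × Bits × Bits}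
    (hw : nd.jump j = some w) : nd'.jump j = some w ∨ nd'.jump j = none := by
  cases h <;> try exact Or.inl hw
  all_goals grind [Function.update_apply]

theorem receiverStep_jump {j : Fin n} {s : ℕ} {tx : Batch} {d σ : Bits}
    (h : nd.jump j = some (s, tx, d, σ))
    (hf : ∀ k, 1 ≤ k → k ≤ s - 1 → (nd.fixed j k).isSome = true) :
    (receiverStep Y S i j nd).1.jump j = none := by
  unfold receiverStep
  rw [h]
  dsimp only
  rw [if_pos fun k hk _ h1 => hf k h1 (by have := List.mem_range.1 hk; omega)]
  simp [castVote]

theorem receiverStep_queue_of_jump {j : Fin n} (h : nd.jump j ≠ none) :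
    (receiverStep Y S i j nd).1.queue j = nd.queue j := by
  unfold receiverStep
  split
  · split <;> rfl
  · rename_i hn; exact absurd hn h

theorem receiverStep_queue {j : Fin n} {q : ℕ × Batch × Option (Bits × Bits)}
    {l : List (ℕ × Batch × Option (Bits × Bits))} (h : nd.jump j = none)
    (hq : nd.queue j = q :: l) : (receiverStep Y S i j nd).1.queue j = l ∧
      q.1 ∈ (receiverStep Y S i j nd).1.seen j := by
  obtain ⟨s, tx, cert⟩ := q
  unfold receiverStep
  rw [h]
  dsimp only
  rw [hq]
  dsimp only
  repeat' split
  all_goals simp only [castVote, pull]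
  all_goals try split
  all_goals first | (constructor <;> simp) | simp_all

theorem validShares_eq_some {s : ℕ} {tx : Batch} {j : Fin n} {σ : Bits}
    (h : validShares Y S i s tx nd j = some σ) :
    Y.sig.shareVerify S.pk j (sigMsg i s (digest Y S tx)) σ = true := by
  unfold validShares at h
  rw [Option.map_eq_some_iff] at h
  obtain ⟨w, h1, rfl⟩ := h
  have h3 := List.find?_some h1
  simp only [Bool.and_eq_true, decide_eq_true_eq] at h3
  exact h3.2

theorem validShares_isSome {s : ℕ} {tx : Batch} {j : Fin n} {σ : Bits}
    (h : (j, s, σ) ∈ nd.votes)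
    (hv : Y.sig.shareVerify S.pk j (sigMsg i s (digest Y S tx)) σ = true) :
    (validShares Y S i s tx nd j).isSome = true := by
  unfold validShares
  rw [Option.isSome_map, List.find?_isSome]
  exact ⟨_, h, by simp [hv]⟩

end Receiver

section Trace

variable {n f : ℕ} {Y : System n f} {C : Finset (Fin n)} {x : Outcome n}

local notation "𝒩" => nodeAt Y C x

theorem Good.jump_completes (G : Good Y C x) {i j : Fin n} (hi : i ∉ C) (t : ℕ) :
    ∃ t' ≥ t, (𝒩 t' i).jump j = none := by
  rcases hw : (𝒩 t i).jump j with _ | ⟨s, tx, d, σ⟩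
  · exact ⟨t, le_rfl, hw⟩
  · obtain ⟨t₁, ht₁, hf⟩ := G.fixed_eventually hi
      ((inv_nodeAt Y C x t i).jump_some j s tx d σ hw).2.2
    obtain ⟨t₂, ht₂, hr⟩ := G.run_after hi (.receiver j) t₁
    refine exists_of_until (P := fun t => (𝒩 t i).jump j = some (s, tx, d, σ)) (fun u _ hp => ?_)
      hw (ht₁.trans ht₂) fun hp => ?_
    · obtain ⟨out, ht, -⟩ := tr_step Y C x u i
      exact ht.jump_step hp
    · rw [(nodeAt_run Y C x t₂ i hi _ hr).1]
      exact receiverStep_jump hp fun k h1 h2 => fixed_isSome_mono Y C x ht₂ i j k (hf k h1 h2)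

theorem jump_eq_of_not_run {i j : Fin n} {t : ℕ} (h : x.2 t ≠ .run i (.receiver j)) :
    (𝒩 (t + 1) i).jump j = (𝒩 t i).jump j :=
  nodeAt_succ_cases Y C x t i (fun nd => nd.jump j = (𝒩 t i).jump j) rfl (fun _ => rfl)
    (fun src m => (receive_queue _ src m j).2)
    (fun p _ hp => (runProcess_queue Y x.1 i _ p j fun h' => h (h' ▸ hp)).2) fun _ => rfl

-- The queue is popped only by a receiver step without a pending jump. Such steps occur infinitely
-- often because every jump completes, so `fifo` applies.
open Classical in
theorem Good.queue_popped (G : Good Y C x) {i j : Fin n} (hi : i ∉ C) {t : ℕ}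
    {q : ℕ × Batch × Option (Bits × Bits)} (hq : q ∈ (𝒩 t i).queue j) :
    ∃ t', q.1 ∈ (𝒩 t' i).seen j := by
  have h1 : ∀ t, ¬ (x.2 t = .run i (.receiver j) ∧ (𝒩 t i).jump j = none) →
      ∃ l, (𝒩 (t + 1) i).queue j = (𝒩 t i).queue j ++ l := by
    intro t hp
    by_cases hr : x.2 t = .run i (.receiver j)
    · refine ⟨[], ?_⟩
      rw [(nodeAt_run Y C x t i hi _ hr).1, List.append_nil]
      exact receiverStep_queue_of_jump fun h => hp ⟨hr, h⟩
    · exact nodeAt_succ_cases Y C x t i (fun nd => ∃ l, nd.queue j = (𝒩 t i).queue j ++ l)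
        ⟨[], by simp⟩ (fun _ => ⟨[], by simp⟩) (fun src m => (receive_queue _ src m j).1)
        (fun p _ hp => ⟨[], by
          rw [(runProcess_queue Y x.1 i _ p j fun h' => hr (h' ▸ hp)).1, List.append_nil]⟩)
        fun _ => ⟨[], by simp⟩
  have h2 : ∀ t q l, (x.2 t = .run i (.receiver j) ∧ (𝒩 t i).jump j = none) →
      (𝒩 t i).queue j = q :: l → (𝒩 (t + 1) i).queue j = l := by
    intro t q l hp hq
    rw [(nodeAt_run Y C x t i hi _ hp.1).1]
    exact (receiverStep_queue hp.2 hq).1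
  -- Once the jump is cleared, it stays clear up to the next step of this receiver, because no other
  -- event sets it.
  have h3 : ∀ t, ∃ t' ≥ t, x.2 t' = .run i (.receiver j) ∧ (𝒩 t' i).jump j = none := by
    intro t
    obtain ⟨t₁, ht₁, hn⟩ := G.jump_completes (j := j) hi t
    have hex := G.run_after hi (.receiver j) t₁
    obtain ⟨h1, h2⟩ := Nat.find_spec hex
    refine ⟨Nat.find hex, ht₁.trans h1, h2, ?_⟩
    have key : ∀ u, t₁ ≤ u → u ≤ Nat.find hex → (𝒩 u i).jump j = none := by
      intro u hu
      induction u, hu using Nat.le_induction with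
      | base => exact fun _ => hn
      | succ u hu ih =>
        intro hlt
        rw [jump_eq_of_not_run fun h => Nat.find_min hex (show u < _ by omega) ⟨hu, h⟩]
        exact ih (by omega)
    exact key _ h1 le_rfl
  obtain ⟨t', -, ⟨hr, hj⟩, l, hl⟩ := fifo (fun t => (𝒩 t i).queue j)
    (fun t => x.2 t = .run i (.receiver j) ∧ (𝒩 t i).jump j = none) h1 h2 h3 t q hq
  refine ⟨t' + 1, ?_⟩
  rw [(nodeAt_run Y C x t' i hi _ hr).1]
  exact (receiverStep_queue hj hl).2

/-- The certificate in a proposal of an honest node is valid and belongs to the batch that the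
node proposed in the previous slot. -/
theorem Good.proposal_valid (G : Good Y C x) {t : ℕ} {j dst : Fin n} {s : ℕ} {a : Batch}
    {cert : Option (Bits × Bits)} (hs : 2 ≤ s)
    (h : (j, dst, .proposal s a cert) ∈ (exec Y C x t).sent) : ∃ b σ, Proposed Y C x j (s - 1) b ∧
      cert = some (digest Y x.1 b, σ) ∧
      certValid Y x.1 j ⟨s - 1, digest Y x.1 b, σ⟩ = true := by
  obtain ⟨t', -, h1, -, rfl⟩ := proposal_origin Y C x h
  obtain ⟨t₁, -, b, h2, h3, h4, h5⟩ :=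
    sendCert_origin Y C x (s := s - 1) (t := t') (j := j) (by omega) (by omega)
  exact ⟨b, _, ⟨t₁, h2, h3⟩, h5, G.combine_ok _ _ (fun i σ => validShares_eq_some) h4⟩

/-- A proposal of an honest sender for the current or a later slot is never discarded: its
certificate is valid, and the digest is that of the recorded batch since an honest sender proposes
only one batch per slot. -/
theorem Good.seen_handled (G : Good Y C x) {t : ℕ} {i j : Fin n} {s : ℕ} (hj : j ∉ C)
    (hs : s ∈ (𝒩 t i).seen j) :
    s < (𝒩 t i).recvSlot j ∨ ∃ tx d σ, (𝒩 t i).jump j = some (s, tx, d, σ) := by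
  induction t with
  | zero => simp [nodeAt, exec] at hs
  | succ t ih =>
    obtain ⟨out, h, -⟩ := tr_step Y C x t i
    have hI := inv_nodeAt Y C x t i
    have hr := (h.recvSlot_le hI j).1
    revert hs
    generalize 𝒩 (t + 1) i = nd' at h hr
    intro hs
    cases h <;> try exact ih hs
    case skipBad j' s' tx cert rest h1 h2 h3 h4 h5 =>
      by_cases hne : j = j'
      · subst hne
        simp only [Function.update_self, List.mem_cons] at hs
        rcases hs with rfl | hs
        · left
          have hsent := queue_origin Y C x (i := i) hj (t := t) (by rw [h2]; exact List.mem_cons_self)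
          have hpos := hI.recv_pos j
          by_contra hlt
          rcases (not_lt.1 hlt).eq_or_lt with heq | hgt
          · obtain ⟨h6, h7⟩ := h4 heq.symm
            simp only at heq
            obtain ⟨b, σ, h8, rfl, h10⟩ := G.proposal_valid (by omega) hsent
            rcases hl : (𝒩 t i).latest j with _ | ⟨k, tx₀⟩
            · have := hI.latest_none j hl; omega
            · have hk := (hI.latest_some j k tx₀ hl).1
              obtain rfl : k = s - 1 := by omega
              have := (proposed_of_latest hj hl).unique Y C x h8
              exact h7 _ _ _ _ rfl hl rfl (by rw [this]) h10
          · obtain ⟨b, σ, h8, rfl, h10⟩ := G.proposal_valid (by simp only at hgt; omega) hsent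
            exact h5 hgt _ _ rfl h10
        · exact ih hs
      · simp only [Function.update_of_ne hne] at hs
        exact ih hs
    case jumpStart j' s' tx d σ rest mm lp h1 h2 h3 h4 h5 h6 =>
      by_cases hne : j = j'
      · subst hne
        simp only [Function.update_self, List.mem_cons] at hs ⊢
        rcases hs with rfl | hs
        · exact Or.inr ⟨_, _, _, rfl⟩
        · rcases ih hs with h | ⟨_, _, _, h⟩
          · exact Or.inl h
          · rw [h1] at h; simp at h
      · simp only [Function.update_of_ne hne] at hs ⊢
        exact ih hs
    all_goals grind [Function.update_apply]

theorem Good.seen_voted (G : Good Y C x) {t : ℕ} {i j : Fin n} {s : ℕ} (hi : i ∉ C) (hj : j ∉ C)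
    (hs : s ∈ (𝒩 t i).seen j) : ∃ t', s < (𝒩 t' i).recvSlot j := by
  obtain ⟨t', ht', hn⟩ := G.jump_completes (j := j) hi t
  rcases G.seen_handled hj (seen_mono Y C x ht' i j s hs) with h | ⟨tx, d, σ, h⟩
  · exact ⟨t', h⟩
  · rw [hn] at h; simp at h

theorem Good.proposal_voted (G : Good Y C x) {i j : Fin n} {s : ℕ} {a : Batch} (hi : i ∉ C)
    (hj : j ∉ C) (h : Proposed Y C x j s a) : ∃ t, s < (𝒩 t i).recvSlot j := by
  obtain ⟨t, rfl, h2⟩ := h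
  obtain ⟨t', ht'⟩ := G.delivered hj hi (proposal_sent Y C x h2 i)
  obtain ⟨t₁, h3⟩ := G.queue_popped (i := i) (j := j) hi (t := t' + 1)
    (q := ((𝒩 t j).sendSlot, a, (𝒩 t j).sendCert)) (by simp [ht', receive])
  exact G.seen_voted hi hj h3

/-- If the slot were stuck, all honest nodes would vote for its unique batch, and the at least `n -
f` valid shares would let the sender advance. -/
theorem Good.sendSlot_advances (G : Good Y C x) {j : Fin n} (hj : j ∉ C) (t : ℕ) :
    ∃ t', (𝒩 t j).sendSlot < (𝒩 t' j).sendSlot := by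
  by_contra! hc
  have heq : ∀ t' ≥ t, (𝒩 t' j).sendSlot = (𝒩 t j).sendSlot := fun t' ht' =>
    le_antisymm (hc t') (sendSlot_mono Y C x ht' j)
  have hb : ∃ t₁ ≥ t, ∃ a, (𝒩 t₁ j).sendBatch = some a := by
    obtain ⟨t₁, ht₁, hr⟩ := G.run_after hj .sender t
    rcases hn : (𝒩 t₁ j).sendBatch with _ | a
    · refine ⟨t₁ + 1, by omega, (𝒩 t₁ j).buffer.take Y.batchSize, ?_⟩
      rw [(nodeAt_run Y C x t₁ j hj _ hr).1]
      simp [runProcess, senderStep, hn]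
    · exact ⟨t₁, ht₁, a, hn⟩
  obtain ⟨t₁, ht₁, a, ha⟩ := hb
  have hP : Proposed Y C x j (𝒩 t j).sendSlot a := ⟨t₁, heq t₁ ht₁, ha⟩
  obtain ⟨T, hT⟩ := exists_forall_of_mono
    (P := fun u i => i ∉ C → (𝒩 t j).sendSlot < (𝒩 u i).recvSlot j)
    (fun u u' i hu hp hi => (hp hi).trans_le (recvSlot_mono Y C x hu i j)) fun i => by
      by_cases hi : i ∈ C
      · exact ⟨0, fun h => absurd hi h⟩
      · exact (G.proposal_voted hi hj hP).imp fun _ h _ => h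
  have hvote : ∀ i, i ∉ C → ∃ u, (i, (𝒩 t j).sendSlot, Y.sig.shareSign (x.1.sk i)
      (sigMsg j (𝒩 t j).sendSlot (digest Y x.1 a))) ∈ (𝒩 u j).votes := by
    intro i hi
    have h1 := hT i hi
    have hI := inv_nodeAt Y C x T i
    have hpos := sendSlot_pos Y C x t j
    rcases hl : (𝒩 T i).latest j with _ | ⟨k, b⟩
    · have := hI.latest_none j hl; omega
    · have hk := (hI.latest_some j k b hl).1
      have hPk := proposed_of_latest hj hl
      obtain ⟨u, hu, -⟩ := id hPk
      have := hc u
      -- The voter is past the stuck slot, so `k` is at least that slot; and `k` was proposed, so it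
      -- cannot exceed it.
      obtain rfl : k = (𝒩 t j).sendSlot := by omega
      obtain rfl := hPk.unique Y C x hP
      obtain ⟨u', hu'⟩ := G.delivered hi hj (vote_sent Y C x hl)
      exact ⟨u' + 1, by simp [hu', receive]⟩
  obtain ⟨T', hT'⟩ := exists_forall_of_mono (P := fun u i => i ∉ C →
      (i, (𝒩 t j).sendSlot, Y.sig.shareSign (x.1.sk i)
        (sigMsg j (𝒩 t j).sendSlot (digest Y x.1 a))) ∈ (𝒩 u j).votes)
    (fun u u' i hu hp hi => votes_mono Y C x hu j _ (hp hi)) fun i => by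
      by_cases hi : i ∈ C
      · exact ⟨0, fun h => absurd hi h⟩
      · exact (hvote i hi).imp fun _ h _ => h
  obtain ⟨t₂, ht₂, hr⟩ := G.run_after hj .sender (max t₁ T')
  have h2 : (𝒩 t₂ j).sendBatch = some a :=
    (send_eq Y C x (show t₁ ≤ t₂ by omega) j (by rw [heq t₂ (by omega), heq t₁ ht₁])).2 a ha
  have h3 : n - f ≤ (Finset.univ.filter fun i =>
      (validShares Y x.1 j (𝒩 t₂ j).sendSlot a (𝒩 t₂ j) i).isSome = true).card := by
    have hcard := Finset.card_add_card_compl C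
    rw [Fintype.card_fin] at hcard
    have := G.card_corrupt
    refine le_trans (show n - f ≤ Cᶜ.card by omega) (Finset.card_le_card fun i hi => ?_)
    refine Finset.mem_filter.2 ⟨Finset.mem_univ _, ?_⟩
    rw [heq t₂ (by omega)]
    exact validShares_isSome (votes_mono Y C x (show T' ≤ t₂ by omega) j _
      (hT' i (Finset.mem_compl.1 hi))) (G.share_ok _ _)
  have h4 := hc (t₂ + 1)
  rw [(nodeAt_run Y C x t₂ j hj _ hr).1] at h4
  simp only [runProcess, senderStep, h2, h3, if_true] at h4
  rw [heq t₂ (by omega)] at h4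
  omega

theorem Good.sendSlot_unbounded (G : Good Y C x) {j : Fin n} (hj : j ∉ C) (s : ℕ) :
    ∃ t, s ≤ (𝒩 t j).sendSlot := by
  induction s with
  | zero => exact ⟨0, Nat.zero_le _⟩
  | succ s ih =>
    obtain ⟨t, ht⟩ := ih
    obtain ⟨t', ht'⟩ := G.sendSlot_advances hj t
    exact ⟨t', by omega⟩

theorem Good.exists_proposed (G : Good Y C x) {j : Fin n} (hj : j ∉ C) {s : ℕ} (hs : 1 ≤ s) :
    ∃ a, Proposed Y C x j s a := by
  obtain ⟨t, ht⟩ := G.sendSlot_unbounded hj (s + 1)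
  exact proposed_of_lt Y C x hs ht

/-- Every honest node eventually holds certificates for all slots of honest broadcasts. -/
theorem Good.current_unbounded (G : Good Y C x) {i j : Fin n} (hi : i ∉ C) (hj : j ∉ C)
    (s : ℕ) : ∃ t, s ≤ ((𝒩 t i).current j).slot := by
  -- The certificate for slot `s` arrives with the proposal of slot `s + 1`.
  obtain ⟨a, ha⟩ := G.exists_proposed hj (s := s + 1) (by omega)
  obtain ⟨t, ht⟩ := G.proposal_voted hi hj ha
  refine ⟨t, ?_⟩
  rw [(inv_nodeAt Y C x t i).current_slot]
  omega

end Trace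

/-! ## Progress of the epochs -/

section Consensus

variable {n f : ℕ} {Y : System n f} {S : Setup n} {nd : Node n}

theorem consensusStep_give (h : nd.mvbaIn nd.epoch = none) (hc : n - f ≤
      (Finset.univ.filter fun j => (nd.ordered j).slot < (nd.current j).slot).card) :
    ((consensusStep Y S nd).1.mvbaIn nd.epoch).isSome = true := by
  simp [consensusStep, h, hc]

theorem consensusStep_output {w v : Vec n} (hw : nd.mvbaIn nd.epoch = some w)
    (hv : nd.mvbaOut nd.epoch = some v) (hc : ∀ j, complete nd v j = true) :
    (consensusStep Y S nd).1.epoch = nd.epoch + 1 := by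
  simp [consensusStep, hw, hv, hc]

theorem consensusStep_fetch {w v : Vec n} (hw : nd.mvbaIn nd.epoch = some w)
    (hv : nd.mvbaOut nd.epoch = some v) (hc : ¬ ∀ j, complete nd v j = true) (j : Fin n) :
    complete nd v j = true ∨ (certValid Y S j (v j) = true →
      (v j).slot ≤ ((consensusStep Y S nd).1.maxMissing j).slot ∨
        (v j).slot ≤ (nd.current j).slot) := by
  obtain ⟨mm, lp, h, hj⟩ := foldl_pull Y S nd v
  have : (consensusStep Y S nd).1.maxMissing = mm := by
    simp only [consensusStep, hw, hv]
    rw [if_neg hc, h]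
  rw [this]
  rcases hj j with ⟨-, -, h1⟩ | ⟨h1, -, h2⟩ | ⟨h1, -⟩
  · exact Or.inl h1
  · exact Or.inr fun hcv => by rw [h1]; exact h2 hcv
  · exact Or.inr fun _ => Or.inl (by rw [h1])

theorem Tr.epoch_succ_le {L : Fin n → Msg n → Prop} {i : Fin n} {nd' : Node n}
    {out : List (Fin n × Msg n)} (h : Tr Y S L i nd nd' out) : nd'.epoch ≤ nd.epoch + 1 := by
  cases h <;> simp

theorem Tr.mvbaIn_or_current {L : Fin n → Msg n → Prop} {i : Fin n} {nd' : Node n}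
    {out : List (Fin n × Msg n)} (h : Tr Y S L i nd nd' out) :
    nd'.mvbaIn = nd.mvbaIn ∨ nd'.current = nd.current := by
  cases h <;> first | exact Or.inl rfl | exact Or.inr rfl

end Consensus

section Trace

variable {n f : ℕ} {Y : System n f} {C : Finset (Fin n)} {x : Outcome n}

local notation "𝒩" => nodeAt Y C x

theorem ordered_origin {t : ℕ} {i : Fin n} {e : ℕ} (he : 1 ≤ e) (h : (𝒩 t i).epoch = e + 1) :
    ∃ t' < t, (𝒩 t' i).epoch = e ∧ (𝒩 t' i).mvbaOut e = some (𝒩 t i).ordered := by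
  have hI := consInv_nodeAt Y C x t i
  have hlen : e - 1 < (𝒩 t i).blocks.length := by have := hI.blocks_length; omega
  obtain ⟨t', ht', v, h1, h2, -⟩ := block_origin Y C x (List.getElem?_eq_getElem hlen)
  rw [Nat.sub_add_cancel he] at h1 h2
  have h3 := mvbaOut_mono Y C x ht'.le i e v h2
  rw [hI.ordered_succ e he h] at h3
  exact ⟨t', ht', h1, h2.trans h3.symm⟩

theorem Good.ordered_valid (G : Good Y C x) {t : ℕ} {i : Fin n} (hi : i ∉ C) (j : Fin n) :
    certValid Y x.1 j ((𝒩 t i).ordered j) = true ∨ ((𝒩 t i).ordered j).slot = 0 := by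
  have hI := consInv_nodeAt Y C x t i
  rcases hI.epoch_pos.eq_or_lt with h | h
  · rw [hI.ordered_first h.symm]; exact Or.inr rfl
  · obtain ⟨t', -, h1, h2⟩ := ordered_origin (Y := Y) (C := C) (x := x) (t := t) (i := i)
      (e := (𝒩 t i).epoch - 1) (by omega) (by omega)
    exact ((G.mvba _).2.2 i hi t' _ h1 h2).1 j

/-- Entries that lag behind are replaced by ordered ones, whose signatures are valid by external
validity of the previous instance. Without the replacement the last clause of `ValidVec` could fail.
-/
theorem Good.input_valid (G : Good Y C x) {t : ℕ} {i : Fin n} {e : ℕ} {v : Vec n} (hi : i ∉ C)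
    (h : (𝒩 t i).mvbaIn e = some v) : ∃ t' v, (𝒩 t' i).epoch = e ∧
      (𝒩 t' i).mvbaIn e = some v ∧ ValidVec Y x.1 (𝒩 t' i).ordered v := by
  obtain ⟨t', -, h1, h2, rfl, h3, h4, h5, h6⟩ := mvbaIn_origin Y C x h
  refine ⟨t' + 1, _, h4, h5, ?_⟩
  rw [h6]
  refine ⟨fun j => ?_, h3.trans (Finset.card_le_card fun j hj => ?_), fun j => ?_⟩
  · unfold inputVec
    split
    · exact ((inv_nodeAt Y C x t' i).current_valid j).symm
    · exact G.ordered_valid hi j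
  · have hj' := (Finset.mem_filter.1 hj).2
    refine Finset.mem_filter.2 ⟨Finset.mem_univ _, ?_⟩
    unfold inputVec
    rw [if_pos hj'.le]
    exact hj'
  · unfold inputVec
    split
    · assumption
    · exact le_rfl

/-- Without an input the epoch and its ordered indices stay fixed, while the certificates of all
honest broadcasts grow without bound and eventually exceed them. -/
theorem Good.input_eventually (G : Good Y C x) {t : ℕ} {i : Fin n} (hi : i ∉ C) :
    ∃ t', ((𝒩 t' i).mvbaIn (𝒩 t i).epoch).isSome = true := by
  by_contra! hc
  have heq : ∀ t' ≥ t, (𝒩 t' i).epoch = (𝒩 t i).epoch := by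
    intro t' ht'
    by_contra hne
    have hI := consInv_nodeAt Y C x t' i
    have h1 := epoch_mono Y C x ht' i
    exact hc t' (hI.out_in _ (hI.out_lt _ (consInv_nodeAt Y C x t i).epoch_pos (by omega)))
  obtain ⟨T, hT⟩ := exists_forall_of_mono
    (P := fun u j => j ∉ C → ((𝒩 t i).ordered j).slot < ((𝒩 u i).current j).slot)
    (fun u u' j hu hp hj => (hp hj).trans_le (current_mono Y C x hu i j)) fun j => by
      by_cases hj : j ∈ C
      · exact ⟨0, fun h => absurd hj h⟩
      · exact (G.current_unbounded hi hj (((𝒩 t i).ordered j).slot + 1)).imp fun _ h _ => h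
  obtain ⟨t', ht', hr⟩ := G.run_after hi .consensus (max t T)
  have h1 := heq t' (by omega)
  apply hc (t' + 1)
  rw [(nodeAt_run Y C x t' i hi _ hr).1, ← h1]
  refine consensusStep_give (by rw [h1]; simpa using hc t') ?_
  have hcard := Finset.card_add_card_compl C
  rw [Fintype.card_fin] at hcard
  have := G.card_corrupt
  refine le_trans (show n - f ≤ Cᶜ.card by omega) (Finset.card_le_card fun j hj => ?_)
  refine Finset.mem_filter.2 ⟨Finset.mem_univ _, ?_⟩
  rw [G.ordered_eq hi hi h1]
  exact (hT j (Finset.mem_compl.1 hj)).trans_le (current_mono Y C x (by omega) i j)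

theorem exists_epoch_eq {i : Fin n} {e t : ℕ} (he : 1 ≤ e) (h : e ≤ (𝒩 t i).epoch) :
    ∃ t', (𝒩 t' i).epoch = e := by
  induction t with
  | zero => exact ⟨0, le_antisymm he h⟩
  | succ t ih =>
    by_cases h1 : e ≤ (𝒩 t i).epoch
    · exact ih h1
    · obtain ⟨out, ht, -⟩ := tr_step Y C x t i
      have := ht.epoch_succ_le
      exact ⟨t + 1, by omega⟩

/-- Once the MVBA instance of the current epoch has an output, the epoch is completed. -/
theorem Good.epoch_completes (G : Good Y C x) {i : Fin n} {e t : ℕ} {v : Vec n} (hi : i ∉ C)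
    (he : (𝒩 t i).epoch = e) (hv : (𝒩 t i).mvbaOut e = some v) :
    ∃ t', e + 1 ≤ (𝒩 t' i).epoch := by
  by_contra! hc
  have heq : ∀ t' ≥ t, (𝒩 t' i).epoch = e := fun t' ht' =>
    le_antisymm (by have := hc t'; omega) (he ▸ epoch_mono Y C x ht' i)
  have hout : ∀ t' ≥ t, (𝒩 t' i).mvbaOut (𝒩 t' i).epoch = some v := fun t' ht' => by
    rw [heq t' ht']; exact mvbaOut_mono Y C x ht' i e v hv
  have hin : ∀ t' ≥ t, ∃ w, (𝒩 t' i).mvbaIn (𝒩 t' i).epoch = some w := fun t' ht' =>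
    Option.isSome_iff_exists.1 ((consInv_nodeAt Y C x t' i).out_in _ (by rw [hout t' ht']; rfl))
  have hvalid := (G.mvba e).2.2 i hi t v he hv
  have hord : ∀ t' ≥ t, (𝒩 t' i).ordered = (𝒩 t i).ordered := fun t' ht' =>
    G.ordered_eq hi hi (by rw [heq t' ht', he])
  have hmono : ∀ t₁ ≥ t, ∀ t₂ ≥ t₁, ∀ j, complete (𝒩 t₁ i) v j = true →
      complete (𝒩 t₂ i) v j = true := by
    intro t₁ h1 t₂ h2 j h
    rw [complete_iff] at h ⊢
    rw [hord t₂ (by omega), ← hord t₁ h1]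
    exact fun k h3 h4 => fixed_isSome_mono Y C x h2 i j k (h k h3 h4)
  -- A consensus step in a complete state would end the epoch. So the next such step pulls the
  -- missing batches instead, and a later one, after all of them have arrived, gives the
  -- contradiction.
  have hnot : ∀ t' ≥ t, x.2 t' = .run i .consensus → ¬ ∀ j, complete (𝒩 t' i) v j = true := by
    intro t' ht' hr hall
    obtain ⟨w, hw⟩ := hin t' ht'
    have h1 := heq (t' + 1) (by omega)
    rw [(nodeAt_run Y C x t' i hi _ hr).1] at h1
    have h2 := consensusStep_output (Y := Y) (S := x.1) hw (hout t' ht') hall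
    have h3 := heq t' ht'
    simp only [runProcess] at h1
    omega
  obtain ⟨t₁, ht₁, hr₁⟩ := G.run_after hi .consensus t
  obtain ⟨w, hw⟩ := hin t₁ ht₁
  have hfix : ∀ j, ∃ t₂, t₁ ≤ t₂ ∧ complete (𝒩 t₂ i) v j = true := by
    intro j
    rcases consensusStep_fetch (Y := Y) (S := x.1) hw (hout t₁ ht₁) (hnot t₁ ht₁ hr₁) j with h | h
    · exact ⟨t₁, le_rfl, h⟩
    · have h' : (v j).slot ≤ ((𝒩 (t₁ + 1) i).maxMissing j).slot ∨
          (v j).slot ≤ ((𝒩 t₁ i).current j).slot := by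
        rcases hvalid.1 j with h2 | h2
        · rw [(nodeAt_run Y C x t₁ i hi _ hr₁).1]; exact h h2
        · exact Or.inr (by omega)
      rcases h' with h' | h'
      · obtain ⟨t₂, ht₂, hf⟩ := G.fixed_eventually hi h'
        exact ⟨t₂, by omega, complete_iff.2 fun k h3 h4 => hf k (by omega) h4⟩
      · exact ⟨t₁, le_rfl, complete_iff.2 fun k h3 h4 =>
          (inv_nodeAt Y C x t₁ i).fixed_current j k (by omega) (h4.trans h')⟩
  obtain ⟨T, hT⟩ := exists_forall_of_mono
    (P := fun u j => t₁ ≤ u ∧ complete (𝒩 u i) v j = true)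
    (fun u u' j hu hp => ⟨hp.1.trans hu, hmono u (by omega) u' hu j hp.2⟩) hfix
  obtain ⟨t₃, ht₃, hr₃⟩ := G.run_after hi .consensus (max t T)
  have hTt : ∀ j, t ≤ T := fun j => by have := (hT j).1; omega
  exact hnot t₃ (by omega) hr₃ fun j => hmono T (hTt j) t₃ (by omega) j (hT j).2

/-- The induction has to treat all honest nodes together, since termination of an instance requires
valid inputs from all of them. -/
theorem Good.epoch_reached (G : Good Y C x) (e : ℕ) : ∀ i, i ∉ C → ∃ t, (𝒩 t i).epoch = e + 1 := by
  induction e with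
  | zero => exact fun i _ => ⟨0, rfl⟩
  | succ e ih =>
    intro i hi
    have hin : ∀ i, i ∉ C → ∃ t v, (𝒩 t i).epoch = e + 1 ∧ (𝒩 t i).mvbaIn (e + 1) = some v ∧
        ValidVec Y x.1 (𝒩 t i).ordered v := by
      intro i hi
      obtain ⟨t, ht⟩ := ih i hi
      obtain ⟨t', ht'⟩ := G.input_eventually (t := t) hi
      rw [ht] at ht'
      obtain ⟨v, hv⟩ := Option.isSome_iff_exists.1 ht'
      exact G.input_valid hi hv
    obtain ⟨t₁, h1⟩ := (G.mvba (e + 1)).1 hin i hi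
    obtain ⟨v, hv⟩ := Option.isSome_iff_exists.1 h1
    obtain ⟨t, ht⟩ := ih i hi
    have hv' := mvbaOut_mono Y C x (le_max_right t t₁) i _ v hv
    have h2 := epoch_mono Y C x (le_max_left t t₁) i
    have h3 : ∃ t', e + 1 + 1 ≤ (𝒩 t' i).epoch := by
      rcases h2.eq_or_lt with h4 | h4
      · exact G.epoch_completes hi (h4.symm.trans ht) hv'
      · exact ⟨max t t₁, by omega⟩
    obtain ⟨t', ht'⟩ := h3
    exact exists_epoch_eq (by omega) ht'

theorem Good.agreement (G : Good Y C x) : Agreement Y C x := by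
  intro i i' hi hi' t tx htx
  unfold output at *
  obtain ⟨b, hb, htx⟩ := List.mem_flatten.1 htx
  obtain ⟨e, he, rfl⟩ := List.mem_iff_getElem.1 hb
  -- In epoch `e + 2` there are `e + 1` blocks, so position `e` is occupied.
  obtain ⟨t', ht'⟩ := G.epoch_reached (e + 1) i' hi'
  have hl := (consInv_nodeAt Y C x t' i').blocks_length
  have hlt : e < (𝒩 t' i').blocks.length := by omega
  refine ⟨t', List.mem_flatten.2 ⟨_, List.getElem_mem hlt, ?_⟩⟩
  rw [G.block_eq hi' hi (List.getElem?_eq_getElem hlt) (List.getElem?_eq_getElem he)]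
  exact htx

/-! ## Output of certified slots -/

/-- An instance that began after all honest nodes were certified for a slot, and whose output does
not come from the adversary, orders the slot. -/
theorem Good.ordered_of_not_adv (G : Good Y C x) {j : Fin n} {s e T : ℕ} (he : 1 ≤ e)
    (hT : Certified Y C x j s T) (hin : ∀ i, i ∉ C → (𝒩 T i).mvbaIn e = none)
    (hadv : ¬ AdvOutput Y C x e) {t : ℕ} {i : Fin n} (hi : i ∉ C) (ht : (𝒩 t i).epoch = e + 1) :
    s ≤ ((𝒩 t i).ordered j).slot := by
  classical
  have hex : ∃ u, ∃ i, i ∉ C ∧ ((𝒩 u i).mvbaOut e).isSome = true :=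
    ⟨t, i, hi, (consInv_nodeAt Y C x t i).out_lt e he (by omega)⟩
  obtain ⟨i₁, hi₁, h1⟩ := Nat.find_spec hex
  have hmin : ∀ t' < Nat.find hex, ∀ i', i' ∉ C → (𝒩 t' i').mvbaOut e = none := by
    intro t' ht' i' hi'
    have := Nat.find_min hex ht'
    push Not at this
    simpa using this i' hi'
  revert h1 hmin
  generalize Nat.find hex = t₁
  intro h1 hmin
  obtain ⟨v, hv⟩ := Option.isSome_iff_exists.1 h1
  have h2 : ∃ i', i' ∉ C ∧ (𝒩 t₁ i').mvbaIn e = some v := by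
    by_contra! hc
    exact hadv ⟨t₁, i₁, v, hi₁, hv, hmin, hc⟩
  obtain ⟨i', hi', h3⟩ := h2
  obtain ⟨t', -, -, -, rfl, -, -, h4, -⟩ := mvbaIn_origin Y C x h3
  have hTt : T ≤ t' := by
    by_contra hlt
    have := mvbaIn_mono Y C x (show t' + 1 ≤ T by omega) i' e _ h4
    rw [hin i' hi'] at this
    simp at this
  have h5 := (hT i' hi').trans (current_mono Y C x hTt i' j)
  have h6 := (consInv_nodeAt Y C x t i).ordered_succ e he ht
  rw [(G.mvba e).2.1 i i₁ hi hi₁ t t₁ _ _ h6 hv]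
  unfold inputVec
  split
  · exact h5
  · omega

theorem begun_of_le {T e : ℕ} (he : 1 ≤ e) (h : e ≤ begunCount Y C x T) :
    Begun Y C x e T := by
  unfold begunCount at h
  rw [Finset.le_sup_iff (by exact he)] at h
  obtain ⟨i, hi, h⟩ := h
  refine ⟨i, (Finset.mem_filter.1 hi).2, ?_⟩
  have hI := consInv_nodeAt Y C x T i
  have hlt : e < (𝒩 T i).epoch → ((𝒩 T i).mvbaIn e).isSome = true := fun h =>
    hI.out_in _ (hI.out_lt e he h)
  split at h
  · rename_i hs
    rcases h.eq_or_lt with h | h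
    · rw [h]; exact hs
    · exact hlt h
  · have := hI.epoch_pos
    exact hlt (by omega)

theorem le_begunCount {T e : ℕ} (h : Begun Y C x e T) : e ≤ begunCount Y C x T := by
  obtain ⟨i, hi, h⟩ := h
  have hI := consInv_nodeAt Y C x T i
  have h1 := hI.in_le e h
  refine le_trans ?_ (Finset.le_sup (Finset.mem_filter.2 ⟨Finset.mem_univ i, hi⟩))
  split
  · exact h1.2
  · rename_i hs
    have : e ≠ (𝒩 T i).epoch := fun he => hs (he ▸ h)
    omega

/-- With `m ≥ 1`, the instance numbered `begunCount + m` has not begun at any honest node by time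
`T`, so an honest input to it already covers slot `s`. -/
theorem Good.outputWithin (G : Good Y C x) {j : Fin n} {s T m : ℕ} (hj : j ∉ C) (hs : 1 ≤ s)
    (hm : 1 ≤ m) (hT : Certified Y C x j s T) (hT' : ∀ t' < T, ¬ Certified Y C x j s t')
    (hadv : ¬ AdvOutput Y C x (begunCount Y C x T + m)) : OutputWithin Y C x j s m := by
  obtain ⟨b, hb⟩ := G.exists_proposed hj hs
  set e := begunCount Y C x T + m with he
  obtain ⟨t, ht⟩ := exists_forall_of_mono (P := fun u i => i ∉ C → ∃ t' ≤ u, (𝒩 t' i).epoch = e + 1)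
    (fun u u' i hu hp hi => (hp hi).imp fun _ h => ⟨h.1.trans hu, h.2⟩) fun i => by
      by_cases hi : i ∈ C
      · exact ⟨0, fun h => absurd hi h⟩
      · obtain ⟨t, ht⟩ := G.epoch_reached e i hi
        exact ⟨t, fun _ => ⟨t, le_rfl, ht⟩⟩
  refine ⟨T, b, t, hT, hT', hb, fun i hi tx htx => ?_⟩
  obtain ⟨t', ht', hep⟩ := ht i hi
  have hin : ∀ i, i ∉ C → (𝒩 T i).mvbaIn e = none := by
    intro i hi
    by_contra hc
    have := le_begunCount ⟨i, hi, Option.isSome_iff_ne_none.2 hc⟩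
    omega
  obtain ⟨t₁, a, ha, hout⟩ := ordered_output (Y := Y) (C := C) (x := x) t' i j s hs
    (G.ordered_of_not_adv (by omega) hT hin hadv hi hep)
  obtain rfl := (G.proposed_of_fixed hi hj ha).unique Y C x hb
  obtain ⟨r, hr⟩ := blocks_mono Y C x ht' i
  have hl := (consInv_nodeAt Y C x t' i).blocks_length
  rw [← hr, List.take_left' (by omega)]
  exact hout tx htx

theorem Good.exists_certified (G : Good Y C x) {j : Fin n} (hj : j ∉ C) (s : ℕ) :
    ∃ T, Certified Y C x j s T ∧ ∀ t' < T, ¬ Certified Y C x j s t' := by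
  classical
  have hex : ∃ T, Certified Y C x j s T := exists_forall_of_mono
    (P := fun u i => i ∉ C → s ≤ ((𝒩 u i).current j).slot)
    (fun u u' i hu hp hi => (hp hi).trans (current_mono Y C x hu i j)) fun i => by
      by_cases hi : i ∈ C
      · exact ⟨0, fun h => absurd hi h⟩
      · exact (G.current_unbounded hi hj s).imp fun _ h _ => h
  exact ⟨Nat.find hex, Nat.find_spec hex, fun t' ht' => Nat.find_min hex ht'⟩

theorem Certified.mono {j : Fin n} {s t t' : ℕ} (h : t ≤ t') (hc : Certified Y C x j s t) :
    Certified Y C x j s t' :=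
  fun i hi => (hc i hi).trans (current_mono Y C x h i j)

theorem Begun.of_adv {e : ℕ} (h : AdvOutput Y C x e) : ∃ t, Begun Y C x e t := by
  obtain ⟨t, i, v, hi, hv, -⟩ := h
  exact ⟨t, i, hi, (consInv_nodeAt Y C x t i).out_in e (by rw [hv]; rfl)⟩

theorem exists_only_node (t : ℕ) : ∃ i₀, ∀ i ≠ i₀, 𝒩 (t + 1) i = 𝒩 t i := by
  have hex : exec Y C x (t + 1) = applyLabel Y C x.1 (exec Y C x t) (x.2 t) := rfl
  unfold nodeAt
  rw [hex]
  cases x.2 t with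
  | input i' tx => exact ⟨i', fun i hi => by simp only [applyLabel]; split <;> simp [hi]⟩
  | deliver src dst m => exact ⟨dst, fun i hi => by simp only [applyLabel]; split <;> simp [hi]⟩
  | run i' p => exact ⟨i', fun i hi => by simp only [applyLabel]; split <;> simp [hi]⟩
  | mvba i' v => exact ⟨i', fun i hi => by simp only [applyLabel]; split <;> simp [hi]⟩

/-- No event at once begins an instance and completes the certification of a slot. -/
theorem not_begun_certified {j : Fin n} {s e t : ℕ} (h1 : ¬ Begun Y C x e t)
    (h2 : Begun Y C x e (t + 1)) (h3 : ¬ Certified Y C x j s t) : ¬ Certified Y C x j s (t + 1) := by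
  intro h4
  obtain ⟨i₀, h0⟩ := exists_only_node (Y := Y) (C := C) (x := x) t
  obtain ⟨i, hi, h5⟩ := h2
  unfold Certified at h3
  push Not at h3
  obtain ⟨i', hi', h6⟩ := h3
  have e1 : i = i₀ := by
    by_contra hne
    rw [h0 i hne] at h5
    exact h1 ⟨i, hi, h5⟩
  have e2 : i' = i₀ := by
    by_contra hne
    have := h4 i' hi'
    rw [h0 i' hne] at this
    omega
  subst e1 e2
  obtain ⟨out, ht, -⟩ := tr_step Y C x t i'
  rcases ht.mvbaIn_or_current with h | h
  · rw [h] at h5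
    exact h1 ⟨i', hi, h5⟩
  · have := h4 i' hi'
    rw [h] at this
    omega

/-- All honest nodes are certified for slot `s` of `j` when the instance of `e` begins. -/
def CertifiedAtStart (Y : System n f) (C : Finset (Fin n)) (j : Fin n) (s e : ℕ)
    (x : Outcome n) : Prop :=
  ∀ i, i ∉ C → s ≤ slotsAtStart Y C x e i j

/-- The honest `j` and `1 ≤ s` exclude the default value `0` that `slotsAtStart` takes if the
instance never begins. -/
theorem certifiedAtStart_iff {j : Fin n} {s e : ℕ} (hj : j ∉ C) (hs : 1 ≤ s) :
    CertifiedAtStart Y C j s e x ↔ ∃ t, Begun Y C x e t ∧ (∀ t' < t, ¬ Begun Y C x e t') ∧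
      Certified Y C x j s t := by
  classical
  unfold CertifiedAtStart slotsAtStart
  by_cases h : ∃ t, Begun Y C x e t
  · simp only [dif_pos h]
    constructor
    · intro hc
      exact ⟨Nat.find h, Nat.find_spec h, fun t' ht' => Nat.find_min h ht', hc⟩
    · rintro ⟨t, h1, h2, h3⟩
      have : Nat.find h = t := (Nat.find_eq_iff h).2 ⟨h1, h2⟩
      rw [this]; exact h3
  · simp only [dif_neg h]
    constructor
    · intro hc; have := hc j hj; omega
    · rintro ⟨t, h1, -⟩; exact absurd ⟨t, h1⟩ h

/-- The time `T` is not part of the record on which the quality is conditioned. This expresses the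
number of instances begun by `T` through the record, as the index before the first instance that
starts with all honest nodes certified. -/
theorem Good.certifiedAtStart (G : Good Y C x) {j : Fin n} {s T : ℕ} (hj : j ∉ C) (hs : 1 ≤ s)
    (hT : Certified Y C x j s T) (hT' : ∀ t' < T, ¬ Certified Y C x j s t') :
    (∀ e ≤ begunCount Y C x T, ¬ CertifiedAtStart Y C j s e x) ∧
      CertifiedAtStart Y C j s (begunCount Y C x T + 1) x := by
  classical
  constructor
  · intro e he hc
    obtain ⟨t, h1, h2, h3⟩ := (certifiedAtStart_iff hj hs).1 hc
    have hpos : 1 ≤ e := by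
      obtain ⟨i, -, h⟩ := h1
      exact ((consInv_nodeAt Y C x t i).in_le e h).1
    have hb := begun_of_le hpos he
    have htT : t ≤ T := by
      by_contra hlt
      exact h2 T (by omega) hb
    have hTt : T ≤ t := by
      by_contra hlt
      exact hT' t (by omega) h3
    obtain rfl := le_antisymm htT hTt
    rcases t with _ | t
    · have := h3 j hj
      simp [nodeAt, exec] at this
      omega
    · exact not_begun_certified (h2 t (by omega)) h1 (hT' t (by omega)) h3
  · rw [certifiedAtStart_iff hj hs]
    obtain ⟨t, ht⟩ := G.epoch_reached (begunCount Y C x T + 1) j hj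
    have hI := consInv_nodeAt Y C x t j
    have hex : ∃ t, Begun Y C x (begunCount Y C x T + 1) t :=
      ⟨t, j, hj, hI.out_in _ (hI.out_lt _ (by omega) (by omega))⟩
    refine ⟨Nat.find hex, Nat.find_spec hex, fun t' ht' => Nat.find_min hex ht', ?_⟩
    refine hT.mono (le_of_not_gt fun hlt => ?_)
    obtain ⟨i, hi, h⟩ := Nat.find_spec hex
    obtain ⟨v, hv⟩ := Option.isSome_iff_exists.1 h
    have := le_begunCount ⟨i, hi, (by rw [mvbaIn_mono Y C x hlt.le i _ v hv]; rfl :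
      ((𝒩 T i).mvbaIn (begunCount Y C x T + 1)).isSome = true)⟩
    omega

theorem Good.adv_of_lt_instancesNeeded (G : Good Y C x) {j : Fin n} {s T m : ℕ} (hj : j ∉ C)
    (hs : 1 ≤ s) (hT : Certified Y C x j s T) (hT' : ∀ t' < T, ¬ Certified Y C x j s t')
    (hm : (m : ℕ∞) < instancesNeeded Y C x j s) {k : ℕ} (hk : 1 ≤ k) (hkm : k ≤ m) :
    AdvOutput Y C x (begunCount Y C x T + k) := by
  by_contra hadv
  have h1 : instancesNeeded Y C x j s ≤ (k : ℕ∞) :=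
    iInf₂_le k (G.outputWithin hj hs hk hT hT' hadv)
  have h2 : (k : ℕ∞) ≤ m := by exact_mod_cast hkm
  exact absurd (hm.trans_le (h1.trans h2)) (lt_irrefl _)

end Trace

/-! ## Liveness -/

section Buffer

variable {n f : ℕ} {Y : System n f} {S : Setup n}
variable {L : Fin n → Msg n → Prop} {i : Fin n} {nd nd' : Node n} {out : List (Fin n × Msg n)}

theorem idxOf_filter_le {α : Type*} [BEq α] [LawfulBEq α] (p : α → Bool) (a : α) (l : List α)
    (ha : p a = true) : (l.filter p).idxOf a ≤ l.idxOf a := by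
  induction l with
  | nil => simp
  | cons b l ih =>
    by_cases hb : p b = true
    · rw [List.filter_cons_of_pos hb, List.idxOf_cons, List.idxOf_cons]
      by_cases hab : b = a
      · simp [hab]
      · simpa [beq_false_of_ne hab] using ih
    · have hab : b ≠ a := fun h => hb (h ▸ ha)
      rw [List.filter_cons_of_neg hb, List.idxOf_cons_ne _ hab]
      omega

theorem head?_filter_of_idxOf_eq {α : Type*} [BEq α] [LawfulBEq α] (p : α → Bool) (a : α) (l : List α)
    (ha : p a = true) (h : (l.filter p).idxOf a = l.idxOf a) :
    (l.filter p).head? = l.head? := by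
  cases l with
  | nil => rfl
  | cons b l =>
    by_cases hb : p b = true
    · rw [List.filter_cons_of_pos hb]; rfl
    · have hab : b ≠ a := fun h => hb (h ▸ ha)
      rw [List.filter_cons_of_neg hb, List.idxOf_cons_ne _ hab] at h
      have := idxOf_filter_le p a l ha
      omega

/-- Inputs are appended behind `tx` and removals only move it forward. If its position is unchanged,
nothing in front of it was removed, in particular not the head. -/
theorem Tr.buffer_step (h : Tr Y S L i nd nd' out) {tx : Bits} (htx : tx ∈ nd.buffer) :
    tx ∈ nd'.blocks.flatten ∨ (tx ∈ nd'.buffer ∧ nd'.buffer.idxOf tx ≤ nd.buffer.idxOf tx ∧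
      (nd'.buffer.idxOf tx = nd.buffer.idxOf tx → nd'.buffer.head? = nd.buffer.head?)) := by
  cases h <;> try exact Or.inr ⟨htx, le_rfl, fun _ => rfl⟩
  case input tx' =>
    refine Or.inr ⟨List.mem_append_left _ htx, (List.idxOf_append_of_mem htx).le, fun _ => ?_⟩
    exact List.head?_append_of_ne_nil _ (List.ne_nil_of_mem htx)
  case output v h1 h2 h3 =>
    by_cases hb : tx ∈ blockOf nd v
    · left; simp [hb]
    · right
      have hp : (fun tx => decide (tx ∉ blockOf nd v)) tx = true := by simpa using hb
      exact ⟨List.mem_filter.2 ⟨htx, hp⟩, idxOf_filter_le _ tx _ hp,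
        head?_filter_of_idxOf_eq _ tx _ hp⟩

/-- The step that orders a slot is the one that outputs its batch and filters it out of the buffer.
-/
theorem Tr.ordered_step (h : Tr Y S L i nd nd' out) {j : Fin n} {s : ℕ}
    (h1 : (nd.ordered j).slot < s) (h2 : s ≤ (nd'.ordered j).slot) :
    ∃ a, nd.fixed j s = some a ∧ ∀ tx ∈ a, tx ∉ nd'.buffer := by
  cases h <;> try exact absurd h2 (not_le.2 h1)
  case output v h3 h4 h5 =>
    obtain ⟨a, ha⟩ := Option.isSome_iff_exists.1 (complete_iff.1 (h5 j) s h1 h2)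
    refine ⟨a, ha, fun tx htx hm => ?_⟩
    have := (List.mem_filter.1 hm).2
    rw [decide_eq_true_eq] at this
    exact this (mem_blockOf.2 ⟨j, s, mem_newSlots.2 ⟨h1, h2⟩, by rw [ha]; exact htx⟩)

end Buffer

section Trace

variable {n f : ℕ} {Y : System n f} {C : Finset (Fin n)} {x : Outcome n}

local notation "𝒩" => nodeAt Y C x

theorem sendBatch_origin {t : ℕ} {j : Fin n} {b : Batch} (h : (𝒩 t j).sendBatch = some b) :
    ∃ t' < t, (𝒩 t' j).sendSlot = (𝒩 t j).sendSlot ∧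
      b = (𝒩 t' j).buffer.take Y.batchSize := by
  induction t with
  | zero => simp [nodeAt, exec] at h
  | succ t ih =>
    obtain ⟨out, ht, -⟩ := tr_step Y C x t j
    have key : ((𝒩 t j).sendBatch = some b ∨ b = (𝒩 t j).buffer.take Y.batchSize) ∧
        (𝒩 t j).sendSlot = (𝒩 (t + 1) j).sendSlot := by
      revert h
      generalize 𝒩 (t + 1) j = nd' at ht
      intro h
      cases ht <;> try exact ⟨Or.inl h, rfl⟩
      case propose => exact ⟨Or.inr (by simpa using h.symm), rfl⟩
      case advance => simp at h
    rcases key.1 with h1 | h1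
    · obtain ⟨t', ht', h2, h3⟩ := ih h1
      exact ⟨t', by omega, h2.trans key.2, h3⟩
    · exact ⟨t, by omega, key.2, h1⟩

theorem Good.ordered_eventually (G : Good Y C x) (hadv : ∀ E, ∃ e ≥ E, ¬ AdvOutput Y C x e)
    {i j : Fin n} (hi : i ∉ C) (hj : j ∉ C) (s : ℕ) : ∃ t, s ≤ ((𝒩 t i).ordered j).slot := by
  obtain ⟨T, hT, -⟩ := G.exists_certified hj s
  obtain ⟨e, he, h⟩ := hadv (begunCount Y C x T + 1)
  obtain ⟨t, ht⟩ := G.epoch_reached e i hi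
  refine ⟨t, G.ordered_of_not_adv (by omega) hT (fun i hi => ?_) h hi ht⟩
  by_contra hc
  have := le_begunCount ⟨i, hi, Option.isSome_iff_ne_none.2 hc⟩
  omega

theorem Good.ordered_mono (G : Good Y C x) {i : Fin n} (hi : i ∉ C) (j : Fin n) {t t' : ℕ}
    (h : t ≤ t') : ((𝒩 t i).ordered j).slot ≤ ((𝒩 t' i).ordered j).slot := by
  induction t', h using Nat.le_induction with
  | base => exact le_rfl
  | succ t _ ih =>
    refine ih.trans ?_
    obtain ⟨out, ht, -⟩ := tr_step Y C x t i
    have hv := fun v => (G.mvba (𝒩 t i).epoch).2.2 i hi t v rfl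
    generalize 𝒩 (t + 1) i = nd' at ht
    cases ht <;> try exact le_rfl
    case output v h1 h2 h3 => exact (hv v h2).2.2 j

/-- The transaction at the head of a buffer does not stay there forever. -/
theorem Good.head_changes (G : Good Y C x) (hadv : ∀ E, ∃ e ≥ E, ¬ AdvOutput Y C x e)
    {i : Fin n} (hi : i ∉ C) (t : ℕ) (a : Bits) :
    ¬ ∀ t' ≥ t, (𝒩 t' i).buffer.head? = some a := by
  intro hh
  -- The first bound ensures that the batch of slot `s` is taken from the buffer after time `t`,
  -- when `a` is its head; the second that slot `s` is ordered only after `t`.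
  set s := max ((𝒩 t i).sendSlot + 1) (((𝒩 t i).ordered i).slot + 1) with hs
  obtain ⟨b, hb⟩ := G.exists_proposed hi (s := s) (by omega)
  have hab : a ∈ b := by
    obtain ⟨t₁, h1, h2⟩ := hb
    obtain ⟨t₂, -, h3, rfl⟩ := sendBatch_origin h2
    have ht₂ : t ≤ t₂ := by
      by_contra hlt
      have := sendSlot_mono Y C x (show t₂ ≤ t by omega) i
      omega
    have h4 := hh t₂ ht₂
    have hB := G.batch_pos
    rcases hbuf : (𝒩 t₂ i).buffer with _ | ⟨c, l⟩
    · rw [hbuf] at h4; simp at h4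
    · rw [hbuf] at h4
      obtain ⟨B, hB'⟩ : ∃ B, Y.batchSize = B + 1 := ⟨Y.batchSize - 1, by omega⟩
      simp only [List.head?_cons, Option.some.injEq] at h4
      rw [hB', List.take_succ_cons, h4]
      exact List.mem_cons_self
  obtain ⟨t₁, ht₁⟩ := G.ordered_eventually hadv hi hi s
  have hstep : ∃ u ≥ t, ((𝒩 u i).ordered i).slot < s ∧ s ≤ ((𝒩 (u + 1) i).ordered i).slot := by
    by_contra! hc
    have key : ∀ u ≥ t, ((𝒩 u i).ordered i).slot < s := by
      intro u hu
      induction u, hu using Nat.le_induction with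
      | base => omega
      | succ u hu ih => exact hc u hu ih
    rcases le_total t t₁ with h | h
    · exact absurd ht₁ (not_le.2 (key t₁ h))
    · have := G.ordered_mono hi i h
      omega
  obtain ⟨u, hu, h1, h2⟩ := hstep
  obtain ⟨out, ht, -⟩ := tr_step Y C x u i
  obtain ⟨b', hb', h3⟩ := ht.ordered_step h1 h2
  obtain rfl := (G.proposed_of_fixed hi hi hb').unique Y C x hb
  exact h3 a hab (List.mem_of_head? (hh (u + 1) (by omega)))

theorem Good.output_of_mem_buffer (G : Good Y C x)
    (hadv : ∀ E, ∃ e ≥ E, ¬ AdvOutput Y C x e) {i : Fin n} (hi : i ∉ C) {t : ℕ} {tx : Bits}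
    (h : tx ∈ (𝒩 t i).buffer) : ∃ t', tx ∈ output Y C x t' i := by
  classical
  by_contra! hc
  have hstep : ∀ u, tx ∈ (𝒩 u i).buffer → tx ∈ (𝒩 (u + 1) i).buffer ∧
      (𝒩 (u + 1) i).buffer.idxOf tx ≤ (𝒩 u i).buffer.idxOf tx ∧
      ((𝒩 (u + 1) i).buffer.idxOf tx = (𝒩 u i).buffer.idxOf tx →
        (𝒩 (u + 1) i).buffer.head? = (𝒩 u i).buffer.head?) := by
    intro u hu
    obtain ⟨out, ht, -⟩ := tr_step Y C x u i
    exact (ht.buffer_step hu).resolve_left (hc (u + 1))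
  have hmem : ∀ u ≥ t, tx ∈ (𝒩 u i).buffer := by
    intro u hu
    induction u, hu using Nat.le_induction with
    | base => exact h
    | succ u _ ih => exact (hstep u ih).1
  -- From the time at which the position of `tx` is minimal, position and head are constant.
  have hex : ∃ p, ∃ u ≥ t, (𝒩 u i).buffer.idxOf tx = p := ⟨_, t, le_rfl, rfl⟩
  obtain ⟨t₁, ht₁, hp⟩ := Nat.find_spec hex
  have hmin : ∀ u ≥ t, (𝒩 t₁ i).buffer.idxOf tx ≤ (𝒩 u i).buffer.idxOf tx := by
    intro u hu
    rw [hp]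
    exact Nat.find_min' hex ⟨u, hu, rfl⟩
  have hconst : ∀ u ≥ t₁, (𝒩 u i).buffer.idxOf tx = (𝒩 t₁ i).buffer.idxOf tx ∧
      (𝒩 u i).buffer.head? = (𝒩 t₁ i).buffer.head? := by
    intro u hu
    induction u, hu using Nat.le_induction with
    | base => exact ⟨rfl, rfl⟩
    | succ u hu ih =>
      obtain ⟨-, h1, h2⟩ := hstep u (hmem u (by omega))
      have h3 := hmin (u + 1) (by omega)
      exact ⟨by omega, (h2 (by omega)).trans ih.2⟩
  rcases hbuf : (𝒩 t₁ i).buffer with _ | ⟨a, l⟩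
  · have := hmem t₁ ht₁
    rw [hbuf] at this
    simp at this
  · exact G.head_changes hadv hi t₁ a fun u hu => by rw [(hconst u hu).2, hbuf]; rfl

theorem Good.liveness (G : Good Y C x) (hadv : ∀ E, ∃ e ≥ E, ¬ AdvOutput Y C x e) :
    Liveness Y C x := by
  intro i hi t tx h i' hi'
  have hm : tx ∈ (𝒩 (t + 1) i).buffer := by
    have hex : exec Y C x (t + 1) = applyLabel Y C x.1 (exec Y C x t) (x.2 t) := rfl
    unfold nodeAt
    rw [hex, h]
    simp [applyLabel, hi]
  obtain ⟨t', ht'⟩ := G.output_of_mem_buffer hadv hi hm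
  exact G.agreement i i' hi hi' t' tx ht'

end Trace

/-! ## Measurability -/

section Measurability

variable {n f : ℕ} (Y : System n f) (C : Finset (Fin n))

instance (n : ℕ) : MeasurableSingletonClass (Setup n) := ⟨fun _ => trivial⟩

instance (n : ℕ) : MeasurableSingletonClass (Label n) := ⟨fun _ => trivial⟩

theorem exec_congr {x y : Outcome n} {t : ℕ} (h1 : x.1 = y.1) (h2 : ∀ s < t, x.2 s = y.2 s) :
    exec Y C x t = exec Y C y t := by
  induction t with
  | zero => rfl
  | succ t ih =>
    rw [exec, exec, ih fun s hs => h2 s (by omega), h1, h2 t (by omega)]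

/-- A property that is determined by the state after each of the first `t` events is measurable. -/
theorem measurableSet_of_exec {P : Outcome n → Prop} (t : ℕ)
    (h : ∀ x y, (∀ t' ≤ t, exec Y C x t' = exec Y C y t') → P x → P y) :
    MeasurableSet {x | P x} := by
  let g : Outcome n → Setup n × (Fin t → Label n) := fun x => (x.1, fun s => x.2 s)
  have hg : Measurable g := by fun_prop
  have : {x | P x} = g ⁻¹' (g '' {x | P x}) := by
    refine Set.Subset.antisymm (Set.subset_preimage_image _ _) ?_
    rintro y ⟨x, hx, hxy⟩
    refine h x y (fun t' ht' => exec_congr Y C (Prod.ext_iff.1 hxy).1 fun s hs => ?_) hx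
    exact congrFun (Prod.ext_iff.1 hxy).2 ⟨s, by omega⟩
  rw [this]
  -- The keys and the first `t` events range over a countable set.
  exact hg (Set.to_countable _).measurableSet

theorem measurableSet_advOutput (e : ℕ) : MeasurableSet {x | AdvOutput Y C x e} := by
  have : {x | AdvOutput Y C x e} = ⋃ t, {x | ∃ i v, i ∉ C ∧
      (nodeAt Y C x t i).mvbaOut e = some v ∧
      (∀ t' < t, ∀ i', i' ∉ C → (nodeAt Y C x t' i').mvbaOut e = none) ∧
      ∀ i', i' ∉ C → (nodeAt Y C x t i').mvbaIn e ≠ some v} := by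
    ext x; simp only [Set.mem_ofPred_eq, Set.mem_iUnion]; rfl
  rw [this]
  refine MeasurableSet.iUnion fun t => measurableSet_of_exec Y C t fun x y h => ?_
  rintro ⟨i, v, hi, h1, h2, h3⟩
  unfold nodeAt at *
  refine ⟨i, v, hi, h t le_rfl ▸ h1, fun t' ht' => h t' ht'.le ▸ h2 t' ht', h t le_rfl ▸ h3⟩

theorem measurableSet_certifiedAtStart {j : Fin n} {s : ℕ} (hj : j ∉ C) (hs : 1 ≤ s) (e : ℕ) :
    MeasurableSet {x | CertifiedAtStart Y C j s e x} := by
  have : {x | CertifiedAtStart Y C j s e x} = ⋃ t, {x | Begun Y C x e t ∧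
      (∀ t' < t, ¬ Begun Y C x e t') ∧ Certified Y C x j s t} := by
    ext x; simp only [Set.mem_ofPred_eq, Set.mem_iUnion]; exact certifiedAtStart_iff hj hs
  rw [this]
  refine MeasurableSet.iUnion fun t => measurableSet_of_exec Y C t fun x y h => ?_
  rintro ⟨h1, h2, h3⟩
  unfold Begun Certified nodeAt at *
  exact ⟨h t le_rfl ▸ h1, fun t' ht' => h t' ht'.le ▸ h2 t' ht', h t le_rfl ▸ h3⟩

end Measurability

/-! ## Consequences of the quality of the MVBA instances -/

/-- The constant `β / p` is the fixed point of `y ↦ r * y + β`, so the errors of all steps add up to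
no more than this. -/
theorem le_pow_add_div {g : ℕ → ℝ≥0∞} {r p β : ℝ≥0∞} (hrp : r + p = 1) (hp : p ≠ 0)
    (h0 : g 0 ≤ 1) (h : ∀ k, g (k + 1) ≤ r * g k + β) (k : ℕ) : g k ≤ r ^ k + β / p := by
  have hp' : p ≠ ∞ := by rintro rfl; simp at hrp
  induction k with
  | zero => exact h0.trans (by simp)
  | succ k ih =>
    calc g (k + 1) ≤ r * (r ^ k + β / p) + β := (h k).trans (by gcongr)
      _ = r ^ (k + 1) + (r * (β / p) + p * (β / p)) := by
        rw [ENNReal.mul_div_cancel hp hp', mul_add, pow_succ, mul_comm (r ^ k), add_assoc]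
      _ = r ^ (k + 1) + β / p := by rw [← add_mul, hrp, one_mul]

section Quality

variable {n f : ℕ} {Y : System n f} {C : Finset (Fin n)} {μ : Measure (Outcome n)}
  {bad : Set (Outcome n)} {r p : ℝ≥0∞}

/-- An adversarial output presupposes that the instance begins, so `D` needs to agree with an event
of the record only on outcomes where it does. The exceptional part is kept intersected with `D`, so
that later its sum over disjoint events stays below `μ bad`. -/
theorem measure_inter_advOutput_le {e : ℕ} {D : Set (Outcome n)}
    (hQ : ∀ R, μ ({x ∈ History Y C e R | AdvOutput Y C x e} \ bad) ≤ r * μ (History Y C e R))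
    (R : Set ((Fin (e + 1) → Fin n → Fin n → ℕ) × Set (Fin e)))
    (hR : ∀ x, (∃ t, Begun Y C x e t) → (x ∈ D ↔
      ((fun e' : Fin (e + 1) => slotsAtStart Y C x e'), {e' : Fin e | AdvOutput Y C x e'}) ∈ R)) :
    μ (D ∩ {x | AdvOutput Y C x e}) ≤ r * μ D + μ (D ∩ {x | AdvOutput Y C x e} ∩ bad) := by
  have h1 : History Y C e R ⊆ D := fun x hx => (hR x hx.1).2 hx.2
  have h2 : (D ∩ {x | AdvOutput Y C x e}) \ bad ⊆
      {x ∈ History Y C e R | AdvOutput Y C x e} \ bad := by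
    rintro x ⟨⟨hx, ha⟩, hb⟩
    exact ⟨⟨⟨Begun.of_adv ha, (hR x (Begun.of_adv ha)).1 hx⟩, ha⟩, hb⟩
  calc μ (D ∩ {x | AdvOutput Y C x e})
      ≤ μ (((D ∩ {x | AdvOutput Y C x e}) \ bad) ∪ (D ∩ {x | AdvOutput Y C x e} ∩ bad)) := by
        rw [Set.sdiff_union_inter]
    _ ≤ μ ((D ∩ {x | AdvOutput Y C x e}) \ bad) + μ (D ∩ {x | AdvOutput Y C x e} ∩ bad) :=
        measure_union_le _ _
    _ ≤ r * μ D + μ (D ∩ {x | AdvOutput Y C x e} ∩ bad) := by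
        gcongr
        exact (measure_mono h2).trans ((hQ R).trans (by gcongr))

/-- For fixed `E` the bound `r ^ k + μ bad / p` on `k` adversarial outputs in a row is passed to the
limit in `k`. The events increase with `E`, so their union costs a supremum and no sum. -/
theorem measure_forall_advOutput_le [IsProbabilityMeasure μ] (hrp : r + p = 1) (hp : p ≠ 0)
    (hQ : ∀ e R, μ ({x ∈ History Y C e R | AdvOutput Y C x e} \ bad) ≤ r * μ (History Y C e R)) :
    μ {x | ∃ E, ∀ e ≥ E, AdvOutput Y C x e} ≤ μ bad / p := by
  have hr : r < 1 := by
    have hr' : r ≠ ∞ := by rintro rfl; simp at hrp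
    rw [← hrp]
    exact ENNReal.lt_add_right hr' hp
  have key : ∀ E k, μ {x | ∀ k' < k, AdvOutput Y C x (E + k')} ≤ r ^ k + μ bad / p := by
    intro E
    refine le_pow_add_div hrp hp prob_le_one fun k => ?_
    have h1 : {x | ∀ k' < k + 1, AdvOutput Y C x (E + k')} =
        {x | ∀ k' < k, AdvOutput Y C x (E + k')} ∩ {x | AdvOutput Y C x (E + k)} := by
      ext x
      simp only [Set.mem_ofPred_eq, Set.mem_inter_iff, Nat.forall_lt_succ_right]
    rw [h1]
    refine (measure_inter_advOutput_le (hQ (E + k))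
      {w | ∀ e' : Fin (E + k), E ≤ (e' : ℕ) → e' ∈ w.2} fun x _ => ?_).trans ?_
    · constructor
      · intro hx e' he'
        have := hx (e' - E) (by omega)
        rwa [Nat.add_sub_cancel' he'] at this
      · intro hx k' hk'
        exact hx ⟨E + k', by omega⟩ (by simp)
    · gcongr
      exact Set.inter_subset_right
  have hE : ∀ E, μ {x | ∀ e ≥ E, AdvOutput Y C x e} ≤ μ bad / p := by
    intro E
    have hlim : Filter.Tendsto (fun k => r ^ k + μ bad / p) Filter.atTop
        (nhds (0 + μ bad / p)) :=
      (ENNReal.tendsto_pow_atTop_nhds_zero_of_lt_one hr).add tendsto_const_nhds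
    rw [zero_add] at hlim
    refine ge_of_tendsto' hlim fun k => (measure_mono ?_).trans (key E k)
    exact fun x hx k' _ => hx _ (by omega)
  rw [Set.ofPred_exists, Monotone.measure_iUnion]
  · exact iSup_le hE
  · exact fun E E' h x hx e he => hx e (h.trans he)

/-- The instance of epoch `E + 1` is the first that begins when all honest nodes are certified for
slot `s` of `j`, and the outputs of this and the following instances, `k` in total, come from the
adversary. -/
def AdvRun (Y : System n f) (C : Finset (Fin n)) (j : Fin n) (s E k : ℕ) : Set (Outcome n) :=
  {x | (∀ e ≤ E, ¬ CertifiedAtStart Y C j s e x) ∧ CertifiedAtStart Y C j s (E + 1) x ∧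
    ∀ k' < k, AdvOutput Y C x (E + 1 + k')}

theorem measurableSet_advRun {j : Fin n} {s : ℕ} (hj : j ∉ C) (hs : 1 ≤ s) (E k : ℕ) :
    MeasurableSet (AdvRun Y C j s E k) := by
  have h1 := measurableSet_certifiedAtStart Y C hj hs
  have h2 := measurableSet_advOutput Y C
  unfold AdvRun
  simp only [Set.ofPred_and, Set.ofPred_forall]
  refine (MeasurableSet.iInter fun e => MeasurableSet.iInter fun _ => (h1 e).compl).inter
    ((h1 _).inter (MeasurableSet.iInter fun k' => MeasurableSet.iInter fun _ => h2 _))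

theorem pairwise_disjoint_advRun (j : Fin n) (s k : ℕ) :
    Pairwise (Function.onFun Disjoint fun E => AdvRun Y C j s E k) := by
  intro E E' hne
  refine Set.disjoint_left.2 fun x hx hx' => ?_
  rcases Nat.lt_or_gt_of_ne hne with h | h
  · exact hx'.1 (E + 1) h hx.2.1
  · exact hx.1 (E' + 1) h hx'.2.1

/-- The quality is applied for each starting index `E` separately and then summed. Since the events
are disjoint in `E`, the exceptional parts contribute at most `μ bad` per step, not once for every
`E`. Measurability of `AdvRun` is what allows this sum, as `bad` itself need not be measurable. -/
theorem measure_advRun_le [IsProbabilityMeasure μ] (hrp : r + p = 1) (hp : p ≠ 0)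
    (hQ : ∀ e R, μ ({x ∈ History Y C e R | AdvOutput Y C x e} \ bad) ≤ r * μ (History Y C e R))
    {j : Fin n} {s : ℕ} (hj : j ∉ C) (hs : 1 ≤ s) (k : ℕ) :
    ∑' E, μ (AdvRun Y C j s E k) ≤ r ^ k + μ bad / p := by
  have hsum : ∀ (ν : Measure (Outcome n)) k,
      ∑' E, ν (AdvRun Y C j s E k) ≤ ν Set.univ := fun ν k => by
    rw [← measure_iUnion (pairwise_disjoint_advRun j s k) (measurableSet_advRun hj hs · k)]
    exact measure_mono (Set.subset_univ _)
  refine le_pow_add_div (g := fun k => ∑' E, μ (AdvRun Y C j s E k)) hrp hp ?_ (fun k => ?_) k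
  · simpa using hsum μ 0
  have hstep : ∀ E, μ (AdvRun Y C j s E (k + 1)) ≤
      r * μ (AdvRun Y C j s E k) + μ.restrict bad (AdvRun Y C j s E (k + 1)) := by
    intro E
    have h1 : AdvRun Y C j s E (k + 1) =
        AdvRun Y C j s E k ∩ {x | AdvOutput Y C x (E + 1 + k)} := by
      ext x
      simp only [AdvRun, Set.mem_ofPred_eq, Set.mem_inter_iff, Nat.forall_lt_succ_right, and_assoc]
    rw [Measure.restrict_apply (measurableSet_advRun hj hs _ _), h1]
    refine measure_inter_advOutput_le (hQ (E + 1 + k))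
      -- The event `AdvRun Y C j s E k` as read off from the record at the beginning of instance `E
      -- + 1 + k`.
      {w | (∀ e' : Fin (E + 1 + k + 1), (e' : ℕ) ≤ E → ¬ ∀ i, i ∉ C → s ≤ w.1 e' i j) ∧
        (∀ i, i ∉ C → s ≤ w.1 ⟨E + 1, by omega⟩ i j) ∧
        ∀ e' : Fin (E + 1 + k), E + 1 ≤ (e' : ℕ) → e' ∈ w.2} fun x _ => ?_
    refine and_congr ?_ (and_congr Iff.rfl ?_)
    · exact ⟨fun hx e' he' => hx e' he', fun hx e he => hx ⟨e, by omega⟩ he⟩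
    · constructor
      · intro hx e' he'
        have := hx (e' - (E + 1)) (by omega)
        rwa [Nat.add_sub_cancel' he'] at this
      · intro hx k' hk'
        exact hx ⟨E + 1 + k', by omega⟩ (by simp)
  calc ∑' E, μ (AdvRun Y C j s E (k + 1))
      ≤ ∑' E, (r * μ (AdvRun Y C j s E k) + μ.restrict bad (AdvRun Y C j s E (k + 1))) :=
        ENNReal.tsum_le_tsum hstep
    _ = r * ∑' E, μ (AdvRun Y C j s E k) + ∑' E, μ.restrict bad (AdvRun Y C j s E (k + 1)) := by
        rw [ENNReal.tsum_add, ENNReal.tsum_mul_left]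
    _ ≤ r * ∑' E, μ (AdvRun Y C j s E k) + μ bad := by
        gcongr
        simpa using hsum (μ.restrict bad) (k + 1)

theorem measure_lt_instancesNeeded_le [IsProbabilityMeasure μ] (hrp : r + p = 1) (hp : p ≠ 0)
    (hQ : ∀ e R, μ ({x ∈ History Y C e R | AdvOutput Y C x e} \ bad) ≤ r * μ (History Y C e R))
    {j : Fin n} {s : ℕ} (hj : j ∉ C) (hs : 1 ≤ s) (m : ℕ) :
    μ {x | (m : ℕ∞) < instancesNeeded Y C x j s} ≤
      r ^ m + (μ {x | ¬ Good Y C x} + μ bad / p) := by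
  have hsub : {x | (m : ℕ∞) < instancesNeeded Y C x j s} ⊆
      {x | ¬ Good Y C x} ∪ ⋃ E, AdvRun Y C j s E m := by
    intro x hx
    by_cases G : Good Y C x
    · right
      obtain ⟨T, hT, hT'⟩ := G.exists_certified hj s
      obtain ⟨h1, h2⟩ := G.certifiedAtStart hj hs hT hT'
      refine Set.mem_iUnion.2 ⟨begunCount Y C x T, h1, h2, fun k' hk' => ?_⟩
      rw [add_assoc, add_comm 1]
      exact G.adv_of_lt_instancesNeeded hj hs hT hT' hx (by omega) (by omega)
    · exact Or.inl G
  calc μ {x | (m : ℕ∞) < instancesNeeded Y C x j s}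
      ≤ μ {x | ¬ Good Y C x} + ∑' E, μ (AdvRun Y C j s E m) :=
        (measure_mono hsub).trans ((measure_union_le _ _).trans (by
          gcongr; exact measure_iUnion_le _))
    _ ≤ μ {x | ¬ Good Y C x} + (r ^ m + μ bad / p) := by
        gcongr; exact measure_advRun_le hrp hp hQ hj hs m
    _ = _ := by ring

theorem measure_not_atomicBroadcast_le [IsProbabilityMeasure μ] (hrp : r + p = 1) (hp : p ≠ 0)
    (hQ : ∀ e R, μ ({x ∈ History Y C e R | AdvOutput Y C x e} \ bad) ≤ r * μ (History Y C e R)) :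
    μ {x | ¬ (Agreement Y C x ∧ TotalOrder Y C x ∧ Liveness Y C x)} ≤
      μ {x | ¬ Good Y C x} + μ bad / p := by
  refine (measure_mono fun x hx => ?_).trans ((measure_union_le {x | ¬ Good Y C x}
    {x | ∃ E, ∀ e ≥ E, AdvOutput Y C x e}).trans (by
      gcongr; exact measure_forall_advOutput_le hrp hp hQ))
  by_contra hc
  rw [Set.mem_union, not_or] at hc
  have G : Good Y C x := not_not.1 hc.1
  refine hx ⟨G.agreement, G.totalOrder, G.liveness ?_⟩
  have h := hc.2
  simp only [Set.mem_ofPred_eq] at h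
  push Not at h
  exact h

end Quality

/-- The layer-cake formula for a truncated extended natural number. -/
theorem toENNReal_min_eq_sum (a : ℕ∞) (M : ℕ) : ((min a M : ℕ∞) : ℝ≥0∞) =
    ∑ m ∈ Finset.range M, if (m : ℕ∞) < a then (1 : ℝ≥0∞) else 0 := by
  rw [Finset.sum_boole]
  induction a using ENat.recTopCoe with
  | top => rw [Finset.filter_true_of_mem fun m _ => ENat.natCast_lt_top m]; simp
  | coe k =>
    have : (Finset.range M).filter (fun m : ℕ => (m : ℕ∞) < (k : ℕ∞)) =
        Finset.range (min k M) := by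
      ext m; simp [and_comm]
    rw [this, Finset.card_range]
    rcases le_total k M with h | h
    · rw [min_eq_left h, min_eq_left (by exact_mod_cast h)]; simp
    · rw [min_eq_right h, min_eq_right (by exact_mod_cast h)]; simp

/-- Truncated expectation from a bound on the tails. -/
theorem lintegral_min_le {Ω : Type*} [MeasurableSpace Ω] {μ : Measure Ω} {K : Ω → ℕ∞}
    {r p ε : ℝ≥0∞} (hrp : r + p = 1) (h : ∀ m : ℕ, μ {x | (m : ℕ∞) < K x} ≤ r ^ m + ε) (M : ℕ) :
    ∫⁻ x, ((min (K x) M : ℕ∞) : ℝ≥0∞) ∂μ ≤ p⁻¹ + M * ε := by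
  have hp : p = 1 - r := by
    have hr' : r ≠ ∞ := by rintro rfl; simp at hrp
    exact ENNReal.eq_sub_of_add_eq hr' (by rw [add_comm, hrp])
  -- Measurability of `K` is not assumed, so the tail events are replaced by measurable supersets of
  -- the same measure.
  have hpt : ∀ x, ((min (K x) M : ℕ∞) : ℝ≥0∞) ≤ ∑ m ∈ Finset.range M,
      (toMeasurable μ {x | (m : ℕ∞) < K x}).indicator 1 x := by
    intro x
    have h1 : ∀ m ∈ Finset.range M, (if (m : ℕ∞) < K x then (1 : ℝ≥0∞) else 0) ≤
        (toMeasurable μ {x | (m : ℕ∞) < K x}).indicator 1 x := by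
      intro m _
      split_ifs with hm
      · rw [Set.indicator_of_mem (subset_toMeasurable μ {x | (m : ℕ∞) < K x} hm)]; rfl
      · exact zero_le
    rw [toENNReal_min_eq_sum]
    exact Finset.sum_le_sum h1
  calc ∫⁻ x, ((min (K x) M : ℕ∞) : ℝ≥0∞) ∂μ
      ≤ ∫⁻ x, ∑ m ∈ Finset.range M, (toMeasurable μ {x | (m : ℕ∞) < K x}).indicator 1 x ∂μ :=
        lintegral_mono hpt
    _ = ∑ m ∈ Finset.range M, μ {x | (m : ℕ∞) < K x} := by
        rw [lintegral_finsetSum _ fun m _ =>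
          measurable_one.indicator (measurableSet_toMeasurable _ _)]
        refine Finset.sum_congr rfl fun m _ => ?_
        rw [lintegral_indicator_one (measurableSet_toMeasurable _ _), measure_toMeasurable]
    _ ≤ ∑ m ∈ Finset.range M, (r ^ m + ε) := Finset.sum_le_sum fun m _ => h m
    _ = ∑ m ∈ Finset.range M, r ^ m + M * ε := by simp [Finset.sum_add_distrib]
    _ ≤ p⁻¹ + M * ε := by
        gcongr
        rw [hp, ← ENNReal.tsum_geometric]
        exact ENNReal.sum_le_tsum _

/-! ## Negligible functions -/

theorem Negligible.mono {ε δ : ℕ → ℝ≥0∞} (h : Negligible δ) (hle : ∀ l, ε l ≤ δ l) :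
    Negligible ε := fun c => (h c).imp fun _ hN l hl => (hle l).trans (hN l hl)

/-- Use the exponent `c + 1`; for `l ≥ a` the additional factor `l` absorbs the constant. -/
theorem Negligible.const_mul {ε : ℕ → ℝ≥0∞} (h : Negligible ε) {a : ℝ≥0∞} (ha : a ≠ ∞) :
    Negligible fun l => a * ε l := by
  intro c
  obtain ⟨N, hN⟩ := h (c + 1)
  obtain ⟨k, hk⟩ := ENNReal.exists_nat_gt ha
  refine ⟨max N (max k 1), fun l hl => ?_⟩
  have h1 : (l : ℝ≥0∞) ≠ 0 := by
    have : l ≠ 0 := by omega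
    exact_mod_cast this
  have h2 : a ≤ l := hk.le.trans (by exact_mod_cast (by omega : k ≤ l))
  calc a * ε l ≤ l * ((l : ℝ≥0∞) ^ (c + 1))⁻¹ := by
        gcongr
        exact hN l (by omega)
    _ = ((l : ℝ≥0∞) ^ c)⁻¹ := by
        rw [pow_succ, ENNReal.mul_inv (Or.inr (ENNReal.natCast_ne_top l)) (Or.inr h1), mul_comm,
          mul_assoc, ENNReal.inv_mul_cancel h1 (ENNReal.natCast_ne_top l), mul_one]

theorem Negligible.add {ε δ : ℕ → ℝ≥0∞} (h : Negligible ε) (h' : Negligible δ) :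
    Negligible fun l => ε l + δ l := by
  have key : Negligible fun l => 2 * max (ε l) (δ l) := by
    refine Negligible.const_mul (fun c => ?_) (by simp)
    obtain ⟨N, hN⟩ := h c
    obtain ⟨N', hN'⟩ := h' c
    exact ⟨max N N', fun l hl => max_le (hN l (by omega)) (hN' l (by omega))⟩
  refine key.mono fun l => ?_
  rw [two_mul]
  exact add_le_add (le_max_left _ _) (le_max_right _ _)

/-! ## The keys -/

section Keys

variable {n t : ℕ} {E : Ensemble n} {sig : ThresholdSig n t} {hash : HashFamily}

theorem measurableSet_setup (P : Setup n → Prop) : MeasurableSet {x : Outcome n | P x.1} :=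
  measurable_fst (MeasurableSpace.measurableSet_top (s := {S | P S}))

theorem Ensemble.HonestSetup.keys_law (h : E.HonestSetup sig hash) (l : ℕ)
    (K : Bits × (Fin n → Bits)) : E.law l {x | (x.1.pk, x.1.sk) = K} = sig.gen l K := by
  have h1 : {x : Outcome n | (x.1.pk, x.1.sk) = K} =
      ⋃ hk : Bits, {x | x.1 = ⟨K.1, K.2, hk⟩} := by
    ext x
    rw [Set.mem_iUnion]
    constructor
    · rintro rfl; exact ⟨x.1.hk, rfl⟩
    · rintro ⟨hk, hx⟩
      have hx' : x.1 = ⟨K.1, K.2, hk⟩ := hx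
      simp [hx']
  rw [h1, measure_iUnion]
  · simp_rw [h l]
    rw [ENNReal.tsum_mul_left, PMF.tsum_coe, mul_one]
  · intro a b hab
    refine Set.disjoint_left.2 fun x hx hx' => hab ?_
    exact congrArg Setup.hk ((show x.1 = _ from hx).symm.trans (show x.1 = _ from hx'))
  · exact fun _ => measurableSet_setup fun S => S = _

theorem Ensemble.HonestSetup.hashKey_law (h : E.HonestSetup sig hash) (l : ℕ) (hk : Bits) :
    E.law l {x | x.1.hk = hk} = hash.gen l hk := by
  have h1 : {x : Outcome n | x.1.hk = hk} =
      ⋃ K : Bits × (Fin n → Bits), {x | x.1 = ⟨K.1, K.2, hk⟩} := by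
    ext x
    rw [Set.mem_iUnion]
    constructor
    · rintro rfl; exact ⟨(x.1.pk, x.1.sk), rfl⟩
    · rintro ⟨K, hx⟩
      have hx' : x.1 = ⟨K.1, K.2, hk⟩ := hx
      simp [hx']
  rw [h1, measure_iUnion]
  · simp_rw [h l]
    rw [ENNReal.tsum_mul_right, PMF.tsum_coe, one_mul]
  · intro a b hab
    refine Set.disjoint_left.2 fun x hx hx' => hab ?_
    have := (show x.1 = _ from hx).symm.trans (show x.1 = _ from hx')
    exact Prod.ext (congrArg Setup.pk this) (congrArg Setup.sk this)
  · exact fun _ => measurableSet_setup fun S => S = _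

/-- Correctness of the signature scheme is only available for keys in the support. There are
countably many keys, so the exceptional ones form a null set. -/
theorem Ensemble.HonestSetup.keys_mem_support (h : E.HonestSetup sig hash) (l : ℕ) :
    E.law l {x | (x.1.pk, x.1.sk) ∉ (sig.gen l).support} = 0 := by
  have h1 : {x : Outcome n | (x.1.pk, x.1.sk) ∉ (sig.gen l).support} =
      ⋃ K ∈ (sig.gen l).supportᶜ, {x | (x.1.pk, x.1.sk) = K} := by
    ext x
    simp
  rw [h1, measure_biUnion_null_iff (Set.to_countable _)]
  intro K hK
  rw [h.keys_law]
  exact (PMF.apply_eq_zero_iff _ _).2 hK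

end Keys

/-! ### Reduction of bad outcomes to attacks, and the final assembly -/

theorem Ensemble.negligible_not_good {n f B : ℕ} (hf : 3 * f < n) (hB : 0 < B)
    {sig : ThresholdSig n (n - f)} {hash : HashFamily} {code : ErasureCode (n - 2 * f) n}
    {𝓟 : AttackClass n} (hsig : UnforgeableAgainst sig 𝓟.forgers)
    (hhash : CollisionResistantAgainst hash 𝓟.finders)
    {Y : System n f} (hY : Y = ⟨B, sig.toSigAlg, hash.eval, code⟩) {E : Ensemble n}
    (hcorrupt : ∀ l, (E.corrupt l).card ≤ f) (hsetup : E.HonestSetup sig hash)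
    (hfair : ∀ l, ∀ᵐ x ∂(E.law l), Fair Y (E.corrupt l) x) (heff : E.Efficient Y 𝓟)
    {bad : ℕ → Set (Outcome n)} (hbad : Negligible fun l => E.law l (bad l))
    (hsafe : ∀ l x, x ∉ bad l → ∀ e, MvbaSafe Y (E.corrupt l) x e) :
    Negligible fun l => E.law l {x | ¬ Good Y (E.corrupt l) x} := by
  -- At most `f < n - f` signers are corrupted, fewer than the threshold.
  have h1 := hsig _ heff.1 (fun l K => hsetup.keys_law l K) fun l =>
    (hcorrupt l).trans_lt (by omega)
  have h2 := hhash _ heff.2 fun l k => hsetup.hashKey_law l k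
  refine ((h1.add h2).add hbad).mono fun l => ?_
  have h0 : E.law l ({x | ¬ Fair Y (E.corrupt l) x} ∪
      {x | (x.1.pk, x.1.sk) ∉ (sig.gen l).support}) = 0 :=
    measure_union_null (hfair l) (hsetup.keys_mem_support l)
  have hunion : ∀ A F D N : Set (Outcome n), E.law l A = 0 →
      E.law l (A ∪ (F ∪ D) ∪ N) ≤ E.law l F + E.law l D + E.law l N := by
    intro A F D N hA
    have h3 := measure_union_le (μ := E.law l) A (F ∪ D)
    rw [hA, zero_add] at h3
    exact (measure_union_le _ _).trans (by gcongr; exact h3.trans (measure_union_le _ _))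
  refine (measure_mono fun x hx => ?_).trans (hunion _
    {x | ∃ t m σ, (m, σ) ∈ shownSigs Y (E.corrupt l) x t ∧ sig.verify x.1.pk m σ = true ∧
      ({i | i ∈ E.corrupt l ∨ (i ∉ E.corrupt l ∧ m ∈ (nodeAt Y (E.corrupt l) x t i).signed)} :
        Set (Fin n)).ncard < n - f}
    {x | ∃ a b, (a, b) ∈ shownPairs Y (E.corrupt l) x ∧ a ≠ b ∧
      hash.eval x.1.hk a = hash.eval x.1.hk b} (bad l) h0)
  by_contra hc
  simp only [Set.mem_union, not_or] at hc
  obtain ⟨⟨⟨hF, hK⟩, hS, hC⟩, hb⟩ := hc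
  have hF : Fair Y (E.corrupt l) x := not_not.1 hF
  have hK : (x.1.pk, x.1.sk) ∈ (sig.gen l).support := not_not.1 hK
  subst hY
  refine hx ⟨hcorrupt l, hf, hB, hF, fun t m σ hm hv => ?_, fun a b hm he => ?_, hsafe l x hb,
    sig.share_correct l _ hK, sig.combine_correct l _ hK⟩
  · by_contra hlt
    exact hS ⟨t, m, σ, hm, hv, not_le.1 hlt⟩
  · by_contra hab
    exact hC ⟨a, b, hm, hab, he⟩

end DumboNG

open DumboNG in
theorem mainTheorem1 (n f B : ℕ) (hf : 3 * f < n) (hB : 0 < B) (q : ℝ) (hq0 : 0 < q) (hq1 : q ≤ 1)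
    (sig : ThresholdSig n (n - f)) (hash : HashFamily) (code : ErasureCode (n - 2 * f) n)
    (𝓟 : AttackClass n)
    (hsig : UnforgeableAgainst sig 𝓟.forgers)
    (hhash : CollisionResistantAgainst hash 𝓟.finders)
    (Y : System n f) (hY : Y = ⟨B, sig.toSigAlg, hash.eval, code⟩)
    (E : Ensemble n)
    (hcorrupt : ∀ l, (E.corrupt l).card ≤ f)
    (hsetup : E.HonestSetup sig hash)
    (hfair : ∀ l, ∀ᵐ x ∂(E.law l), Fair Y (E.corrupt l) x)
    (heff : E.Efficient Y 𝓟)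
    (hmvba : E.MvbaSecure Y q) :
    (Negligible fun l => E.law l {x | ¬ (Agreement Y (E.corrupt l) x ∧
      TotalOrder Y (E.corrupt l) x ∧ Liveness Y (E.corrupt l) x)}) ∧
    ∃ ε : ℕ → ℝ≥0∞, Negligible ε ∧
      ∀ (l : ℕ) (j : Fin n), j ∉ E.corrupt l → ∀ s : ℕ, 1 ≤ s →
        (∀ m : ℕ, E.law l {x | (m : ℕ∞) < instancesNeeded Y (E.corrupt l) x j s} ≤
          ENNReal.ofReal ((1 - q) ^ m) + ε l) ∧
        ∀ M : ℕ, ∫⁻ x, ((min (instancesNeeded Y (E.corrupt l) x j s) M : ℕ∞) : ℝ≥0∞) ∂(E.law l) ≤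
          ENNReal.ofReal (1 / q) + M * ε l := by
  obtain ⟨bad, hbad, hsafe, hQ⟩ := hmvba
  have hrp : ENNReal.ofReal (1 - q) + ENNReal.ofReal q = 1 := by
    rw [← ENNReal.ofReal_add (by linarith) hq0.le, sub_add_cancel, ENNReal.ofReal_one]
  have hp : ENNReal.ofReal q ≠ 0 := by simpa using hq0
  have hgood := E.negligible_not_good hf hB hsig hhash hY hcorrupt hsetup hfair heff hbad hsafe
  -- One error term serves all claims. It depends neither on the broadcast nor on the slot, because
  -- `Good` and `bad` refer to whole outcomes.
  have hε : Negligible fun l => E.law l {x | ¬ Good Y (E.corrupt l) x} +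
      E.law l (bad l) / ENNReal.ofReal q :=
    hgood.add ((hbad.const_mul (ENNReal.inv_ne_top.2 hp)).mono fun l => by
      rw [div_eq_mul_inv, mul_comm])
  refine ⟨hε.mono fun l => ?_, _, hε, fun l j hj s hs => ?_⟩
  · have := E.isProb l
    exact measure_not_atomicBroadcast_le hrp hp (hQ l)
  · have := E.isProb l
    have key := measure_lt_instancesNeeded_le hrp hp (hQ l) hj hs
    refine ⟨fun m => ?_, fun M => ?_⟩
    · rw [ENNReal.ofReal_pow (by linarith)]
      exact key m
    · rw [one_div, ENNReal.ofReal_inv_of_pos hq0]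
      exact lintegral_min_le hrp key M
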